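/- Let $n\ge 1$ be an integer and let $\kappa,\beta$ be real numbers with $\kappa>n-1$ and $\beta>0$. The $\beta$-Laguerre ensemble $L_\beta$ is the probability law on points $\lambda_1,\dots,\lambda_n\in(0,\infty)$ with joint density (with respect to Lebesgue measure on $(0,\infty)^n$) $$\frac{1}{Z_{n,\kappa,\beta}}\prod_{1\le j<k\le n}|\lambda_j-\lambda_k|^{\beta}\ \prod_{k=1}^n\lambda_k^{\frac{\beta}{2}(\kappa-n+1)-1}e^{-\beta\lambda_k/2},$$ where $Z_{n,\kappa,\beta}$ is the normalising constant, and $\lambda_{\max}(L_\beta)=\max_{1\le k\le n}\lambda_k$. There is a numerical constant $C>0$ such that for all integers $n\ge1$ and all real $\kappa,\varepsilon,\beta$ with $\kappa+1>n$, $0<\varepsilon\le1$ and $\beta\ge1$, $$\mathbb P\Bigl(\lambda_{\max}(L_\beta)\ge(\sqrt\kappa+\sqrt n)^2(1+\varepsilon)\Bigr)\le C\exp\Bigl(-\frac{\beta}{C}\sqrt{n\kappa}\;\varepsilon^{3/2}\min\Bigl\{\frac1{\sqrt\varepsilon},\Bigl(\frac\kappa n\Bigr)^{1/4}\Bigr\}\Bigr)$$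 and $$\mathbb P\Bigl(\lambda_{\max}(L_\beta)\le(\sqrt\kappa+\sqrt n)^2(1-\varepsilon)\Bigr)\le C^{\beta}\exp\Bigl(-\frac{\beta}{C}\,n\kappa\,\varepsilon^{3}\min\Bigl\{\frac1\varepsilon,\Bigl(\frac\kappa n\Bigr)^{1/2}\Bigr\}\Bigr).$$ -/

import Mathlib

open MeasureTheory

/-- Unnormalised joint density of the `β`-Laguerre ensemble of `n` points with real parameter
`κ > n - 1`, at a configuration `x` of positive points:
`∏_{i < j} |x i - x j| ^ β * ∏_i (x i) ^ ((β / 2) (κ - n + 1) - 1) * exp (-β (x i) / 2)`. -/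
noncomputable def laguerreDensity (n : ℕ) (κ β : ℝ) (x : Fin n → ℝ) : ℝ :=
  (∏ i, ∏ j ∈ Finset.Ioi i, |x i - x j| ^ β) *
    ∏ i, (x i ^ (β / 2 * (κ - n + 1) - 1) * Real.exp (-(β / 2) * x i))

/-- The measure on `ℝⁿ`, carried by the open positive orthant, which has there the density
`laguerreDensity n κ β` with respect to Lebesgue measure. -/
noncomputable def laguerreWeight (n : ℕ) (κ β : ℝ) : Measure (Fin n → ℝ) :=
  (volume.restrict (Set.univ.pi fun _ => Set.Ioi 0)).withDensity
    fun x => ENNReal.ofReal (laguerreDensity n κ β x)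

/-- The `β`-Laguerre ensemble `L_β`: the law of the points `λ₁, …, λₙ`, that is, the measure
`laguerreWeight n κ β` divided by its total mass. -/
noncomputable def laguerreEnsemble (n : ℕ) (κ β : ℝ) : Measure (Fin n → ℝ) :=
  (laguerreWeight n κ β Set.univ)⁻¹ • laguerreWeight n κ β

/-- The largest point `λ_max` of a configuration of `n ≥ 1` points. -/
noncomputable def largestPoint {n : ℕ} (x : Fin n → ℝ) : ℝ := ⨆ i, x i

theorem measurable_laguerreDensity (n : ℕ) (κ β : ℝ) : Measurable (laguerreDensity n κ β) := by
  unfold laguerreDensity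
  fun_prop

theorem laguerreWeight_univ_ne_top (n : ℕ) {κ β : ℝ} (hκ : (n : ℝ) < κ + 1) (hβ : 0 < β) :
    laguerreWeight n κ β Set.univ ≠ ⊤ := by
  obtain ⟨a, ha⟩ : ∃ a : ℝ, β / 2 * (κ - n + 1) - 1 = a := ⟨_, rfl⟩
  have ha1 : -1 < a := by
    have : 0 < β / 2 * (κ - n + 1) := by apply mul_pos <;> linarith
    linarith
  obtain ⟨N, hN⟩ : ∃ N : ℕ, N = ∑ i : Fin n, (Finset.Ioi i).card := ⟨_, rfl⟩
  let g : ℝ → ℝ := fun t => ((1 + t) ^ β) ^ N * (t ^ a * Real.exp (-(β / 2) * t))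
  have hgm : Measurable g := by fun_prop
  have hb : (0 : ℝ) < β / 2 := by linarith
  have hint : ∀ s : ℝ, -1 < s →
      IntegrableOn (fun t : ℝ => t ^ s * Real.exp (-(β / 2) * t)) (Set.Ioi 0) := by
    intro s hs
    have h := integrableOn_rpow_mul_exp_neg_mul_rpow hs (zero_lt_one' ℝ) hb
    simp only [Real.rpow_one] at h
    exact h
  have hM : 0 ≤ β * N := by positivity
  have hg : IntegrableOn g (Set.Ioi 0) := by
    refine Integrable.mono'
      (((hint a ha1).add (hint (a + β * N) (by linarith))).const_mul (2 ^ (β * N)))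
      hgm.aestronglyMeasurable ?_
    filter_upwards [ae_restrict_mem measurableSet_Ioi] with t ht
    have ht : 0 < t := ht
    have h1 : ((1 + t) ^ β) ^ N ≤ 2 ^ (β * N) * (1 + t ^ (β * N)) := by
      rw [← Real.rpow_natCast, ← Real.rpow_mul (by positivity)]
      rcases le_total t 1 with h | h
      · calc (1 + t) ^ (β * N) ≤ 2 ^ (β * N) :=
              Real.rpow_le_rpow (by positivity) (by linarith) hM
          _ ≤ 2 ^ (β * N) * (1 + t ^ (β * N)) :=
              le_mul_of_one_le_right (by positivity)
                (le_add_of_nonneg_right (by positivity))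
      · calc (1 + t) ^ (β * N) ≤ (2 * t) ^ (β * N) :=
              Real.rpow_le_rpow (by positivity) (by linarith) hM
          _ = 2 ^ (β * N) * t ^ (β * N) := Real.mul_rpow (by norm_num) ht.le
          _ ≤ 2 ^ (β * N) * (1 + t ^ (β * N)) := by gcongr; linarith
    rw [Real.norm_of_nonneg (by positivity)]
    calc g t ≤ 2 ^ (β * N) * (1 + t ^ (β * N)) * (t ^ a * Real.exp (-(β / 2) * t)) := by
          simp only [g]; gcongr
      _ = _ := by simp only [Pi.add_apply]; rw [Real.rpow_add ht]; ring
  have hprod : Integrable (fun x : Fin n → ℝ => ∏ i, g (x i))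
      (volume.restrict (Set.univ.pi fun _ => Set.Ioi 0)) := by
    rw [volume_pi, Measure.restrict_pi_pi]
    exact Integrable.fintype_prod (fun _ => hg)
  have hdens : Integrable (laguerreDensity n κ β)
      (volume.restrict (Set.univ.pi fun _ => Set.Ioi 0)) := by
    refine hprod.mono' (measurable_laguerreDensity n κ β).aestronglyMeasurable ?_
    filter_upwards [ae_restrict_mem (MeasurableSet.univ_pi fun _ => measurableSet_Ioi)] with x hx
    have hx : ∀ i, 0 < x i := fun i => hx i (Set.mem_univ i)
    have hw : ∀ i, 0 ≤ x i ^ a * Real.exp (-(β / 2) * x i) := fun i => by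
      have := hx i
      positivity
    have hle : ∀ i j, i ≠ j → |x i - x j| ^ β ≤ ∏ k, (1 + x k) ^ β := by
      intro i j hij
      have hone : ∀ k, (1 : ℝ) ≤ (1 + x k) ^ β := fun k =>
        Real.one_le_rpow (by linarith [hx k]) hβ.le
      have hsub : ∏ k ∈ ({i, j} : Finset (Fin n)), (1 + x k) ^ β ≤ ∏ k, (1 + x k) ^ β :=
        Finset.prod_le_prod_of_subset_of_one_le (Finset.subset_univ _)
          (fun k _ => zero_le_one.trans (hone k)) (fun k _ _ => hone k)
      rw [Finset.prod_pair hij, ← Real.mul_rpow (by linarith [hx i]) (by linarith [hx j])] at hsub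
      refine le_trans (Real.rpow_le_rpow (abs_nonneg _) ?_ hβ.le) hsub
      rw [abs_le]
      constructor <;> nlinarith [hx i, hx j, mul_pos (hx i) (hx j)]
    have hV : ∏ i, ∏ j ∈ Finset.Ioi i, |x i - x j| ^ β ≤ (∏ k, (1 + x k) ^ β) ^ N := by
      rw [hN, ← Finset.prod_pow_eq_pow_sum]
      refine Finset.prod_le_prod (fun i _ => Finset.prod_nonneg fun j _ => by positivity)
        fun i _ => ?_
      refine (Finset.prod_le_prod (fun j _ => by positivity) fun j hj =>
        hle i j (Finset.mem_Ioi.1 hj).ne).trans ?_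
      rw [Finset.prod_const]
    have hnn : 0 ≤ laguerreDensity n κ β x :=
      mul_nonneg (Finset.prod_nonneg fun i _ => Finset.prod_nonneg fun j _ => by positivity)
        (Finset.prod_nonneg fun i _ => by rw [ha]; exact hw i)
    rw [Real.norm_of_nonneg hnn]
    simp only [g, laguerreDensity, ha]
    rw [Finset.prod_mul_distrib (f := fun i => ((1 + x i) ^ β) ^ N), Finset.prod_pow]
    exact mul_le_mul_of_nonneg_right hV (Finset.prod_nonneg fun i _ => hw i)
  rw [laguerreWeight, withDensity_apply _ MeasurableSet.univ, Measure.restrict_univ]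
  exact hdens.lintegral_lt_top.ne

theorem laguerreWeight_univ_ne_zero (n : ℕ) (κ β : ℝ) :
    laguerreWeight n κ β Set.univ ≠ 0 := by
  have hm : Measurable fun x => ENNReal.ofReal (laguerreDensity n κ β x) :=
    (measurable_laguerreDensity n κ β).ennreal_ofReal
  have hS : MeasurableSet (Set.univ.pi fun _ : Fin n => Set.Ioi (0 : ℝ)) :=
    MeasurableSet.univ_pi fun _ => measurableSet_Ioi
  rw [laguerreWeight, withDensity_apply _ MeasurableSet.univ, Measure.restrict_univ]
  refine (lt_of_lt_of_le ?_ (measure_mono ?_ :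
    volume (Set.univ.pi fun i : Fin n => Set.Ioo ((i : ℝ) + 1) (i + 2)) ≤ _) |>.trans_eq rfl |>
      (setLIntegral_pos_iff hm).2).ne'
  · rw [volume_pi, Measure.pi_pi]
    norm_num
  · intro x hx
    have hx : ∀ i : Fin n, (i : ℝ) + 1 < x i ∧ x i < i + 2 := fun i => hx i (Set.mem_univ i)
    have hpos : ∀ i, 0 < x i := fun i => by
      have := (hx i).1
      have : (0 : ℝ) ≤ (i : ℕ) := Nat.cast_nonneg _
      linarith
    refine ⟨?_, fun i _ => hpos i⟩
    have : 0 < laguerreDensity n κ β x := by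
      refine mul_pos (Finset.prod_pos fun i _ => Finset.prod_pos fun j hj => ?_)
        (Finset.prod_pos fun i _ => mul_pos (Real.rpow_pos_of_pos (hpos i) _) (Real.exp_pos _))
      have hij : ((i : ℕ) : ℝ) + 1 ≤ (j : ℕ) := by
        exact_mod_cast Finset.mem_Ioi.1 hj
      refine Real.rpow_pos_of_pos (abs_pos.2 ?_) _
      have h1 := (hx i).2
      have h2 := (hx j).1
      linarith
    simpa [Function.mem_support] using this

/-- The normalisation is legitimate: for `κ > n - 1` and `β > 0` the total mass is positive and
finite, so that the `β`-Laguerre ensemble is a probability measure. -/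
theorem isProbabilityMeasure_laguerreEnsemble (n : ℕ) {κ β : ℝ} (hκ : (n : ℝ) < κ + 1)
    (hβ : 0 < β) : IsProbabilityMeasure (laguerreEnsemble n κ β) := by
  refine ⟨?_⟩
  rw [laguerreEnsemble, Measure.smul_apply, smul_eq_mul]
  exact ENNReal.inv_mul_cancel (laguerreWeight_univ_ne_zero n κ β)
    (laguerreWeight_univ_ne_top n hκ hβ)

/-!
Both tails are read off from the joint density, by integration by parts ("loop equations") and
without any matrix model. Points in `(0, t)` are rescaled to the unit cube, where they carry the
weight `∏ |y i - y j| ^ β ∏ (y i) ^ a (1 - y i) ^ s exp (-θ y i)` with `θ = β t / 2`; then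
derivatives in `t` are moments of `∑ y`, and `loop_equation` gives relations between expectations.

*Upper tail.* The density of the largest of `n + 1` points is, up to a constant,
`t ^ a exp (-β t / 2) φ(t)` with `a = β / 2 * (κ - n) - 1`, where `φ` is the partition function of
`n` points in `(0, t)` repelled from `t` with exponent `s = β`. A vector field with poles at the
face `y i = 1` yields an inequality for the first two moments of `∑ y` (`upperEdge_inequality`),
that is, with `K = κ - n`, `t² φ'' ≥ β (t - K) t φ' - β² n (t + 1 / 3) φ`. Beyond the edge its
characteristic quadratic has two real roots, and `φ' / φ` must stay below `β` times any value
between them: above it, it would stay above, and `φ` would grow exponentially although it is at most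
a power of `t` (`deriv_le_of_differential_inequality`). Taken a distance `ρ` below the midpoint of
the roots, this is a decay of the density at rate `β ρ`, and the discriminant of the quadratic,
essentially `(t - (√κ - √N)²) (t - b)` with `N = n + 1` and `b = (√κ + √N)²`, turns it into the tail
bound.

*Lower tail.* Let `F` be the distribution function of the largest of `n` points. With `s = 0`,
scaling gives `t F' / F = (β / 2) (n κ - t E[∑ y])`. For `ζ > 1`, the loop equation along
`y i (1 - y i) / (ζ - y i)`, which vanishes at the wall, identifies `n κ - t E[∑ y]` with
`(ζ - 1) E[Q]`, where `Q` is the quadratic polynomial in the resolvent `∑ (ζ - y j)⁻¹` whose roots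
describe the limiting shape, plus a multiple of the derivative of the resolvent
(`hardWall_loop_equation`). If `t` is below the edge, this quadratic has no real root for `t ζ`
slightly below `b = (√κ + √n)²`. Integrating in `ζ` against a squared bump function, one can
integrate the derivative term by parts and complete the square (`integral_loopQuadratic_ge`); the
bump costs a kinetic term, which is affordable as soon as the window is longer than the fluctuation
scale of the edge. This bounds the logarithmic derivative of `F` from below (`drift_ge_below_edge`),
and integrating over `t ∈ [b (1 - ε), b (1 - ε / 2)]` gives the bound. Far from the edge it suffices
that all points are below `t`, and when the exponent is of order `β` the factor `C ^ β` makes the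
bound trivial.
-/

/-! ### The Gibbs weight on the unit cube -/

/-- The open unit cube `(0, 1)ⁿ`. -/
def unitCube (n : ℕ) : Set (Fin n → ℝ) := Set.univ.pi fun _ => Set.Ioo 0 1

/-- The repulsion factor `∏_{i < j} |y i - y j| ^ β`. -/
noncomputable def interaction {n : ℕ} (β : ℝ) (y : Fin n → ℝ) : ℝ :=
  ∏ i, ∏ j ∈ Finset.Ioi i, |y i - y j| ^ β

/-- The Gibbs weight `∏_{i < j} |y i - y j| ^ β * ∏_i (y i) ^ a * (1 - y i) ^ s * exp (-θ * y i)`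
on the unit cube. -/
noncomputable def gibbsWeight {n : ℕ} (a s β θ : ℝ) (y : Fin n → ℝ) : ℝ :=
  interaction β y * ∏ i, (y i ^ a * (1 - y i) ^ s * Real.exp (-θ * y i))

section Weights

variable {n : ℕ}

theorem measurableSet_unitCube : MeasurableSet (unitCube n) :=
  MeasurableSet.univ_pi fun _ => measurableSet_Ioo

theorem unitCube_pos {y : Fin n → ℝ} (hy : y ∈ unitCube n) (i : Fin n) : 0 < y i :=
  (hy i (Set.mem_univ i)).1

theorem unitCube_lt_one {y : Fin n → ℝ} (hy : y ∈ unitCube n) (i : Fin n) : y i < 1 :=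
  (hy i (Set.mem_univ i)).2

theorem update_mem_unitCube {y : Fin n → ℝ} (hy : y ∈ unitCube n) (i : Fin n) {u : ℝ}
    (hu : u ∈ Set.Ioo (0 : ℝ) 1) : Function.update y i u ∈ unitCube n := by
  intro j _
  rcases eq_or_ne j i with rfl | h
  · simpa using hu
  · simpa [Function.update_of_ne h] using hy j (Set.mem_univ j)

theorem measurable_interaction (β : ℝ) : Measurable (interaction (n := n) β) := by
  unfold interaction
  fun_prop

theorem measurable_gibbsWeight (a s β θ : ℝ) : Measurable (gibbsWeight (n := n) a s β θ) := by
  unfold gibbsWeight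
  have := measurable_interaction (n := n) β
  fun_prop

theorem interaction_nonneg (β : ℝ) (y : Fin n → ℝ) : 0 ≤ interaction β y :=
  Finset.prod_nonneg fun _ _ => Finset.prod_nonneg fun _ _ => by positivity

theorem abs_sub_le_one_of_mem_unitCube {y : Fin n → ℝ} (hy : y ∈ unitCube n) (i j : Fin n) :
    |y i - y j| ≤ 1 := by
  have h1 := unitCube_pos hy i
  have h2 := unitCube_pos hy j
  have h3 := unitCube_lt_one hy i
  have h4 := unitCube_lt_one hy j
  rw [abs_le]
  constructor <;> linarith

/-- On the cube every factor of the repulsion is at most one, so that the product is at most any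
single factor. -/
theorem interaction_le_factor {β : ℝ} (hβ : 0 ≤ β) {y : Fin n → ℝ} (hy : y ∈ unitCube n)
    {i j : Fin n} (hij : i < j) : interaction β y ≤ |y i - y j| ^ β := by
  have h01 : ∀ k l : Fin n, |y k - y l| ^ β ≤ 1 := fun k l =>
    Real.rpow_le_one (abs_nonneg _) (abs_sub_le_one_of_mem_unitCube hy k l) hβ
  have h0 : ∀ k : Fin n, 0 ≤ ∏ l ∈ Finset.Ioi k, |y k - y l| ^ β := fun k =>
    Finset.prod_nonneg fun _ _ => by positivity
  have h1 : ∀ k : Fin n, ∏ l ∈ Finset.Ioi k, |y k - y l| ^ β ≤ 1 := fun k =>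
    Finset.prod_le_one (fun _ _ => by positivity) fun l _ => h01 k l
  unfold interaction
  rw [← Finset.mul_prod_erase _ _ (Finset.mem_univ i)]
  refine (mul_le_of_le_one_right (h0 i) (Finset.prod_le_one (fun k _ => h0 k)
    fun k _ => h1 k)).trans ?_
  rw [← Finset.mul_prod_erase _ _ (Finset.mem_Ioi.2 hij)]
  exact mul_le_of_le_one_right (by positivity)
    (Finset.prod_le_one (fun _ _ => by positivity) fun l _ => h01 i l)

theorem interaction_le_one {β : ℝ} (hβ : 0 ≤ β) {y : Fin n → ℝ} (hy : y ∈ unitCube n) :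
    interaction β y ≤ 1 :=
  Finset.prod_le_one (fun _ _ => Finset.prod_nonneg fun _ _ => by positivity) fun k _ =>
    Finset.prod_le_one (fun _ _ => by positivity) fun l _ =>
      Real.rpow_le_one (abs_nonneg _) (abs_sub_le_one_of_mem_unitCube hy k l) hβ

theorem interaction_eq_zero {β : ℝ} (hβ : β ≠ 0) {y : Fin n → ℝ} {i j : Fin n} (hij : i ≠ j)
    (h : y i = y j) : interaction β y = 0 := by
  wlog hlt : i < j generalizing i j
  · exact this hij.symm h.symm (lt_of_le_of_ne (not_lt.1 hlt) hij.symm)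
  unfold interaction
  refine Finset.prod_eq_zero (Finset.mem_univ i) (Finset.prod_eq_zero (Finset.mem_Ioi.2 hlt) ?_)
  rw [h, sub_self, abs_zero, Real.zero_rpow hβ]

/-- For `β ≥ 1` the repulsion absorbs a pole `1 / (y i - y j)`. -/
theorem interaction_mul_abs_inv_le_one {β : ℝ} (hβ : 1 ≤ β) {y : Fin n → ℝ}
    (hy : y ∈ unitCube n) {i j : Fin n} (hij : i < j) :
    interaction β y * |(y i - y j)⁻¹| ≤ 1 := by
  rcases eq_or_ne (y i) (y j) with h | h
  · simp [h]
  have hpos : 0 < |y i - y j| := abs_pos.2 (sub_ne_zero.2 h)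
  rw [abs_inv, ← div_eq_mul_inv, div_le_one hpos]
  refine (interaction_le_factor (by linarith) hy hij).trans ?_
  calc |y i - y j| ^ β ≤ |y i - y j| ^ (1 : ℝ) :=
        Real.rpow_le_rpow_of_exponent_ge hpos (abs_sub_le_one_of_mem_unitCube hy i j) hβ
    _ = _ := Real.rpow_one _

theorem gibbsWeight_nonneg {a s β θ : ℝ} {y : Fin n → ℝ} (hy : y ∈ unitCube n) :
    0 ≤ gibbsWeight a s β θ y :=
  mul_nonneg (interaction_nonneg β y) <| Finset.prod_nonneg fun i _ => by
    have h1 := unitCube_pos hy i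
    have h2 := unitCube_lt_one hy i
    have : 0 ≤ 1 - y i := by linarith
    positivity

theorem prod_rpow_mul_exp_le {a s θ : ℝ} (hθ : 0 ≤ θ) {y : Fin n → ℝ} (hy : y ∈ unitCube n) :
    ∏ i, (y i ^ a * (1 - y i) ^ s * Real.exp (-θ * y i)) ≤ ∏ i, (y i ^ a * (1 - y i) ^ s) := by
  refine Finset.prod_le_prod (fun i _ => ?_) fun i _ => ?_
  all_goals
    have h1 := unitCube_pos hy i
    have h2 := unitCube_lt_one hy i
    have h3 : 0 ≤ 1 - y i := by linarith
  · positivity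
  · refine mul_le_of_le_one_right (by positivity) (Real.exp_le_one_iff.2 ?_)
    nlinarith

theorem gibbsWeight_le {a s β θ : ℝ} (hβ : 0 ≤ β) (hθ : 0 ≤ θ) {y : Fin n → ℝ}
    (hy : y ∈ unitCube n) : gibbsWeight a s β θ y ≤ ∏ i, (y i ^ a * (1 - y i) ^ s) := by
  refine le_trans ?_ (prod_rpow_mul_exp_le hθ hy)
  refine mul_le_of_le_one_left ?_ (interaction_le_one hβ hy)
  exact Finset.prod_nonneg fun i _ => by
    have h1 := unitCube_pos hy i
    have h2 := unitCube_lt_one hy i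
    have h3 : 0 ≤ 1 - y i := by linarith
    positivity

theorem gibbsWeight_mul_abs_inv_le {a s β θ : ℝ} (hβ : 1 ≤ β) (hθ : 0 ≤ θ) {y : Fin n → ℝ}
    (hy : y ∈ unitCube n) {i j : Fin n} (hij : i < j) :
    gibbsWeight a s β θ y * |(y i - y j)⁻¹| ≤ ∏ i, (y i ^ a * (1 - y i) ^ s) := by
  refine le_trans ?_ (prod_rpow_mul_exp_le hθ hy)
  unfold gibbsWeight
  rw [mul_right_comm]
  refine mul_le_of_le_one_left ?_ (interaction_mul_abs_inv_le_one hβ hy hij)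
  exact Finset.prod_nonneg fun i _ => by
    have h1 := unitCube_pos hy i
    have h2 := unitCube_lt_one hy i
    have h3 : 0 ≤ 1 - y i := by linarith
    positivity

theorem integrableOn_rpow_mul_one_sub_rpow {a b : ℝ} (ha : -1 < a) (hb : -1 < b) :
    IntegrableOn (fun u : ℝ => u ^ a * (1 - u) ^ b) (Set.Ioo 0 1) := by
  have h := Complex.betaIntegral_convergent (u := (a + 1 : ℝ)) (v := (b + 1 : ℝ))
    (by rw [Complex.ofReal_re]; linarith) (by rw [Complex.ofReal_re]; linarith)
  rw [intervalIntegrable_iff_integrableOn_Ioo_of_le zero_le_one] at h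
  refine (integrable_norm_iff h.aestronglyMeasurable).2 h |>.congr ?_
  filter_upwards [ae_restrict_mem measurableSet_Ioo] with u hu
  have h1 : 0 < 1 - u := by linarith [hu.2]
  have h2 : (1 - (u : ℂ)) = ((1 - u : ℝ) : ℂ) := by push_cast; ring
  rw [norm_mul, h2, Complex.norm_cpow_eq_rpow_re_of_pos hu.1,
    Complex.norm_cpow_eq_rpow_re_of_pos h1]
  simp

theorem integrableOn_unitCube_prod {a b : ℝ} (ha : -1 < a) (hb : -1 < b) :
    IntegrableOn (fun y : Fin n → ℝ => ∏ i, (y i ^ a * (1 - y i) ^ b)) (unitCube n) := by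
  unfold IntegrableOn unitCube
  rw [volume_pi, Measure.restrict_pi_pi]
  exact Integrable.fintype_prod (f := fun _ u => u ^ a * (1 - u) ^ b)
    fun _ => integrableOn_rpow_mul_one_sub_rpow ha hb

theorem integrableOn_unitCube_of_le {a b : ℝ} (ha : -1 < a) (hb : -1 < b)
    {f : (Fin n → ℝ) → ℝ} (hf : Measurable f) (C : ℝ)
    (h : ∀ y ∈ unitCube n, |f y| ≤ C * ∏ i, (y i ^ a * (1 - y i) ^ b)) :
    IntegrableOn f (unitCube n) := by
  refine ((integrableOn_unitCube_prod ha hb).const_mul C).mono' hf.aestronglyMeasurable ?_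
  filter_upwards [ae_restrict_mem measurableSet_unitCube] with y hy
  exact h y hy

theorem integrableOn_gibbsWeight {a s β θ : ℝ} (ha : -1 < a) (hs : -1 < s) (hβ : 0 ≤ β)
    (hθ : 0 ≤ θ) : IntegrableOn (gibbsWeight a s β θ) (unitCube n) := by
  refine integrableOn_unitCube_of_le ha hs (measurable_gibbsWeight a s β θ) 1 fun y hy => ?_
  rw [abs_of_nonneg (gibbsWeight_nonneg hy), one_mul]
  exact gibbsWeight_le hβ hθ hy

theorem integrableOn_mul_gibbsWeight {a s β θ : ℝ} (ha : -1 < a) (hs : -1 < s) (hβ : 0 ≤ β)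
    (hθ : 0 ≤ θ) {f : (Fin n → ℝ) → ℝ} (hf : Measurable f) (C : ℝ)
    (h : ∀ y ∈ unitCube n, |f y| ≤ C) :
    IntegrableOn (fun y => f y * gibbsWeight a s β θ y) (unitCube n) := by
  refine ((integrableOn_gibbsWeight (n := n) ha hs hβ hθ).const_mul C).mono'
    (hf.mul (measurable_gibbsWeight a s β θ)).aestronglyMeasurable ?_
  filter_upwards [ae_restrict_mem measurableSet_unitCube] with y hy
  rw [norm_mul, Real.norm_eq_abs, Real.norm_of_nonneg (gibbsWeight_nonneg hy)]
  exact mul_le_mul_of_nonneg_right (h y hy) (gibbsWeight_nonneg hy)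

end Weights

/-! ### Integration by parts against the Gibbs weight -/

section LoopEquation

variable {n : ℕ}

/-- A function on the cube which, along every line in the `i`-th direction, is the derivative
(off a countable set) of a continuous function vanishing at both ends has integral zero. -/
theorem integral_unitCube_eq_zero_of_coordinate (i : Fin n) {Ψ : (Fin n → ℝ) → ℝ}
    (hint : IntegrableOn Ψ (unitCube n))
    (h : ∀ y ∈ unitCube n, ∃ f : ℝ → ℝ, ∃ c : Set ℝ, c.Countable ∧
      ContinuousOn f (Set.Ioo 0 1) ∧ Filter.Tendsto f (nhdsWithin 0 (Set.Ioi 0)) (nhds 0) ∧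
      Filter.Tendsto f (nhdsWithin 1 (Set.Iio 1)) (nhds 0) ∧
      ∀ u ∈ Set.Ioo (0 : ℝ) 1 \ c, HasDerivAt f (Ψ (Function.update y i u)) u) :
    ∫ y in unitCube n, Ψ y = 0 := by
  cases n with
  | zero => exact i.elim0
  | succ m =>
  have hmp := (volume_preserving_piFinSuccAbove (fun _ : Fin (m + 1) => ℝ) i).symm
  set e := (MeasurableEquiv.piFinSuccAbove (fun _ : Fin (m + 1) => ℝ) i).symm
  have he : ∀ p : ℝ × (Fin m → ℝ), e p = i.insertNth p.1 p.2 := fun p => rfl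
  have hpre : e ⁻¹' unitCube (m + 1) = Set.Ioo 0 1 ×ˢ unitCube m := by
    ext p
    simp only [Set.mem_preimage, he, unitCube, Set.mem_pi, Set.mem_univ, true_implies,
      Set.mem_prod, i.forall_iff_succAbove, Fin.insertNth_apply_same,
      Fin.insertNth_apply_succAbove]
  rw [← hmp.setIntegral_preimage_emb e.measurableEmbedding, hpre, Measure.volume_eq_prod]
  have hint2 : IntegrableOn (fun p => Ψ (e p)) (Set.Ioo 0 1 ×ˢ unitCube m)
      ((volume : Measure ℝ).prod volume) := by
    have := (hmp.integrableOn_comp_preimage e.measurableEmbedding).2 hint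
    rw [hpre, Measure.volume_eq_prod] at this
    exact this
  unfold IntegrableOn at hint2
  rw [← Measure.prod_restrict] at hint2 ⊢
  rw [integral_prod_symm _ hint2]
  have hae : ∀ᵐ z ∂(volume.restrict (unitCube m)),
      ∫ u in Set.Ioo (0 : ℝ) 1, Ψ (e (u, z)) = 0 := by
    filter_upwards [hint2.prod_left_ae, ae_restrict_mem measurableSet_unitCube] with z hz hzm
    have hyz : (i.insertNth (1 / 2 : ℝ) z : Fin (m + 1) → ℝ) ∈ unitCube (m + 1) := by
      have : ((1 / 2 : ℝ), z) ∈ e ⁻¹' unitCube (m + 1) := by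
        rw [hpre]
        exact ⟨by norm_num, hzm⟩
      exact this
    obtain ⟨f, c, hc, hcont, h0, h1, hder⟩ := h _ hyz
    simp only [Fin.update_insertNth] at hder
    set F := extendFrom (Set.Ioo (0 : ℝ) 1) f with hF
    have hFc : ContinuousOn F (Set.Icc 0 1) := continuousOn_Icc_extendFrom_Ioo hcont h0 h1
    have hFf : ∀ u ∈ Set.Ioo (0 : ℝ) 1, F u = f u := fun u hu =>
      extendFrom_extends hcont u hu
    have hF0 : F 0 = 0 := eq_lim_at_left_extendFrom_Ioo zero_lt_one h0
    have hF1 : F 1 = 0 := eq_lim_at_right_extendFrom_Ioo zero_lt_one h1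
    have hii : IntervalIntegrable (fun u => Ψ (e (u, z))) volume 0 1 := by
      rw [intervalIntegrable_iff_integrableOn_Ioo_of_le zero_le_one]
      exact hz
    have := integral_eq_of_hasDerivAt_off_countable_of_le F (fun u => Ψ (e (u, z))) zero_le_one hc
      hFc (fun u hu => (hder u hu).congr_of_eventuallyEq ?_) hii
    · rw [← integral_Ioc_eq_integral_Ioo, ← intervalIntegral.integral_of_le zero_le_one, this, hF0,
        hF1, sub_zero]
    · filter_upwards [Ioo_mem_nhds hu.1.1 hu.1.2] with v hv
      exact hFf v hv
  rw [integral_congr_ae hae, integral_zero]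

theorem hasDerivAt_prod_of_logDeriv {ι : Type*} (S : Finset ι) {f : ι → ℝ → ℝ} {l : ι → ℝ} {x : ℝ}
    (h : ∀ k ∈ S, HasDerivAt (f k) (f k x * l k) x) :
    HasDerivAt (fun u => ∏ k ∈ S, f k u) ((∏ k ∈ S, f k x) * ∑ k ∈ S, l k) x := by
  classical
  induction S using Finset.induction_on with
  | empty => simpa using hasDerivAt_const x (1 : ℝ)
  | insert k S hk ih =>
    have h1 := (h k (Finset.mem_insert_self k S)).mul
      (ih fun j hj => h j (Finset.mem_insert_of_mem hj))
    simp only [Finset.prod_insert hk, Finset.sum_insert hk]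
    refine h1.congr_deriv ?_
    ring

theorem hasDerivAt_abs_rpow_of_ne_zero {x : ℝ} (hx : x ≠ 0) (β : ℝ) :
    HasDerivAt (fun u : ℝ => |u| ^ β) (|x| ^ β * (β * x⁻¹)) x := by
  have hx' : |x| ≠ 0 := abs_ne_zero.2 hx
  refine ((hasDerivAt_abs hx).rpow_const (p := β) (Or.inl hx')).congr_deriv ?_
  rw [Real.rpow_sub_one hx']
  rcases lt_or_gt_of_ne hx with h | h
  · simp [abs_of_neg h, h]
    field_simp
  · simp [abs_of_pos h, h]
    field_simp

theorem hasDerivAt_update_apply (y : Fin n → ℝ) (i k : Fin n) (u : ℝ) :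
    HasDerivAt (fun v => Function.update y i v k) ((Pi.single i 1 : Fin n → ℝ) k) u :=
  hasDerivAt_pi.1 (hasDerivAt_update y i u) k

/-- Logarithmic derivative of the repulsion factor in the `i`-th coordinate. -/
theorem hasDerivAt_interaction_update (β : ℝ) (y : Fin n → ℝ) (i : Fin n) {u : ℝ}
    (hu : ∀ j, u ≠ y j) :
    HasDerivAt (fun v => interaction β (Function.update y i v))
      (interaction β (Function.update y i u) * ∑ k, ∑ l ∈ Finset.Ioi k,
        β * ((Pi.single i 1 : Fin n → ℝ) k - (Pi.single i 1 : Fin n → ℝ) l) *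
          (Function.update y i u k - Function.update y i u l)⁻¹) u := by
  unfold interaction
  refine hasDerivAt_prod_of_logDeriv _ fun k _ => hasDerivAt_prod_of_logDeriv _ fun l hl => ?_
  have hkl : k ≠ l := (Finset.mem_Ioi.1 hl).ne
  have hdiff := (hasDerivAt_update_apply y i k u).sub (hasDerivAt_update_apply y i l u)
  by_cases hz : Function.update y i u k - Function.update y i u l = 0
  · have hk : k ≠ i := by
      rintro rfl
      rw [Function.update_self, Function.update_of_ne hkl.symm] at hz
      exact hu l (sub_eq_zero.1 hz)
    have hl : l ≠ i := by
      rintro rfl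
      rw [Function.update_self, Function.update_of_ne hkl] at hz
      exact hu k (sub_eq_zero.1 hz).symm
    simp only [Function.update_of_ne hk, Function.update_of_ne hl, Pi.single_eq_of_ne hk,
      Pi.single_eq_of_ne hl, sub_self, mul_zero, zero_mul]
    exact hasDerivAt_const _ _
  · refine ((hasDerivAt_abs_rpow_of_ne_zero hz β).comp u hdiff).congr_deriv ?_
    ring

theorem hasDerivAt_gibbsWeight_update (a s β θ : ℝ) {y : Fin n → ℝ} (hy : y ∈ unitCube n)
    (i : Fin n) {u : ℝ} (hu0 : u ∈ Set.Ioo (0 : ℝ) 1) (hu : ∀ j, u ≠ y j) :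
    HasDerivAt (fun v => gibbsWeight a s β θ (Function.update y i v))
      (gibbsWeight a s β θ (Function.update y i u) * ((a / u - s / (1 - u) - θ) +
        ∑ k, ∑ l ∈ Finset.Ioi k,
        β * ((Pi.single i 1 : Fin n → ℝ) k - (Pi.single i 1 : Fin n → ℝ) l) *
          (Function.update y i u k - Function.update y i u l)⁻¹)) u := by
  have hz := update_mem_unitCube hy i hu0
  have h1 := hasDerivAt_interaction_update β y i hu
  have h2 : HasDerivAt (fun v => ∏ k, (Function.update y i v k ^ a *
      (1 - Function.update y i v k) ^ s * Real.exp (-θ * Function.update y i v k)))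
      ((∏ k, (Function.update y i u k ^ a *
      (1 - Function.update y i u k) ^ s * Real.exp (-θ * Function.update y i u k))) *
        ∑ k, (Pi.single i 1 : Fin n → ℝ) k * (a / Function.update y i u k -
          s / (1 - Function.update y i u k) - θ)) u := by
    refine hasDerivAt_prod_of_logDeriv _ fun k _ => ?_
    have hd := hasDerivAt_update_apply y i k u
    have hk0 := unitCube_pos hz k
    have hk1 : 0 < 1 - Function.update y i u k := by linarith [unitCube_lt_one hz k]
    have e1 := hd.rpow_const (p := a) (Or.inl hk0.ne')
    have e2 := (hd.const_sub 1).rpow_const (p := s) (Or.inl hk1.ne')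
    have e3 := (hd.const_mul (-θ)).exp
    refine ((e1.mul e2).mul e3).congr_deriv ?_
    simp only [Pi.mul_apply]
    rw [Real.rpow_sub_one hk0.ne', Real.rpow_sub_one hk1.ne']
    field_simp
    ring
  have h3 : ∑ k, (Pi.single i 1 : Fin n → ℝ) k * (a / Function.update y i u k -
          s / (1 - Function.update y i u k) - θ) = a / u - s / (1 - u) - θ := by
    rw [Finset.sum_eq_single i]
    · simp
    · intro k _ hk
      simp [Pi.single_eq_of_ne hk]
    · simp
  rw [h3] at h2
  refine (h1.mul h2).congr_deriv ?_
  unfold gibbsWeight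
  ring

/-- Integration by parts against the Gibbs weight along a vector field `h` on the cube whose `i`-th
component vanishes on the faces `y i = 0` and `y i = 1`, with a controlled singularity at the
upper faces. The repulsion contributes the divided differences of the field; the assumption `1 ≤ β`
makes each term with a pole `(y k - y l)⁻¹` integrable separately. -/
theorem loop_equation {a s β θ q C : ℝ} (ha : -1 < a) (hβ : 1 ≤ β) (hθ : 0 ≤ θ)
    (hsq : -1 < s + q) {h h' : Fin n → (Fin n → ℝ) → ℝ} (hm : ∀ i, Measurable (h i))
    (hm' : ∀ i, Measurable (h' i))
    (hd : ∀ i, ∀ y ∈ unitCube n,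
      HasDerivAt (fun u => h i (Function.update y i u)) (h' i y) (y i))
    (hb : ∀ i, ∀ y ∈ unitCube n, |h i y| ≤ C * (y i * (1 - y i)) * ∏ j, (1 - y j) ^ q)
    (hb' : ∀ i, ∀ y ∈ unitCube n, |h' i y| ≤ C * ∏ j, (1 - y j) ^ q) :
    IntegrableOn (fun y => ((∑ i, (h' i y + h i y * (a / y i - s / (1 - y i) - θ))) +
      β * ∑ k, ∑ l ∈ Finset.Ioi k, (h k y - h l y) * (y k - y l)⁻¹) * gibbsWeight a s β θ y)
      (unitCube n) ∧
    ∫ y in unitCube n, ((∑ i, (h' i y + h i y * (a / y i - s / (1 - y i) - θ))) +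
      β * ∑ k, ∑ l ∈ Finset.Ioi k, (h k y - h l y) * (y k - y l)⁻¹) * gibbsWeight a s β θ y
      = 0 := by
  have hmW := measurable_gibbsWeight (n := n) a s β θ
  set D : Fin n → (Fin n → ℝ) → ℝ := fun i y =>
    (h' i y + h i y * (a / y i - s / (1 - y i) - θ) + ∑ k, ∑ l ∈ Finset.Ioi k,
        h i y * (β * ((Pi.single i 1 : Fin n → ℝ) k - (Pi.single i 1 : Fin n → ℝ) l) *
          (y k - y l)⁻¹)) * gibbsWeight a s β θ y with hD
  have henv : ∀ y ∈ unitCube n, (∏ j, (1 - y j) ^ q) * ∏ j, (y j ^ a * (1 - y j) ^ s) =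
      ∏ j, (y j ^ a * (1 - y j) ^ (s + q)) := by
    intro y hy
    rw [← Finset.prod_mul_distrib]
    refine Finset.prod_congr rfl fun j _ => ?_
    rw [Real.rpow_add (by linarith [unitCube_lt_one hy j])]
    ring
  have hq0 : ∀ y ∈ unitCube n, 0 ≤ ∏ j, (1 - y j) ^ q := fun y hy =>
    Finset.prod_nonneg fun j _ => Real.rpow_nonneg (by linarith [unitCube_lt_one hy j]) _
  have hC : ∀ i : Fin n, ∀ y ∈ unitCube n, 0 ≤ C * ∏ j, (1 - y j) ^ q := fun i y hy =>
    (abs_nonneg _).trans (hb' i y hy)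
  -- a singularity of order `∏ (1 - y j) ^ q` is integrable, because `s + q > -1`
  have hkey : ∀ g : (Fin n → ℝ) → ℝ, Measurable g → ∀ i : Fin n,
      (∀ y ∈ unitCube n, |g y| ≤ C * ∏ j, (1 - y j) ^ q) →
      IntegrableOn (fun y => g y * gibbsWeight a s β θ y) (unitCube n) := by
    intro g hg i hgb
    refine integrableOn_unitCube_of_le ha hsq (hg.mul hmW) C fun y hy => ?_
    rw [abs_mul, abs_of_nonneg (gibbsWeight_nonneg hy), ← henv y hy, ← mul_assoc]
    exact mul_le_mul (hgb y hy) (gibbsWeight_le (by linarith) hθ hy) (gibbsWeight_nonneg hy)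
      (hC i y hy)
  have hfac : ∀ i : Fin n, ∀ y ∈ unitCube n, |h i y| ≤ y i * (C * ∏ j, (1 - y j) ^ q) ∧
      |h i y| ≤ (1 - y i) * (C * ∏ j, (1 - y j) ^ q) ∧ |h i y| ≤ C * ∏ j, (1 - y j) ^ q := by
    intro i y hy
    have h0 := unitCube_pos hy i
    have h1 : 0 < 1 - y i := by linarith [unitCube_lt_one hy i]
    have h2 := hb i y hy
    have h3 := hC i y hy
    have e : C * (y i * (1 - y i)) * ∏ j, (1 - y j) ^ q =
      y i * (1 - y i) * (C * ∏ j, (1 - y j) ^ q) := by ring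
    rw [e] at h2
    set R := C * ∏ j, (1 - y j) ^ q
    refine ⟨h2.trans ?_, h2.trans ?_, h2.trans ?_⟩
    · nlinarith [mul_nonneg h0.le h3]
    · nlinarith [mul_nonneg h1.le h3]
    · nlinarith [mul_nonneg h0.le h3, mul_nonneg h1.le h3]
  have hint : ∀ i, IntegrableOn (D i) (unitCube n) := by
    intro i
    have i1 := hkey (h' i) (hm' i) i (hb' i)
    have i2 := hkey (fun y => h i y / y i) ((hm i).div (measurable_pi_apply i)) i (by
      intro y hy
      have h0 := unitCube_pos hy i
      rw [abs_div, abs_of_pos h0, div_le_iff₀ h0, mul_comm]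
      exact (hfac i y hy).1)
    have i3 := hkey (fun y => h i y / (1 - y i))
        ((hm i).div (measurable_const.sub (measurable_pi_apply i))) i (by
      intro y hy
      have h0 : 0 < 1 - y i := by linarith [unitCube_lt_one hy i]
      rw [abs_div, abs_of_pos h0, div_le_iff₀ h0, mul_comm]
      exact (hfac i y hy).2.1)
    have i4 := hkey (h i) (hm i) i fun y hy => (hfac i y hy).2.2
    have i5 : ∀ k : Fin n, ∀ l ∈ Finset.Ioi k, IntegrableOn
        (fun y => (h i y * (y k - y l)⁻¹) * gibbsWeight a s β θ y) (unitCube n) := by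
      intro k l hl
      refine integrableOn_unitCube_of_le ha hsq
        (((hm i).mul ((measurable_pi_apply k).sub (measurable_pi_apply l)).inv).mul hmW) C
        fun y hy => ?_
      have := gibbsWeight_mul_abs_inv_le (a := a) (s := s) hβ hθ hy (Finset.mem_Ioi.1 hl)
      rw [mul_assoc, abs_mul, abs_mul, abs_of_nonneg (gibbsWeight_nonneg hy), ← henv y hy,
        ← mul_assoc C, mul_comm |(y k - y l)⁻¹|]
      exact mul_le_mul (hfac i y hy).2.2 this
        (mul_nonneg (gibbsWeight_nonneg hy) (abs_nonneg _)) (hC i y hy)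
    have i6 : IntegrableOn (fun y => ∑ k, ∑ l ∈ Finset.Ioi k,
        (β * ((Pi.single i 1 : Fin n → ℝ) k - (Pi.single i 1 : Fin n → ℝ) l)) *
          ((h i y * (y k - y l)⁻¹) * gibbsWeight a s β θ y)) (unitCube n) :=
      integrable_finsetSum _ fun k _ => integrable_finsetSum _ fun l hl =>
        (i5 k l hl).const_mul _
    refine ((((i1.add (i2.const_mul a)).sub (i3.const_mul s)).sub (i4.const_mul θ)).add i6).congr
      (Filter.Eventually.of_forall fun y => ?_)
    simp only [hD, Pi.add_apply, Pi.sub_apply, add_mul, Finset.sum_mul]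
    congr 1
    · ring
    · exact Finset.sum_congr rfl fun k _ => Finset.sum_congr rfl fun l _ => by ring
  have hzero : ∀ i, ∫ y in unitCube n, D i y = 0 := by
    intro i
    refine integral_unitCube_eq_zero_of_coordinate i (hint i) fun y hy => ?_
    set c : ℝ := |C| * ∏ j ∈ Finset.univ.erase i, (y j ^ a * (1 - y j) ^ (s + q)) with hc
    -- the field times the weight vanishes at both ends of the line, as `a + 1` and `s + q + 1`
    -- are positive
    have hbound : ∀ u ∈ Set.Ioo (0 : ℝ) 1, ‖h i (Function.update y i u) *
        gibbsWeight a s β θ (Function.update y i u)‖ ≤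
        c * (u ^ (a + 1) * (1 - u) ^ (s + q + 1)) := by
      intro u hu
      have hz := update_mem_unitCube hy i hu
      have hu1 : 0 < 1 - u := by linarith [hu.2]
      have h1 := hb i _ hz
      have h2 := gibbsWeight_le (a := a) (s := s) (by linarith : 0 ≤ β) hθ hz
      rw [norm_mul, Real.norm_eq_abs, Real.norm_of_nonneg (gibbsWeight_nonneg hz)]
      calc _ ≤ |C| * (Function.update y i u i * (1 - Function.update y i u i)) *
            (∏ j, (1 - Function.update y i u j) ^ q) *
            ∏ j, (Function.update y i u j ^ a * (1 - Function.update y i u j) ^ s) := by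
            have hp := hq0 _ hz
            simp only [Function.update_self] at h1 ⊢
            have h3 : C * (u * (1 - u)) * ∏ j, (1 - Function.update y i u j) ^ q ≤
                |C| * (u * (1 - u)) * ∏ j, (1 - Function.update y i u j) ^ q := by
              have : 0 ≤ u * (1 - u) := mul_nonneg hu.1.le hu1.le
              gcongr
              exact le_abs_self C
            exact mul_le_mul (h1.trans h3) h2 (gibbsWeight_nonneg hz)
              ((abs_nonneg _).trans (h1.trans h3))
        _ = |C| * (u * (1 - u)) *
            ∏ j, (Function.update y i u j ^ a * (1 - Function.update y i u j) ^ (s + q)) := by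
            rw [mul_assoc, henv _ hz, Function.update_self]
        _ = c * (u ^ (a + 1) * (1 - u) ^ (s + q + 1)) := by
            rw [← Finset.mul_prod_erase _ _ (Finset.mem_univ i), Function.update_self,
              Real.rpow_add_one hu.1.ne', Real.rpow_add_one hu1.ne', hc,
              Finset.prod_congr rfl (g := fun j => y j ^ a * (1 - y j) ^ (s + q))]
            · ring
            · intro j hj
              rw [Function.update_of_ne (Finset.ne_of_mem_erase hj)]
    have hcont : Continuous fun u : ℝ => c * (u ^ (a + 1) * (1 - u) ^ (s + q + 1)) := by
      have h1 : Continuous fun u : ℝ => u ^ (a + 1) :=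
        Real.continuous_rpow_const (by linarith)
      have h2 : Continuous fun u : ℝ => u ^ (s + q + 1) :=
        Real.continuous_rpow_const (by linarith)
      exact continuous_const.mul (h1.mul (h2.comp (continuous_const.sub continuous_id)))
    -- differentiability can fail only where two coordinates coincide
    refine ⟨fun u => h i (Function.update y i u) * gibbsWeight a s β θ (Function.update y i u),
      Set.range y, Set.countable_range y, ?_, ?_, ?_, ?_⟩
    · intro u hu
      have hz := update_mem_unitCube hy i hu
      have h1 := (hd i _ hz).continuousAt
      simp only [Function.update_idem, Function.update_self] at h1
      refine (h1.mul ?_).continuousWithinAt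
      have hupd : ∀ k, Continuous fun v => Function.update y i v k := fun k =>
        continuous_iff_continuousAt.2 fun v => (hasDerivAt_update_apply y i k v).continuousAt
      have h2 : Continuous fun v => interaction β (Function.update y i v) := by
        unfold interaction
        exact continuous_finsetProd _ fun k _ => continuous_finsetProd _ fun l _ =>
          (Real.continuous_rpow_const (by linarith)).comp
            (continuous_abs.comp ((hupd k).sub (hupd l)))
      refine h2.continuousAt.mul (tendsto_finsetProd _ fun k _ => ?_)
      have hk0 := unitCube_pos hz k
      have hk1 : 0 < 1 - Function.update y i u k := by linarith [unitCube_lt_one hz k]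
      refine (((hupd k).continuousAt.rpow_const (Or.inl hk0.ne')).mul
        ((continuousAt_const.sub (hupd k).continuousAt).rpow_const (Or.inl hk1.ne'))).mul ?_
      exact (Real.continuous_exp.comp (continuous_const.mul (hupd k))).continuousAt
    · refine squeeze_zero_norm' (a := fun u : ℝ => c * (u ^ (a + 1) * (1 - u) ^ (s + q + 1))) ?_ ?_
      · filter_upwards [Ioo_mem_nhdsGT (zero_lt_one' ℝ)] with u hu using hbound u hu
      · have := hcont.tendsto 0
        rw [Real.zero_rpow (by linarith), zero_mul, mul_zero] at this
        exact this.mono_left nhdsWithin_le_nhds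
    · refine squeeze_zero_norm' (a := fun u : ℝ => c * (u ^ (a + 1) * (1 - u) ^ (s + q + 1))) ?_ ?_
      · filter_upwards [Ioo_mem_nhdsLT (zero_lt_one' ℝ)] with u hu using hbound u hu
      · have := hcont.tendsto 1
        rw [sub_self, Real.zero_rpow (x := s + q + 1) (by linarith), mul_zero, mul_zero] at this
        exact this.mono_left nhdsWithin_le_nhds
    · intro u hu
      have hz := update_mem_unitCube hy i hu.1
      have h1 := hd i _ hz
      simp only [Function.update_idem, Function.update_self] at h1
      have h2 := hasDerivAt_gibbsWeight_update a s β θ hy i hu.1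
        (fun j hj => hu.2 ⟨j, hj.symm⟩)
      refine (h1.mul h2).congr_deriv ?_
      simp only [hD, Function.update_self, ← Finset.mul_sum]
      ring
  have hsum : ∫ y in unitCube n, ∑ i, D i y = 0 := by
    rw [integral_finsetSum _ fun i _ => hint i]
    exact Finset.sum_eq_zero fun i _ => hzero i
  have hsumint : IntegrableOn (fun y => ∑ i, D i y) (unitCube n) :=
    integrable_finsetSum _ fun i _ => hint i
  suffices heq : (fun y => ((∑ i, (h' i y + h i y * (a / y i - s / (1 - y i) - θ))) +
      β * ∑ k, ∑ l ∈ Finset.Ioi k, (h k y - h l y) * (y k - y l)⁻¹) * gibbsWeight a s β θ y) =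
      fun y => ∑ i, D i y by
    rw [heq]
    exact ⟨hsumint, hsum⟩
  ext y
  simp only [hD]
  rw [← Finset.sum_mul, Finset.sum_add_distrib (g := fun i => ∑ k, ∑ l ∈ Finset.Ioi k, _)]
  congr 2
  rw [Finset.sum_comm, Finset.mul_sum]
  refine Finset.sum_congr rfl fun k _ => ?_
  rw [Finset.sum_comm, Finset.mul_sum]
  refine Finset.sum_congr rfl fun l _ => ?_
  have e : ∀ k : Fin n, ∑ i, h i y * (Pi.single i 1 : Fin n → ℝ) k = h k y := by
    intro k
    rw [Finset.sum_eq_single k]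
    · simp
    · intro i _ hi
      simp [Pi.single_eq_of_ne hi.symm]
    · simp
  rw [← e k, ← e l, ← Finset.sum_sub_distrib, Finset.sum_mul, Finset.mul_sum]
  exact Finset.sum_congr rfl fun i _ => by ring

end LoopEquation

/-! ### The loop equation behind the upper edge -/

section UpperEdgeInequality

variable {n : ℕ}

theorem sum_Ioi_mul_eq (x : Fin n → ℝ) :
    ∑ k, ∑ l ∈ Finset.Ioi k, x k * x l = ((∑ i, x i) ^ 2 - ∑ i, x i ^ 2) / 2 := by
  have h1 := Finset.sum_sum_Ioi_add_eq_sum_sum_off_diag (fun i j : Fin n => x i * x j)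
  have h2 : ∑ i, ∑ j ∈ ({i} : Finset (Fin n))ᶜ, x j * x i = (∑ i, x i) ^ 2 - ∑ i, x i ^ 2 := by
    rw [sq, Finset.sum_mul_sum, ← Finset.sum_sub_distrib]
    refine Finset.sum_congr rfl fun i _ => ?_
    rw [← Finset.sum_compl_add_sum {i} (fun j => x i * x j), Finset.sum_singleton]
    rw [sq, add_sub_cancel_right]
    exact Finset.sum_congr rfl fun j _ => mul_comm _ _
  rw [← h2, ← h1, Finset.sum_div]
  refine Finset.sum_congr rfl fun i _ => ?_
  rw [Finset.sum_div]
  exact Finset.sum_congr rfl fun j _ => by ring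

theorem sum_Ioi_const (c : ℝ) :
    ∑ k : Fin n, ∑ _l ∈ Finset.Ioi k, c = (n : ℝ) * (n - 1) / 2 * c := by
  have h := sum_Ioi_mul_eq (fun _ : Fin n => (1 : ℝ))
  simp only [mul_one, Finset.sum_const, Finset.card_univ, Fintype.card_fin, nsmul_eq_mul,
    one_pow] at h ⊢
  rw [← Finset.sum_mul, h]
  ring

/-- The divergence of the vector field
`y i * (M - θ * ∑ y + s * ∑ (1 - y)⁻¹ + d + e * (1 - y i)⁻¹)` with respect to the Gibbs weight,
at a point with distinct coordinates; `M` is the degree of homogeneity of the weight. -/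
theorem divergence_upperEdge_field {a s β θ M d e : ℝ}
    (hM : M = n * (1 + a + s) + β / 2 * (n * (n - 1))) {y : Fin n → ℝ} (hy : y ∈ unitCube n)
    (hinj : ∀ k l, k < l → y k ≠ y l) {P Y S : ℝ} (hP : P = M - θ * ∑ j, y j)
    (hY : Y = ∑ j, (1 - y j)⁻¹) (hS : S = ∑ j, ((1 - y j)⁻¹) ^ 2) :
    (∑ i, (((P + s * Y + d + e * (1 - y i)⁻¹) +
        y i * (-θ + s * ((1 - y i)⁻¹) ^ 2 + e * ((1 - y i)⁻¹) ^ 2)) +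
        y i * (P + s * Y + d + e * (1 - y i)⁻¹) * (a / y i - s / (1 - y i) - θ))) +
      β * ∑ k, ∑ l ∈ Finset.Ioi k, (y k * (P + s * Y + d + e * (1 - y k)⁻¹) -
        y l * (P + s * Y + d + e * (1 - y l)⁻¹)) * (y k - y l)⁻¹ =
      (P + s * Y + d) * (P - s * Y) + P - M + s * (S - Y) +
        e * (S * (1 - β / 2 - s) + β / 2 * Y ^ 2 + (a + s) * Y - θ * (Y - n)) := by
  set x : Fin n → ℝ := fun j => (1 - y j)⁻¹ with hx
  set Q := P + s * Y + d with hQ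
  have hpair : ∑ k, ∑ l ∈ Finset.Ioi k, (y k * (Q + e * (1 - y k)⁻¹) -
        y l * (Q + e * (1 - y l)⁻¹)) * (y k - y l)⁻¹ =
        n * (n - 1) / 2 * Q + e * ((Y ^ 2 - S) / 2) := by
    have h0 : ∀ k, ∀ l ∈ Finset.Ioi k, (y k * (Q + e * (1 - y k)⁻¹) -
        y l * (Q + e * (1 - y l)⁻¹)) * (y k - y l)⁻¹ = Q + e * (x k * x l) := by
      intro k l hl
      have h1 := sub_ne_zero.2 (hinj k l (Finset.mem_Ioi.1 hl))
      have h2 : 1 - y k ≠ 0 := by linarith [unitCube_lt_one hy k]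
      have h3 : 1 - y l ≠ 0 := by linarith [unitCube_lt_one hy l]
      simp only [hx]
      field_simp
      ring
    rw [Finset.sum_congr rfl fun k _ => Finset.sum_congr rfl (h0 k)]
    simp only [Finset.sum_add_distrib]
    rw [sum_Ioi_const, hY, hS, ← sum_Ioi_mul_eq x, Finset.mul_sum]
    simp only [Finset.mul_sum]
  have hone : ∀ i ∈ Finset.univ, (((Q + e * (1 - y i)⁻¹) +
        y i * (-θ + s * ((1 - y i)⁻¹) ^ 2 + e * ((1 - y i)⁻¹) ^ 2)) +
        y i * (Q + e * (1 - y i)⁻¹) * (a / y i - s / (1 - y i) - θ)) =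
      (Q * (1 + a + s) + θ * e) + (-θ - θ * Q) * y i +
        (-s * Q - s + e * (a + s - θ)) * x i + (s + e - e * s) * x i ^ 2 := by
    intro i _
    have h2 : 1 - y i ≠ 0 := by linarith [unitCube_lt_one hy i]
    have h3 : y i ≠ 0 := (unitCube_pos hy i).ne'
    simp only [hx]
    field_simp
    ring
  rw [hpair, Finset.sum_congr rfl hone]
  simp only [Finset.sum_add_distrib, ← Finset.mul_sum, Finset.sum_const, Finset.card_univ,
    Fintype.card_fin, nsmul_eq_mul]
  rw [← hS, ← hY]
  have hp : θ * ∑ j, y j = M - P := by rw [hP]; ring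
  have e1 : (-θ - θ * Q) * ∑ j, y j = -(1 + Q) * (M - P) := by rw [← hp]; ring
  rw [e1]
  have hM' : n * (1 + a + s) = M - β / 2 * (n * (n - 1)) := by rw [hM]; ring
  linear_combination Q * hM'

theorem one_le_inv_one_sub {y : Fin n → ℝ} (hy : y ∈ unitCube n) (j : Fin n) :
    1 ≤ (1 - y j)⁻¹ := by
  have h1 := unitCube_pos hy j
  have h2 := unitCube_lt_one hy j
  exact (one_le_inv₀ (by linarith)).2 (by linarith)

theorem inv_one_sub_le_prod {y : Fin n → ℝ} (hy : y ∈ unitCube n) (i : Fin n) :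
    (1 - y i)⁻¹ ≤ ∏ j, (1 - y j)⁻¹ := by
  rw [← Finset.mul_prod_erase _ _ (Finset.mem_univ i)]
  refine le_mul_of_one_le_right (by linarith [one_le_inv_one_sub hy i]) ?_
  have : ∏ j ∈ Finset.univ.erase i, (1 : ℝ) ≤ ∏ j ∈ Finset.univ.erase i, (1 - y j)⁻¹ :=
    Finset.prod_le_prod (fun _ _ => zero_le_one) fun j _ => one_le_inv_one_sub hy j
  simpa using this

theorem abs_sum_unitCube_le {y : Fin n → ℝ} (hy : y ∈ unitCube n) : |∑ j, y j| ≤ n := by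
  rw [abs_of_nonneg (Finset.sum_nonneg fun j _ => (unitCube_pos hy j).le)]
  calc ∑ j, y j ≤ ∑ _j : Fin n, (1 : ℝ) :=
        Finset.sum_le_sum fun j _ => (unitCube_lt_one hy j).le
    _ = n := by simp

/-- The integrated inequality behind the upper edge, for a repulsion exponent `s > 1` from the
face `y i = 1`. The loop equation for the field of `divergence_upperEdge_field` leaves
the term `(s - 1) (1 / s + 2 / β) ∑ (1 - y)⁻²` with a favourable sign; it is bounded below by the
tangent line `2 τ ∑ (1 - y)⁻¹ - n τ²`. -/
theorem upperEdge_inequality_of_one_lt {a s β t M : ℝ} (ha : -1 < a) (hs : 1 < s) (hβ : 1 ≤ β)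
    (ht : 0 < t) (hM : M = n * (1 + a + s) + β / 2 * (n * (n - 1))) :
    0 ≤ ∫ y in unitCube n, ((M - β / 2 * t * ∑ j, y j) ^ 2 - M -
      s * (t - 2 * (a + 1) / β) * (M - β / 2 * t * ∑ j, y j) +
      s ^ 2 * n * (t + (s - 1) * s / (β * (β + 2 * s)))) * gibbsWeight a s β (β / 2 * t) y := by
  have hβ0 : 0 < β := by linarith
  have hs0 : 0 < s := by linarith
  set θ := β / 2 * t with hθ
  have hθ0 : 0 < θ := by positivity
  set d := -1 - s * (t - 2 * (a + 1) / β) with hd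
  -- this value of `e` cancels the terms in `(∑ (1 - y)⁻¹) ^ 2`
  set e := 2 * s ^ 2 / β with he
  have he0 : 0 < e := by positivity
  set P : (Fin n → ℝ) → ℝ := fun y => M - θ * ∑ j, y j with hP
  set Y : (Fin n → ℝ) → ℝ := fun y => ∑ j, (1 - y j)⁻¹ with hY
  set h : Fin n → (Fin n → ℝ) → ℝ := fun i y =>
    y i * (P y + s * Y y + d + e * (1 - y i)⁻¹) with hh
  set h' : Fin n → (Fin n → ℝ) → ℝ := fun i y => (P y + s * Y y + d + e * (1 - y i)⁻¹) +
        y i * (-θ + s * ((1 - y i)⁻¹) ^ 2 + e * ((1 - y i)⁻¹) ^ 2) with hh'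
  have hPm : Measurable P := by fun_prop
  have hYm : Measurable Y := by fun_prop
  set C1 := |M| + θ * n + |d| + s * n + e with hC1
  have hC10 : 0 ≤ C1 := by positivity
  have hq : ∀ y ∈ unitCube n, ∏ j, (1 - y j) ^ (-2 : ℝ) = (∏ j, (1 - y j)⁻¹) ^ 2 := by
    intro y hy
    rw [← Finset.prod_pow]
    refine Finset.prod_congr rfl fun j _ => ?_
    rw [Real.rpow_neg (by linarith [unitCube_lt_one hy j]), inv_pow]
    norm_cast
  have hone : ∀ y ∈ unitCube n, 1 ≤ ∏ j, (1 - y j)⁻¹ := by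
    intro y hy
    have : ∏ j : Fin n, (1 : ℝ) ≤ ∏ j, (1 - y j)⁻¹ :=
      Finset.prod_le_prod (fun _ _ => zero_le_one) fun j _ => one_le_inv_one_sub hy j
    simpa using this
  have hcore : ∀ i, ∀ y ∈ unitCube n,
      |P y + s * Y y + d + e * (1 - y i)⁻¹| ≤ C1 * ∏ j, (1 - y j)⁻¹ := by
    intro i y hy
    set R := ∏ j, (1 - y j)⁻¹
    have hR : 1 ≤ R := hone y hy
    have h1 : |P y| ≤ |M| + θ * n := by
      refine (abs_sub _ _).trans ?_
      rw [abs_mul, abs_of_pos hθ0]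
      have := abs_sum_unitCube_le hy
      gcongr
    have h2 : |Y y| ≤ n * R := by
      rw [abs_of_nonneg (Finset.sum_nonneg fun j _ => by linarith [one_le_inv_one_sub hy j])]
      calc Y y ≤ ∑ _j : Fin n, R := Finset.sum_le_sum fun j _ => inv_one_sub_le_prod hy j
        _ = n * R := by simp
    have h3 : |(1 - y i)⁻¹| ≤ R := by
      rw [abs_of_nonneg (by linarith [one_le_inv_one_sub hy i])]
      exact inv_one_sub_le_prod hy i
    calc |P y + s * Y y + d + e * (1 - y i)⁻¹|
        ≤ |P y| + |s * Y y| + |d| + |e * (1 - y i)⁻¹| := by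
          refine (abs_add_le _ _).trans (add_le_add ?_ le_rfl)
          refine (abs_add_le _ _).trans (add_le_add ?_ le_rfl)
          exact abs_add_le _ _
      _ ≤ (|M| + θ * n) * R + s * (n * R) + |d| * R + e * R := by
          rw [abs_mul, abs_mul, abs_of_pos hs0, abs_of_pos he0]
          have h4 : |M| + θ * n ≤ (|M| + θ * n) * R :=
            le_mul_of_one_le_right (by positivity) hR
          have h5 : |d| ≤ |d| * R := le_mul_of_one_le_right (by positivity) hR
          gcongr
          exact h1.trans h4
      _ = C1 * R := by rw [hC1]; ring
  -- the field has order `(1 - y i) * (1 - y i)⁻²`, so that `q = -2`, and `s > 1` gives `s + q > -1`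
  have hloop := loop_equation (n := n) (a := a) (s := s) (β := β) (θ := θ) (q := -2)
    (C := C1 + θ + s + e) ha hβ hθ0.le (by linarith) (h := h) (h' := h')
    (fun i => by fun_prop) (fun i => by fun_prop) ?_ ?_ ?_
  · have key : ∀ y ∈ unitCube n,
        ((P y) ^ 2 - M - s * (t - 2 * (a + 1) / β) * P y +
        s ^ 2 * n * (t + (s - 1) * s / (β * (β + 2 * s)))) * gibbsWeight a s β θ y ≥
        ((∑ i, (h' i y + h i y * (a / y i - s / (1 - y i) - θ))) +
        β * ∑ k, ∑ l ∈ Finset.Ioi k, (h k y - h l y) * (y k - y l)⁻¹) *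
          gibbsWeight a s β θ y := by
      intro y hy
      by_cases hinj : ∀ k l, k < l → y k ≠ y l
      · refine mul_le_mul_of_nonneg_right ?_ (gibbsWeight_nonneg hy)
        set S := ∑ j, ((1 - y j)⁻¹) ^ 2 with hS
        rw [divergence_upperEdge_field (M := M) hM hy hinj rfl rfl hS]
        -- with this slope the tangent line cancels the remaining term in `∑ (1 - y)⁻¹`
        set τ := s / (β + 2 * s) with hτ
        have hsq : 0 ≤ S - 2 * τ * Y y + n * τ ^ 2 := by
          have : S - 2 * τ * Y y + n * τ ^ 2 = ∑ j, ((1 - y j)⁻¹ - τ) ^ 2 := by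
            simp only [sub_sq, Finset.sum_add_distrib, Finset.sum_sub_distrib, hS, hY,
              Finset.sum_const, Finset.card_univ, Fintype.card_fin, nsmul_eq_mul,
              ← Finset.sum_mul, ← Finset.mul_sum]
            ring
          rw [this]
          positivity
        have hcoef : 0 ≤ s ^ 2 * ((s - 1) * (1 / s + 2 / β)) := by
          have : 0 < s - 1 := by linarith
          positivity
        have hprod := mul_nonneg hcoef hsq
        have hid : (P y) ^ 2 - M - s * (t - 2 * (a + 1) / β) * P y +
          s ^ 2 * n * (t + (s - 1) * s / (β * (β + 2 * s))) =
          (P y + s * Y y + d) * (P y - s * Y y) + P y - M + s * (S - Y y) +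
            e * (S * (1 - β / 2 - s) + β / 2 * Y y ^ 2 + (a + s) * Y y - θ * (Y y - n)) +
          s ^ 2 * ((s - 1) * (1 / s + 2 / β)) * (S - 2 * τ * Y y + n * τ ^ 2) := by
          rw [hd, he, hθ, hτ]
          field_simp
          ring
        linarith
      · push Not at hinj
        obtain ⟨k, l, hkl, hEq⟩ := hinj
        have : gibbsWeight a s β θ y = 0 := by
          unfold gibbsWeight
          rw [interaction_eq_zero hβ0.ne' hkl.ne hEq, zero_mul]
        simp [this]
    rw [← hloop.2]
    refine setIntegral_mono_on hloop.1 (integrableOn_mul_gibbsWeight ha (by linarith) hβ0.le hθ0.le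
      (by fun_prop) ((|M| + θ * n) ^ 2 + |M| + |s * (t - 2 * (a + 1) / β)| * (|M| + θ * n) +
        |s ^ 2 * n * (t + (s - 1) * s / (β * (β + 2 * s)))|) fun y hy => ?_)
      measurableSet_unitCube key
    have h1 : |P y| ≤ |M| + θ * n := by
      refine (abs_sub _ _).trans ?_
      rw [abs_mul, abs_of_pos hθ0]
      have := abs_sum_unitCube_le hy
      gcongr
    have h2 : |P y ^ 2| ≤ (|M| + θ * n) ^ 2 := by
      rw [abs_pow]
      gcongr
    refine (abs_add_le _ _).trans (add_le_add ?_ le_rfl)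
    refine (abs_sub _ _).trans (add_le_add ?_ ?_)
    · exact (abs_sub _ _).trans (add_le_add h2 le_rfl)
    · rw [abs_mul]
      gcongr
  · intro i y hy
    have hy1 : 1 - y i ≠ 0 := by linarith [unitCube_lt_one hy i]
    have hyd : ∀ j, HasDerivAt (fun u => 1 - Function.update y i u j)
        (-(Pi.single i 1 : Fin n → ℝ) j) (y i) := fun j =>
      (hasDerivAt_update_apply y i j (y i)).const_sub 1
    have hinv : ∀ j, HasDerivAt (fun u => (1 - Function.update y i u j)⁻¹)
        ((Pi.single i 1 : Fin n → ℝ) j * ((1 - y j)⁻¹) ^ 2) (y i) := by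
      intro j
      have hj : 1 - Function.update y i (y i) j ≠ 0 := by
        rw [Function.update_eq_self]
        linarith [unitCube_lt_one hy j]
      refine ((hyd j).inv hj).congr_deriv ?_
      rw [Function.update_eq_self]
      field_simp
    have hsingle : ∀ g : Fin n → ℝ, ∑ j, (Pi.single i 1 : Fin n → ℝ) j * g j = g i := by
      intro g
      rw [Finset.sum_eq_single i]
      · simp
      · intro k _ hk
        simp [Pi.single_eq_of_ne hk]
      · simp
    have dY : HasDerivAt (fun u => Y (Function.update y i u)) (((1 - y i)⁻¹) ^ 2) (y i) := by
      refine (HasDerivAt.fun_sum fun j _ => hinv j).congr_deriv ?_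
      exact hsingle _
    have dP : HasDerivAt (fun u => P (Function.update y i u)) (-θ) (y i) := by
      refine (((HasDerivAt.fun_sum fun j (_ : j ∈ Finset.univ) =>
        hasDerivAt_update_apply y i j (y i)).const_mul θ).const_sub M).congr_deriv ?_
      have := hsingle fun _ => 1
      simp only [mul_one] at this
      rw [this, mul_one]
    have di := hinv i
    refine ((hasDerivAt_update_apply y i i (y i)).mul ((((dP.add (dY.const_mul s)).add_const d).add
      (di.const_mul e)))).congr_deriv ?_
    simp only [hh', Function.update_eq_self, Pi.single_eq_same, Pi.add_apply]
    ring
  · intro i y hy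
    have h0 := unitCube_pos hy i
    have h1 : 0 < 1 - y i := by linarith [unitCube_lt_one hy i]
    have hR := hone y hy
    have hc := hcore i y hy
    have hi := inv_one_sub_le_prod hy i
    rw [hq y hy]
    simp only [hh]
    set R := ∏ j, (1 - y j)⁻¹
    rw [abs_mul, abs_of_pos h0]
    have h2 : 1 ≤ (1 - y i) * R := by
      have := mul_le_mul_of_nonneg_left hi h1.le
      rwa [mul_inv_cancel₀ h1.ne'] at this
    calc y i * |P y + s * Y y + d + e * (1 - y i)⁻¹| ≤ y i * (C1 * R) := by gcongr
      _ ≤ y i * (C1 * R) * ((1 - y i) * R) := le_mul_of_one_le_right (by positivity) h2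
      _ = C1 * (y i * (1 - y i)) * R ^ 2 := by ring
      _ ≤ (C1 + θ + s + e) * (y i * (1 - y i)) * R ^ 2 := by
        gcongr
        linarith
  · intro i y hy
    have h0 := unitCube_pos hy i
    have h0' := unitCube_lt_one hy i
    have h1 : 0 < 1 - y i := by linarith
    have hR := hone y hy
    have hc := hcore i y hy
    have hi := inv_one_sub_le_prod hy i
    have hi0 : 0 ≤ (1 - y i)⁻¹ := by positivity
    rw [hq y hy]
    simp only [hh']
    set R := ∏ j, (1 - y j)⁻¹
    have hRR : R ≤ R ^ 2 := by nlinarith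
    have h2 : |-θ + s * ((1 - y i)⁻¹) ^ 2 + e * ((1 - y i)⁻¹) ^ 2| ≤
        θ * R ^ 2 + s * R ^ 2 + e * R ^ 2 := by
      refine (abs_add_le _ _).trans (add_le_add ((abs_add_le _ _).trans (add_le_add ?_ ?_)) ?_)
      · rw [abs_neg, abs_of_pos hθ0]
        exact le_mul_of_one_le_right hθ0.le (by nlinarith)
      · rw [abs_of_nonneg (by positivity)]
        gcongr
      · rw [abs_of_nonneg (by positivity)]
        gcongr
    calc _ ≤ C1 * R + y i * (θ * R ^ 2 + s * R ^ 2 + e * R ^ 2) := by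
          refine (abs_add_le _ _).trans (add_le_add hc ?_)
          rw [abs_mul, abs_of_pos h0]
          gcongr
      _ ≤ C1 * R ^ 2 + 1 * (θ * R ^ 2 + s * R ^ 2 + e * R ^ 2) := by gcongr
      _ = _ := by ring

/-- The integrated inequality behind the upper edge for the exponent `s = β` carried by the law of
the largest point. It is a limit `s ↓ β`, so that `β = 1`, where the loop equation has a boundary
term, is included. -/
theorem upperEdge_inequality {a β t M : ℝ} (ha : -1 < a) (hβ : 1 ≤ β)
    (ht : 0 < t) (hM : M = n * (1 + a + β) + β / 2 * (n * (n - 1))) :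
    0 ≤ ∫ y in unitCube n, ((M - β / 2 * t * ∑ j, y j) ^ 2 - M -
      β * (t - 2 * (a + 1) / β) * (M - β / 2 * t * ∑ j, y j) +
      β ^ 2 * n * (t + 1 / 3)) * gibbsWeight a β β (β / 2 * t) y := by
  have hβ0 : 0 < β := by linarith
  set m : ℝ → ℝ := fun s => n * (1 + a + s) + β / 2 * (n * (n - 1)) with hm
  set g : ℝ → ℝ → ℝ := fun s p => (m s - β / 2 * t * p) ^ 2 - m s -
      s * (t - 2 * (a + 1) / β) * (m s - β / 2 * t * p) +
      s ^ 2 * n * (t + (s - 1) * s / (β * (β + 2 * s))) with hg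
  have hgc : ContinuousOn (Function.uncurry g) (Set.Icc β (β + 1) ×ˢ Set.Icc (-n : ℝ) n) := by
    have : ∀ p ∈ Set.Icc β (β + 1) ×ˢ Set.Icc (-n : ℝ) n, β * (β + 2 * p.1) ≠ 0 := by
      intro p hp
      have : β ≤ p.1 := hp.1.1
      have h2 : 0 < β + 2 * p.1 := by linarith
      exact (mul_pos hβ0 h2).ne'
    simp only [hg, hm, Function.uncurry_def]
    fun_prop (disch := assumption)
  obtain ⟨C, hC⟩ := (isCompact_Icc.prod isCompact_Icc).exists_bound_of_continuousOn hgc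
  have hlim : Filter.Tendsto (fun s => ∫ y in unitCube n, g s (∑ j, y j) *
      gibbsWeight a s β (β / 2 * t) y) (nhdsWithin β (Set.Ioi β))
      (nhds (∫ y in unitCube n, g β (∑ j, y j) * gibbsWeight a β β (β / 2 * t) y)) := by
    refine tendsto_integral_filter_of_dominated_convergence
      (fun y => C * ∏ j, (y j ^ a * (1 - y j) ^ β)) ?_ ?_ ?_ ?_
    · refine Filter.Eventually.of_forall fun s => Measurable.aestronglyMeasurable ?_
      exact (by fun_prop : Measurable fun y : Fin n → ℝ => g s (∑ j, y j)).mul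
        (measurable_gibbsWeight a s β _)
    · filter_upwards [Ioo_mem_nhdsGT (lt_add_one β)] with s hs
      filter_upwards [ae_restrict_mem measurableSet_unitCube] with y hy
      have h1 := hC (s, ∑ j, y j) ⟨⟨hs.1.le, hs.2.le⟩, abs_le.1 (abs_sum_unitCube_le hy)⟩
      rw [norm_mul, Real.norm_of_nonneg (gibbsWeight_nonneg hy)]
      refine mul_le_mul h1 ((gibbsWeight_le hβ0.le (by positivity) hy).trans ?_)
        (gibbsWeight_nonneg hy) ((norm_nonneg _).trans h1)
      refine Finset.prod_le_prod (fun j _ => ?_) fun j _ => ?_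
      all_goals
        have h2 := unitCube_pos hy j
        have h3 : 0 < 1 - y j := by linarith [unitCube_lt_one hy j]
      · positivity
      · exact mul_le_mul_of_nonneg_left (Real.rpow_le_rpow_of_exponent_ge h3 (by linarith) hs.1.le)
          (by positivity)
    · exact (integrableOn_unitCube_prod ha (by linarith)).const_mul C
    · filter_upwards [ae_restrict_mem measurableSet_unitCube] with y hy
      refine Filter.Tendsto.mono_left ?_ nhdsWithin_le_nhds
      have h1 : ContinuousAt (fun s => g s (∑ j, y j)) β := by
        have : β * (β + 2 * β) ≠ 0 := by positivity
        simp only [hg, hm]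
        fun_prop (disch := assumption)
      refine h1.tendsto.mul ?_
      unfold gibbsWeight
      refine tendsto_const_nhds.mul (tendsto_finsetProd _ fun j _ => ?_)
      have h3 : 0 < 1 - y j := by linarith [unitCube_lt_one hy j]
      exact (tendsto_const_nhds.mul
        (Real.continuousAt_const_rpow h3.ne').tendsto).mul tendsto_const_nhds
  have h0 : 0 ≤ ∫ y in unitCube n, g β (∑ j, y j) * gibbsWeight a β β (β / 2 * t) y := by
    refine ge_of_tendsto hlim ?_
    filter_upwards [self_mem_nhdsWithin] with s hs
    exact upperEdge_inequality_of_one_lt ha (lt_of_le_of_lt hβ hs) hβ ht rfl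
  refine h0.trans (setIntegral_mono_on ?_ ?_ measurableSet_unitCube fun y hy => ?_)
  · refine integrableOn_mul_gibbsWeight ha (by linarith) hβ0.le (by positivity) (by fun_prop) C
      fun y hy => ?_
    exact hC (β, ∑ j, y j) ⟨⟨le_rfl, by linarith⟩, abs_le.1 (abs_sum_unitCube_le hy)⟩
  · refine integrableOn_mul_gibbsWeight ha (by linarith) hβ0.le (by positivity) (by fun_prop)
      (C + |β ^ 2 * n * (t + 1 / 3) - β ^ 2 * n * (t + (β - 1) * β / (β * (β + 2 * β)))|)
      fun y hy => ?_
    have h1 := hC (β, ∑ j, y j) ⟨⟨le_rfl, by linarith⟩, abs_le.1 (abs_sum_unitCube_le hy)⟩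
    refine le_trans (le_of_eq ?_) ((abs_add_le _ _).trans (add_le_add h1 le_rfl))
    congr 1
    simp only [hg, Function.uncurry_def, hM, hm]
    ring
  · refine mul_le_mul_of_nonneg_right ?_ (gibbsWeight_nonneg hy)
    have h2 : (β - 1) * β / (β * (β + 2 * β)) ≤ 1 / 3 := by
      rw [div_le_div_iff₀ (by positivity) (by norm_num)]
      nlinarith
    simp only [hg, hm, ← hM]
    gcongr

end UpperEdgeInequality

/-! ### Derivatives in the scale parameter -/

section Moments

variable {n : ℕ}

/-- The moment `∫ (∑ y) ^ k` of the Gibbs weight on the cube. -/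
noncomputable def gibbsMoment (n : ℕ) (a s β θ : ℝ) (k : ℕ) : ℝ :=
  ∫ y in unitCube n, (∑ j, y j) ^ k * gibbsWeight a s β θ y

theorem integrableOn_pow_mul_gibbsWeight {a s β θ : ℝ} (ha : -1 < a) (hs : -1 < s) (hβ : 0 ≤ β)
    (hθ : 0 ≤ θ) (k : ℕ) :
    IntegrableOn (fun y : Fin n → ℝ => (∑ j, y j) ^ k * gibbsWeight a s β θ y) (unitCube n) := by
  refine integrableOn_mul_gibbsWeight ha hs hβ hθ (by fun_prop) ((n : ℝ) ^ k) fun y hy => ?_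
  rw [abs_pow]
  exact pow_le_pow_left₀ (abs_nonneg _) (abs_sum_unitCube_le hy) k

theorem gibbsMoment_nonneg {a s β θ : ℝ} (k : ℕ) : 0 ≤ gibbsMoment n a s β θ k :=
  setIntegral_nonneg measurableSet_unitCube fun _ hy => mul_nonneg
    (pow_nonneg (Finset.sum_nonneg fun j _ => (unitCube_pos hy j).le) k) (gibbsWeight_nonneg hy)

theorem hasDerivAt_gibbsWeight_exponent (a s β θ : ℝ) (y : Fin n → ℝ) :
    HasDerivAt (fun θ => gibbsWeight a s β θ y) (-(∑ j, y j) * gibbsWeight a s β θ y) θ := by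
  have h : ∀ θ, gibbsWeight a s β θ y =
      (interaction β y * ∏ j, (y j ^ a * (1 - y j) ^ s)) * Real.exp (-θ * ∑ j, y j) := by
    intro θ
    unfold gibbsWeight
    rw [Finset.prod_mul_distrib, ← Real.exp_sum, Finset.mul_sum, mul_assoc]
  simp only [h]
  refine ((((hasDerivAt_id θ).neg.mul_const (∑ j, y j)).exp).const_mul _).congr_deriv ?_
  simp
  ring

theorem hasDerivAt_gibbsMoment {a s β θ : ℝ} (ha : -1 < a) (hs : -1 < s) (hβ : 0 ≤ β)
    (hθ : 0 < θ) (k : ℕ) :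
    HasDerivAt (fun θ => gibbsMoment n a s β θ k) (-gibbsMoment n a s β θ (k + 1)) θ := by
  have h := hasDerivAt_integral_of_dominated_loc_of_deriv_le
    (μ := volume.restrict (unitCube n)) (x₀ := θ) (s := Set.Ioi 0)
    (bound := fun y => (n : ℝ) ^ (k + 1) * ∏ j, (y j ^ a * (1 - y j) ^ s))
    (F := fun θ y => (∑ j, y j) ^ k * gibbsWeight a s β θ y)
    (F' := fun θ y => (∑ j, y j) ^ k * (-(∑ j, y j) * gibbsWeight a s β θ y))
    (Ioi_mem_nhds hθ) ?_ ?_ ?_ ?_ ?_ ?_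
  · refine h.2.congr_deriv ?_
    unfold gibbsMoment
    rw [← integral_neg]
    congr 1
    ext y
    ring
  · exact Filter.Eventually.of_forall fun θ =>
      ((by fun_prop : Measurable fun y : Fin n → ℝ => (∑ j, y j) ^ k).mul
        (measurable_gibbsWeight a s β θ)).aestronglyMeasurable
  · exact integrableOn_pow_mul_gibbsWeight ha hs hβ hθ.le k
  · exact ((by fun_prop : Measurable fun y : Fin n → ℝ => (∑ j, y j) ^ k).mul
        ((by fun_prop : Measurable fun y : Fin n → ℝ => -(∑ j, y j)).mul
        (measurable_gibbsWeight a s β θ))).aestronglyMeasurable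
  · filter_upwards [ae_restrict_mem measurableSet_unitCube] with y hy θ' hθ'
    rw [norm_mul, norm_mul, norm_neg, Real.norm_of_nonneg (gibbsWeight_nonneg hy), norm_pow,
      ← mul_assoc, ← pow_succ]
    exact mul_le_mul (pow_le_pow_left₀ (norm_nonneg _) (abs_sum_unitCube_le hy) _)
      (gibbsWeight_le hβ (le_of_lt hθ') hy) (gibbsWeight_nonneg hy) (by positivity)
  · exact (integrableOn_unitCube_prod ha hs).const_mul _
  · filter_upwards with y θ' _
    exact (hasDerivAt_gibbsWeight_exponent a s β θ' y).const_mul _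

end Moments

/-! ### A barrier for second order differential inequalities -/

section Barrier

/-- A nonnegative function of polynomial growth satisfying a second order differential inequality
whose characteristic quadratic `t γ² - (t - K) γ + m (1 + 1 / (3 t))` is nonpositive at `t₀` has
logarithmic derivative at most `β γ` there: otherwise it would grow exponentially. -/
theorem deriv_le_of_differential_inequality {φ φ₁ φ₂ : ℝ → ℝ} {β K m t₀ γ C N : ℝ}
    (hβ : 0 < β) (ht₀ : 0 < t₀) (hm : 0 ≤ m)
    (h1 : ∀ t, 0 < t → HasDerivAt φ (φ₁ t) t) (h2 : ∀ t, 0 < t → HasDerivAt φ₁ (φ₂ t) t)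
    (hφ : ∀ t, 0 < t → 0 ≤ φ t)
    (hineq : ∀ t, 0 < t →
      β * (t - K) * (t * φ₁ t) - β ^ 2 * m * (t + 1 / 3) * φ t ≤ t ^ 2 * φ₂ t)
    (hgrow : ∀ t, 0 < t → φ t ≤ C * t ^ N) (hγ : 0 < γ) (hγ1 : γ ≤ 1)
    (hq : t₀ * γ ^ 2 - (t₀ - K) * γ + m * (1 + 1 / (3 * t₀)) ≤ 0) :
    φ₁ t₀ ≤ β * γ * φ t₀ := by
  by_contra hcon
  push Not at hcon
  set ψ : ℝ → ℝ := fun t => φ₁ t - β * γ * φ t with hψ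
  have hψ' : ∀ t, 0 < t → HasDerivAt ψ (φ₂ t - β * γ * φ₁ t) t := fun t ht =>
    (h2 t ht).sub ((h1 t ht).const_mul _)
  -- an integrating factor for the inequality `ψ' ≥ (β / t) (t - K - γ t) ψ`
  set E : ℝ → ℝ := fun t => Real.exp (-(β * ((1 - γ) * t - K * Real.log t))) with hE
  have hE' : ∀ t, 0 < t → HasDerivAt E (E t * -(β * ((1 - γ) - K / t))) t := by
    intro t ht
    have := ((((hasDerivAt_id t).const_mul (1 - γ)).sub
      ((Real.hasDerivAt_log ht.ne').const_mul K)).const_mul β).neg.exp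
    refine this.congr_deriv ?_
    simp [hE, div_eq_mul_inv]
  have hpos : ∀ t, t₀ ≤ t → 0 < t := fun t ht => ht₀.trans_le ht
  have hmono : MonotoneOn (fun t => E t * ψ t) (Set.Ici t₀) := by
    refine monotoneOn_of_hasDerivWithinAt_nonneg (convex_Ici t₀)
      (f' := fun t => E t * -(β * ((1 - γ) - K / t)) * ψ t + E t * (φ₂ t - β * γ * φ₁ t))
      (fun t ht => ((hE' t (hpos t ht)).mul (hψ' t (hpos t ht))).continuousAt.continuousWithinAt)
      (fun t ht => ?_) (fun t ht => ?_)
    · rw [interior_Ici] at ht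
      exact ((hE' t (hpos t (le_of_lt ht))).mul (hψ' t (hpos t (le_of_lt ht)))).hasDerivWithinAt
    · rw [interior_Ici] at ht
      have ht' : t₀ ≤ t := le_of_lt ht
      have htp := hpos t ht'
      have hqt : m * (1 + 1 / (3 * t)) ≤ γ * (t - K - γ * t) := by
        have e1 : 1 / (3 * t) ≤ 1 / (3 * t₀) := by gcongr
        have e2 : m * (1 + 1 / (3 * t)) ≤ m * (1 + 1 / (3 * t₀)) := by gcongr
        nlinarith [mul_nonneg (mul_nonneg hγ.le (sub_nonneg.2 hγ1)) (sub_nonneg.2 ht')]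
      have h3 := hineq t htp
      have h4 : 0 ≤ t ^ 2 * (-(β * ((1 - γ) - K / t)) * ψ t + (φ₂ t - β * γ * φ₁ t)) := by
        have e3 : t ^ 2 * (-(β * ((1 - γ) - K / t)) * ψ t + (φ₂ t - β * γ * φ₁ t)) =
          (t ^ 2 * φ₂ t - (β * (t - K) * (t * φ₁ t) - β ^ 2 * m * (t + 1 / 3) * φ t)) +
          β ^ 2 * t * φ t * (γ * (t - K - γ * t) - m * (1 + 1 / (3 * t))) := by
          simp only [hψ]
          field_simp
          ring
        rw [e3]
        have := mul_nonneg (mul_nonneg (mul_nonneg (sq_nonneg β) htp.le) (hφ t htp))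
          (sub_nonneg.2 hqt)
        linarith
      have h5 := nonneg_of_mul_nonneg_right h4 (by positivity)
      have h6 := mul_nonneg (Real.exp_pos (-(β * ((1 - γ) * t - K * Real.log t)))).le h5
      simp only [hE] at *
      linarith
  have hψpos : ∀ t, t₀ ≤ t → 0 < ψ t := by
    intro t ht
    have h3 := hmono (Set.self_mem_Ici) ht ht
    have h4 : 0 < E t₀ * ψ t₀ := mul_pos (Real.exp_pos _) (sub_pos.2 hcon)
    exact pos_of_mul_pos_right (h4.trans_le h3) (Real.exp_pos _).le
  set G : ℝ → ℝ := fun t => Real.exp (-(β * γ) * t) * φ t with hG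
  have hG' : ∀ t, 0 < t → HasDerivAt G (Real.exp (-(β * γ) * t) * ψ t) t := by
    intro t ht
    have := (((hasDerivAt_id t).const_mul (-(β * γ))).exp).mul (h1 t ht)
    refine this.congr_deriv ?_
    simp [hψ]
    ring
  have hGmono : StrictMonoOn G (Set.Ici t₀) := by
    refine strictMonoOn_of_hasDerivWithinAt_pos (convex_Ici t₀)
      (f' := fun t => Real.exp (-(β * γ) * t) * ψ t)
      (fun t ht => (hG' t (hpos t ht)).continuousAt.continuousWithinAt) (fun t ht => ?_)
      (fun t ht => ?_)
    · rw [interior_Ici] at ht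
      exact (hG' t (hpos t (le_of_lt ht))).hasDerivWithinAt
    · rw [interior_Ici] at ht
      exact mul_pos (Real.exp_pos _) (hψpos t (le_of_lt ht))
  have hc : 0 < G (t₀ + 1) := by
    have h3 : 0 ≤ G t₀ := mul_nonneg (Real.exp_pos _).le (hφ t₀ ht₀)
    have h4 : t₀ + 1 ∈ Set.Ici t₀ := by simp
    exact h3.trans_lt (hGmono Set.self_mem_Ici h4 (by linarith))
  have hlim : Filter.Tendsto (fun t : ℝ => C * (t ^ N * Real.exp (-(β * γ) * t))) Filter.atTop
      (nhds 0) := by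
    have := (tendsto_rpow_mul_exp_neg_mul_atTop_nhds_zero N (β * γ) (mul_pos hβ hγ)).const_mul C
    rwa [mul_zero] at this
  -- `G` increases strictly, whereas the polynomial bound on `φ` forces it to tend to `0`
  obtain ⟨t, ht1, ht2⟩ := ((hlim.eventually_lt_const hc).and
    (Filter.eventually_ge_atTop (t₀ + 1))).exists
  have h3 : G (t₀ + 1) ≤ G t :=
    hGmono.monotoneOn (by simp) (by simp only [Set.mem_Ici]; linarith) ht2
  have h4 : G t ≤ C * (t ^ N * Real.exp (-(β * γ) * t)) := by
    have := mul_le_mul_of_nonneg_left (hgrow t (by linarith)) (Real.exp_pos (-(β * γ) * t)).le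
    calc G t ≤ Real.exp (-(β * γ) * t) * (C * t ^ N) := this
      _ = _ := by ring
  linarith

end Barrier

/-! ### Decay of the density of the largest point -/

section EdgeDensity

variable {n : ℕ}

/-- Degree of homogeneity of `∏_{i < j} |x i - x j| ^ β ∏ (x i) ^ a (t - x i) ^ s dx` in `n`
variables. -/
noncomputable def gibbsDegree (n : ℕ) (a s β : ℝ) : ℝ :=
  n * (1 + a + s) + β / 2 * (n * (n - 1))

/-- The integral over `(0, t)ⁿ` of
`∏_{i < j} |x i - x j| ^ β ∏ (x i) ^ a (t - x i) ^ s exp (-β (x i) / 2)`, after rescaling to the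
unit cube. -/
noncomputable def scaledGibbs (n : ℕ) (a s β t : ℝ) : ℝ :=
  t ^ gibbsDegree n a s β * gibbsMoment n a s β (β / 2 * t) 0

/-- The derivative of `scaledGibbs`, up to the factor `t ^ (degree - 1)`. -/
noncomputable def scaledGibbsDrift (n : ℕ) (a s β t : ℝ) : ℝ :=
  gibbsDegree n a s β * gibbsMoment n a s β (β / 2 * t) 0 -
    β / 2 * t * gibbsMoment n a s β (β / 2 * t) 1

theorem hasDerivAt_scaledGibbs {a s β t : ℝ} (ha : -1 < a) (hs : -1 < s) (hβ : 0 < β)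
    (ht : 0 < t) :
    HasDerivAt (scaledGibbs n a s β)
      (t ^ (gibbsDegree n a s β - 1) * scaledGibbsDrift n a s β t) t := by
  have hm := (hasDerivAt_gibbsMoment (n := n) ha hs hβ.le (by positivity : 0 < β / 2 * t) 0).comp t
    ((hasDerivAt_id t).const_mul (β / 2))
  have hp := (hasDerivAt_id t).rpow_const (p := gibbsDegree n a s β) (Or.inl ht.ne')
  refine (hp.mul hm).congr_deriv ?_
  have : t ^ gibbsDegree n a s β = t ^ (gibbsDegree n a s β - 1) * t := by
    rw [← Real.rpow_add_one ht.ne', sub_add_cancel]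
  simp only [Function.comp, id, scaledGibbsDrift, this]
  ring

theorem hasDerivAt_deriv_scaledGibbs {a s β t : ℝ} (ha : -1 < a) (hs : -1 < s) (hβ : 0 < β)
    (ht : 0 < t) :
    HasDerivAt (fun t => t ^ (gibbsDegree n a s β - 1) * scaledGibbsDrift n a s β t)
      (t ^ (gibbsDegree n a s β - 2) *
        (gibbsDegree n a s β * (gibbsDegree n a s β - 1) * gibbsMoment n a s β (β / 2 * t) 0 -
          2 * gibbsDegree n a s β * (β / 2 * t) * gibbsMoment n a s β (β / 2 * t) 1 +
          (β / 2 * t) ^ 2 * gibbsMoment n a s β (β / 2 * t) 2)) t := by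
  set M := gibbsDegree n a s β with hM
  have hlin := (hasDerivAt_id t).const_mul (β / 2)
  have hm0 := (hasDerivAt_gibbsMoment (n := n) ha hs hβ.le (by positivity : 0 < β / 2 * t) 0).comp
    t hlin
  have hm1 := (hasDerivAt_gibbsMoment (n := n) ha hs hβ.le (by positivity : 0 < β / 2 * t) 1).comp
    t hlin
  have hp := (hasDerivAt_id t).rpow_const (p := M - 1) (Or.inl ht.ne')
  refine (hp.mul ((hm0.const_mul M).sub (hlin.mul hm1))).congr_deriv ?_
  have e1 : t ^ (M - 1) = t ^ (M - 2) * t := by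
    rw [← Real.rpow_add_one ht.ne']
    congr 1
    ring
  have e2 : t ^ (M - 1 - 1) = t ^ (M - 2) := by
    congr 1
    ring
  simp only [Function.comp, id, e1, e2, Pi.sub_apply, Pi.mul_apply]
  ring

/-- Decay of the density `t ^ a exp (-β t / 2) scaledGibbs n a β β t` of the largest point, in the
region where the discriminant of the characteristic quadratic is at least `4 t² ρ²`. -/
theorem edgeDensity_add_le {a β K ρ t₀ : ℝ} (hβ : 1 ≤ β) (hK : 0 < K) (haK : a = β / 2 * K - 1)
    (hρ : 0 ≤ ρ) (ht₀ : K < t₀)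
    (hdisc : ∀ t, t₀ ≤ t → 4 * t ^ 2 * ρ ^ 2 + 4 * n * (t + 1 / 3) < (t - K) ^ 2) {t δ : ℝ}
    (ht : t₀ ≤ t) (hδ : 0 ≤ δ) :
    (t + δ) ^ a * Real.exp (-(β / 2) * (t + δ)) * scaledGibbs n a β β (t + δ) ≤
      Real.exp (-(β * ρ * δ)) * (t ^ a * Real.exp (-(β / 2) * t) * scaledGibbs n a β β t) := by
  have hβ0 : 0 < β := by linarith
  have ha : -1 < a := by
    rw [haK]
    have : 0 < β / 2 * K := by positivity
    linarith
  have hs : -1 < β := by linarith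
  set M := gibbsDegree n a β β with hM
  set φ := scaledGibbs n a β β with hφ
  set φ₁ : ℝ → ℝ := fun t => t ^ (M - 1) * scaledGibbsDrift n a β β t with hφ₁
  have h1 : ∀ t, 0 < t → HasDerivAt φ (φ₁ t) t := fun t ht => hasDerivAt_scaledGibbs ha hs hβ0 ht
  have hnn : ∀ t, 0 < t → 0 ≤ φ t := fun t ht =>
    mul_nonneg (Real.rpow_nonneg ht.le _) (gibbsMoment_nonneg 0)
  -- `(1 - K / t) / 2` is the midpoint of the roots of the characteristic quadratic at `t`, and the
  -- roots are at distance at least `ρ` from it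
  have hlog : ∀ t, t₀ ≤ t → φ₁ t ≤ β * ((1 - K / t) / 2 - ρ) * φ t := by
    intro t ht
    have htp : 0 < t := by linarith
    have hd := hdisc t ht
    have hKt : K < t := by linarith
    have hn0 : (0 : ℝ) ≤ n := Nat.cast_nonneg n
    refine deriv_le_of_differential_inequality (m := n)
      (C := ∫ y in unitCube n, ∏ j, (y j ^ a * (1 - y j) ^ β)) (N := M) hβ0 htp hn0 h1
      (fun t ht => hasDerivAt_deriv_scaledGibbs ha hs hβ0 ht) hnn (K := K) ?_ ?_ ?_ ?_ ?_
    · intro t ht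
      have hθ : 0 < β / 2 * t := by positivity
      have hu := upperEdge_inequality (n := n) (M := M) ha hβ ht rfl
      have hKa : 2 * (a + 1) / β = K := by
        rw [haK]
        field_simp
        ring
      rw [hKa] at hu
      have i0 := integrableOn_pow_mul_gibbsWeight (n := n) ha hs hβ0.le hθ.le 0
      have i1 := integrableOn_pow_mul_gibbsWeight (n := n) ha hs hβ0.le hθ.le 1
      have i2 := integrableOn_pow_mul_gibbsWeight (n := n) ha hs hβ0.le hθ.le 2
      have hsplit : ∫ y in unitCube n, ((M - β / 2 * t * ∑ j, y j) ^ 2 - M -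
          β * (t - K) * (M - β / 2 * t * ∑ j, y j) +
          β ^ 2 * n * (t + 1 / 3)) * gibbsWeight a β β (β / 2 * t) y =
          (M ^ 2 - M - β * (t - K) * M + β ^ 2 * n * (t + 1 / 3)) *
            gibbsMoment n a β β (β / 2 * t) 0 +
          (β * (t - K) - 2 * M) * (β / 2 * t) * gibbsMoment n a β β (β / 2 * t) 1 +
          (β / 2 * t) ^ 2 * gibbsMoment n a β β (β / 2 * t) 2 := by
        unfold gibbsMoment
        rw [← integral_const_mul, ← integral_const_mul, ← integral_const_mul, ← integral_add,
          ← integral_add]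
        · congr 1
          ext y
          ring
        · exact (i0.const_mul _).add (i1.const_mul _)
        · exact i2.const_mul _
        · exact i0.const_mul _
        · exact i1.const_mul _
      rw [hsplit] at hu
      have e1 : t ^ (M - 1) = t ^ (M - 2) * t := by
        rw [← Real.rpow_add_one ht.ne']
        congr 1
        ring
      have e2 : t ^ M = t ^ (M - 2) * t ^ 2 := by
        rw [← Real.rpow_natCast, ← Real.rpow_add ht]
        congr 1
        push_cast
        ring
      have hp : 0 ≤ t ^ (M - 2) * t ^ 2 := by positivity
      have := mul_nonneg hp hu
      simp only [hφ₁, hφ, scaledGibbs, scaledGibbsDrift, ← hM, e1, e2]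
      linarith
    · intro t ht
      have hθ : 0 < β / 2 * t := by positivity
      simp only [hφ, scaledGibbs]
      rw [mul_comm]
      refine mul_le_mul_of_nonneg_right ?_ (Real.rpow_nonneg ht.le _)
      refine setIntegral_mono_on (integrableOn_pow_mul_gibbsWeight ha hs hβ0.le hθ.le 0)
        (integrableOn_unitCube_prod ha hs) measurableSet_unitCube fun y hy => ?_
      rw [pow_zero, one_mul]
      exact gibbsWeight_le hβ0.le hθ.le hy
    · have : 2 * (t * ρ) < t - K := by
        refine lt_of_pow_lt_pow_left₀ 2 (by linarith) ?_
        have : 0 ≤ 4 * n * (t + 1 / 3) := by positivity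
        nlinarith
      have e : (1 - K / t) / 2 - ρ = (t - K - 2 * (t * ρ)) / (2 * t) := by
        field_simp
      rw [e]
      apply div_pos <;> linarith
    · have : 0 < K / t := by positivity
      linarith
    · have e : t * ((1 - K / t) / 2 - ρ) ^ 2 - (t - K) * ((1 - K / t) / 2 - ρ) +
          n * (1 + 1 / (3 * t)) =
          (4 * t ^ 2 * ρ ^ 2 + 4 * n * (t + 1 / 3) - (t - K) ^ 2) / (4 * t) := by
        field_simp
        ring
      rw [e]
      exact div_nonpos_of_nonpos_of_nonneg (by linarith) (by linarith)
  have hanti : AntitoneOn (fun t => Real.exp (β * ρ * t) *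
      (t ^ a * Real.exp (-(β / 2) * t) * φ t)) (Set.Ici t₀) := by
    have hD : ∀ t, t₀ ≤ t → HasDerivAt (fun t => Real.exp (β * ρ * t) *
      (t ^ a * Real.exp (-(β / 2) * t) * φ t))
      (Real.exp (β * ρ * t) * (t ^ a * Real.exp (-(β / 2) * t)) *
        ((β * ρ + a / t - β / 2) * φ t + φ₁ t)) t := by
      intro t ht
      have htp : 0 < t := by linarith
      have e1 := ((hasDerivAt_id t).const_mul (β * ρ)).exp
      have e2 := (hasDerivAt_id t).rpow_const (p := a) (Or.inl htp.ne')
      have e3 := ((hasDerivAt_id t).const_mul (-(β / 2))).exp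
      refine (e1.mul ((e2.mul e3).mul (h1 t htp))).congr_deriv ?_
      simp only [id, Pi.mul_apply]
      rw [Real.rpow_sub_one htp.ne']
      ring
    refine antitoneOn_of_hasDerivWithinAt_nonpos (convex_Ici t₀)
      (f' := fun t => Real.exp (β * ρ * t) * (t ^ a * Real.exp (-(β / 2) * t)) *
        ((β * ρ + a / t - β / 2) * φ t + φ₁ t))
      (fun t ht => (hD t ht).continuousAt.continuousWithinAt) (fun t ht => ?_) (fun t ht => ?_)
    · rw [interior_Ici] at ht
      exact (hD t (le_of_lt ht)).hasDerivWithinAt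
    · rw [interior_Ici] at ht
      have htp : 0 < t := by
        have : t₀ < t := ht
        linarith
      refine mul_nonpos_of_nonneg_of_nonpos (by positivity) ?_
      have h3 := hlog t (le_of_lt ht)
      have e : (β * ρ + a / t - β / 2) * φ t + β * ((1 - K / t) / 2 - ρ) * φ t =
          -(φ t / t) := by
        rw [haK]
        field_simp
        ring
      have : 0 ≤ φ t / t := div_nonneg (hnn t htp) htp.le
      linarith
  have h5 := hanti (a := t) (b := t + δ) ht (by simp only [Set.mem_Ici]; linarith) (by linarith)
  simp only at h5
  have e5 : Real.exp (β * ρ * (t + δ)) = Real.exp (β * ρ * t) * Real.exp (β * ρ * δ) := by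
    rw [← Real.exp_add]
    ring_nf
  rw [e5, mul_assoc] at h5
  have h6 := le_of_mul_le_mul_left h5 (Real.exp_pos _)
  rw [Real.exp_neg, ← div_eq_inv_mul, le_div_iff₀ (Real.exp_pos _), mul_comm]
  exact h6

end EdgeDensity

/-! ### The law of the largest point -/

section LargestPoint

open scoped Pointwise

variable {n : ℕ}

/-- The repulsion as a product over ordered pairs, with half the exponent, which makes it visibly
symmetric. -/
theorem interaction_eq_prod_ite (β : ℝ) (y : Fin n → ℝ) :
    interaction β y = ∏ i, ∏ j, if j = i then 1 else |y j - y i| ^ (β / 2) := by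
  have h := Finset.prod_prod_Ioi_mul_eq_prod_prod_off_diag
    (fun j i : Fin n => |y j - y i| ^ (β / 2))
  unfold interaction
  have h1 : ∀ i : Fin n, (∏ j, if j = i then 1 else |y j - y i| ^ (β / 2)) =
      ∏ j ∈ ({i} : Finset (Fin n))ᶜ, |y j - y i| ^ (β / 2) := by
    intro i
    rw [← Finset.prod_compl_mul_prod {i}, Finset.prod_singleton, if_pos rfl, mul_one]
    exact Finset.prod_congr rfl fun j hj => if_neg (by simpa using hj)
  simp only [h1]
  rw [← h]
  refine Finset.prod_congr rfl fun i _ => Finset.prod_congr rfl fun j _ => ?_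
  rw [abs_sub_comm (y j) (y i)]
  rcases eq_or_ne (y i - y j) 0 with h0 | h0
  · rw [h0, abs_zero]
    rcases eq_or_ne β 0 with rfl | hb
    · simp
    · rw [Real.zero_rpow hb, Real.zero_rpow (by simpa using hb), zero_mul]
  · rw [← Real.rpow_add (abs_pos.2 h0), add_halves]

theorem interaction_insertNth (β : ℝ) (i : Fin (n + 1)) (u : ℝ) (x : Fin n → ℝ) :
    interaction β (i.insertNth u x : Fin (n + 1) → ℝ) =
      (∏ j, |u - x j| ^ β) * interaction β x := by
  rw [interaction_eq_prod_ite, interaction_eq_prod_ite, Fin.prod_univ_succAbove _ i]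
  simp only [Fin.prod_univ_succAbove _ i, Fin.insertNth_apply_same,
    Fin.insertNth_apply_succAbove, if_true, one_mul, Fin.succAbove_ne, if_false,
    (Fin.succAbove_ne i _).symm, Fin.succAbove_right_inj]
  rw [Finset.prod_mul_distrib, ← mul_assoc, ← Finset.prod_mul_distrib]
  congr 1
  refine Finset.prod_congr rfl fun j _ => ?_
  rw [abs_sub_comm (x j) u]
  rcases eq_or_ne (u - x j) 0 with h0 | h0
  · rw [h0, abs_zero]
    rcases eq_or_ne β 0 with rfl | hb
    · simp
    · rw [Real.zero_rpow hb, Real.zero_rpow (by simpa using hb), zero_mul]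
  · rw [← Real.rpow_add (abs_pos.2 h0), add_halves]

theorem interaction_smul {u : ℝ} (hu : 0 < u) (β : ℝ) (y : Fin n → ℝ) :
    interaction β (u • y) = u ^ (β / 2 * (n * (n - 1))) * interaction β y := by
  unfold interaction
  have h : ∀ i j : Fin n, |(u • y) i - (u • y) j| ^ β = u ^ β * |y i - y j| ^ β := by
    intro i j
    rw [Pi.smul_apply, Pi.smul_apply, smul_eq_mul, smul_eq_mul, ← mul_sub, abs_mul,
      abs_of_pos hu, Real.mul_rpow hu.le (abs_nonneg _)]
  simp only [h, Finset.prod_mul_distrib]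
  congr 1
  have h2 : ∀ k : Fin n, ∏ _l ∈ Finset.Ioi k, u ^ β = u ^ (∑ _l ∈ Finset.Ioi k, β) := by
    intro k
    rw [Finset.prod_const, Finset.sum_const, nsmul_eq_mul, mul_comm, Real.rpow_mul hu.le,
      Real.rpow_natCast]
  simp only [h2]
  rw [← Real.rpow_sum_of_pos hu, sum_Ioi_const]
  congr 1
  ring

/-- The weight `∏_j |u - x j| ^ s ∏_{i < j} |x i - x j| ^ β ∏_j (x j) ^ a exp (-β (x j) / 2)`; with
`s = β` it is the weight of the remaining points given a point at `u`. -/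
noncomputable def conditionedWeight {n : ℕ} (a s β u : ℝ) (x : Fin n → ℝ) : ℝ :=
  (∏ j, |u - x j| ^ s) * (interaction β x * ∏ j, (x j ^ a * Real.exp (-(β / 2) * x j)))

theorem measurable_conditionedWeight (a s β u : ℝ) :
    Measurable (conditionedWeight (n := n) a s β u) := by
  unfold conditionedWeight
  have := measurable_interaction (n := n) β
  fun_prop

theorem conditionedWeight_smul {a s β u : ℝ} (hu : 0 < u) {y : Fin n → ℝ}
    (hy : y ∈ unitCube n) :
    conditionedWeight a s β u (u • y) =
      u ^ (gibbsDegree n a s β - n) * gibbsWeight a s β (β / 2 * u) y := by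
  unfold conditionedWeight gibbsWeight
  rw [interaction_smul hu]
  have h1 : ∀ j, |u - (u • y) j| ^ s = u ^ s * (1 - y j) ^ s := by
    intro j
    have : 0 < 1 - y j := by linarith [unitCube_lt_one hy j]
    rw [Pi.smul_apply, smul_eq_mul, ← mul_one_sub, abs_mul, abs_of_pos hu, abs_of_pos this,
      Real.mul_rpow hu.le this.le]
  have h2 : ∀ j, (u • y) j ^ a * Real.exp (-(β / 2) * (u • y) j) =
      u ^ a * (y j ^ a * Real.exp (-(β / 2 * u) * y j)) := by
    intro j
    rw [Pi.smul_apply, smul_eq_mul, Real.mul_rpow hu.le (unitCube_pos hy j).le, mul_assoc]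
    congr 3
    ring
  simp only [h1, h2, Finset.prod_mul_distrib, Finset.prod_const, Finset.card_univ,
    Fintype.card_fin]
  have h3 : u ^ (gibbsDegree n a s β - n) =
      (u ^ s) ^ n * (u ^ (β / 2 * (n * (n - 1))) * (u ^ a) ^ n) := by
    rw [← Real.rpow_natCast, ← Real.rpow_natCast, ← Real.rpow_mul hu.le, ← Real.rpow_mul hu.le,
      ← Real.rpow_add hu, ← Real.rpow_add hu]
    congr 1
    unfold gibbsDegree
    ring
  rw [h3]
  ring

theorem smul_unitCube {u : ℝ} (hu : 0 < u) :
    u • unitCube n = Set.univ.pi fun _ => Set.Ioo 0 u := by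
  ext x
  rw [Set.mem_smul_set_iff_inv_smul_mem₀ hu.ne']
  simp only [unitCube, Set.mem_pi, Set.mem_univ, true_implies, Pi.smul_apply, smul_eq_mul,
    Set.mem_Ioo]
  refine forall_congr' fun j => ?_
  rw [inv_mul_lt_iff₀ hu, mul_one]
  exact and_congr_left' (mul_pos_iff_of_pos_left (inv_pos.2 hu))

theorem conditionedWeight_nonneg {a s β u : ℝ} {x : Fin n → ℝ} (hx : ∀ j, 0 < x j) :
    0 ≤ conditionedWeight a s β u x :=
  mul_nonneg (Finset.prod_nonneg fun j _ => by positivity) <|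
    mul_nonneg (interaction_nonneg β x) <| Finset.prod_nonneg fun j _ =>
      mul_nonneg (Real.rpow_nonneg (hx j).le _) (Real.exp_pos _).le

theorem setLIntegral_conditionedWeight {a s β u : ℝ} (ha : -1 < a) (hs : -1 < s) (hβ : 0 ≤ β)
    (hu : 0 < u) :
    ∫⁻ x in Set.univ.pi fun _ : Fin n => Set.Ioo 0 u,
      ENNReal.ofReal (conditionedWeight a s β u x) = ENNReal.ofReal (scaledGibbs n a s β u) := by
  rw [← smul_unitCube hu]
  have hms : MeasurableSet (u • unitCube n) := measurableSet_unitCube.const_smul₀ u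
  have hcomp : IntegrableOn (fun y : Fin n → ℝ => conditionedWeight a s β u (u • y))
      (unitCube n) := by
    refine IntegrableOn.congr_fun ((integrableOn_gibbsWeight (n := n) (θ := β / 2 * u) ha hs hβ
      (by positivity)).const_mul (u ^ (gibbsDegree n a s β - n))) (fun y hy => ?_)
      measurableSet_unitCube
    exact (conditionedWeight_smul hu hy).symm
  have hint : IntegrableOn (conditionedWeight (n := n) a s β u) (u • unitCube n) := by
    rw [← integrable_indicator_iff hms, ← integrable_comp_smul_iff _ _ hu.ne']
    rw [← integrable_indicator_iff measurableSet_unitCube] at hcomp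
    refine hcomp.congr (Filter.Eventually.of_forall fun y => ?_)
    simp only
    by_cases hy : y ∈ unitCube n
    · rw [Set.indicator_of_mem hy,
        Set.indicator_of_mem ((Set.smul_mem_smul_set_iff₀ hu.ne' _ _).2 hy)]
    · rw [Set.indicator_of_notMem hy,
        Set.indicator_of_notMem (fun h => hy ((Set.smul_mem_smul_set_iff₀ hu.ne' _ _).1 h))]
  rw [← ofReal_integral_eq_lintegral_ofReal hint]
  · congr 1
    have h := Measure.setIntegral_comp_smul (volume : Measure (Fin n → ℝ))
      (conditionedWeight a s β u) (unitCube n) hu.ne'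
    rw [setIntegral_congr_fun measurableSet_unitCube
      (fun y hy => conditionedWeight_smul hu hy), integral_const_mul, Module.finrank_fin_fun,
      abs_of_pos (by positivity), smul_eq_mul, ← div_eq_inv_mul, eq_div_iff (by positivity)] at h
    rw [← h]
    unfold scaledGibbs gibbsMoment
    simp only [pow_zero, one_mul]
    rw [mul_right_comm, ← Real.rpow_natCast u n, ← Real.rpow_add hu, sub_add_cancel]
  · filter_upwards [ae_restrict_mem hms] with x hx
    rw [smul_unitCube hu] at hx
    exact conditionedWeight_nonneg fun j => (hx j (Set.mem_univ j)).1

theorem laguerreDensity_insertNth {a κ β : ℝ} (ha : a = β / 2 * (κ - (n + 1 : ℕ) + 1) - 1)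
    (i : Fin (n + 1)) (u : ℝ) (x : Fin n → ℝ) :
    laguerreDensity (n + 1) κ β (i.insertNth u x) =
      u ^ a * Real.exp (-(β / 2) * u) * conditionedWeight a β β u x := by
  change interaction β (i.insertNth u x : Fin (n + 1) → ℝ) * _ = _
  rw [interaction_insertNth, ← ha, Fin.prod_univ_succAbove _ i]
  simp only [Fin.insertNth_apply_same, Fin.insertNth_apply_succAbove]
  unfold conditionedWeight
  ring

/-- The configurations whose `i`-th point exceeds all others and is at least `t`. -/
def strictMaxAt (i : Fin n) (t : ℝ) : Set (Fin n → ℝ) := {x | t ≤ x i ∧ ∀ j, j ≠ i → x j < x i}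

theorem measurableSet_strictMaxAt (i : Fin n) (t : ℝ) : MeasurableSet (strictMaxAt i t) := by
  have : strictMaxAt i t = {x | t ≤ x i} ∩ ⋂ j, ⋂ (_ : j ≠ i), {x | x j < x i} := by
    ext x
    simp [strictMaxAt]
  rw [this]
  exact (measurableSet_le measurable_const (measurable_pi_apply i)).inter
    (MeasurableSet.iInter fun j => MeasurableSet.iInter fun _ =>
      measurableSet_lt (measurable_pi_apply j) (measurable_pi_apply i))

/-- Disintegration of the weight of `strictMaxAt` over the position of the largest point. -/
theorem laguerreWeight_strictMaxAt {a κ β t : ℝ} (hκ : ((n + 1 : ℕ) : ℝ) < κ + 1) (hβ : 1 ≤ β)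
    (ha : a = β / 2 * (κ - (n + 1 : ℕ) + 1) - 1) (ht : 0 < t) (i : Fin (n + 1)) :
    laguerreWeight (n + 1) κ β (strictMaxAt i t) =
      ∫⁻ u in Set.Ici t, ENNReal.ofReal
        (u ^ a * Real.exp (-(β / 2) * u) * scaledGibbs n a β β u) := by
  have ha1 : -1 < a := by
    rw [ha]
    have : 0 < β / 2 * (κ - (n + 1 : ℕ) + 1) := by apply mul_pos <;> linarith
    linarith
  have hS : MeasurableSet (Set.univ.pi fun _ : Fin (n + 1) => Set.Ioi (0 : ℝ)) :=
    MeasurableSet.univ_pi fun _ => measurableSet_Ioi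
  have hB := measurableSet_strictMaxAt i t
  have hg : Measurable fun x => ENNReal.ofReal (laguerreDensity (n + 1) κ β x) :=
    (measurable_laguerreDensity (n + 1) κ β).ennreal_ofReal
  have hmp := (volume_preserving_piFinSuccAbove (fun _ : Fin (n + 1) => ℝ) i).symm
  set e := (MeasurableEquiv.piFinSuccAbove (fun _ : Fin (n + 1) => ℝ) i).symm
  have he : ∀ p : ℝ × (Fin n → ℝ), e p = i.insertNth p.1 p.2 := fun p => rfl
  set F : (Fin (n + 1) → ℝ) → ENNReal :=
    (strictMaxAt i t ∩ Set.univ.pi fun _ => Set.Ioi (0 : ℝ)).indicator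
      fun x => ENNReal.ofReal (laguerreDensity (n + 1) κ β x) with hF
  have hFm : Measurable F := hg.indicator (hB.inter hS)
  rw [laguerreWeight, withDensity_apply _ hB, Measure.restrict_restrict hB,
    ← lintegral_indicator (hB.inter hS), ← hmp.lintegral_comp hFm, Measure.volume_eq_prod,
    lintegral_prod (fun p => F (e p)) (hFm.comp e.measurable).aemeasurable,
    ← lintegral_indicator measurableSet_Ici]
  refine lintegral_congr fun u => ?_
  by_cases hu : t ≤ u
  · have hu0 : 0 < u := ht.trans_le hu
    have hpt : ∀ z : Fin n → ℝ, F (e (u, z)) =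
        (Set.univ.pi fun _ : Fin n => Set.Ioo 0 u).indicator (fun z =>
          ENNReal.ofReal (u ^ a * Real.exp (-(β / 2) * u)) *
            ENNReal.ofReal (conditionedWeight a β β u z)) z := by
      intro z
      have hiff : e (u, z) ∈ strictMaxAt i t ∩ (Set.univ.pi fun _ => Set.Ioi (0 : ℝ)) ↔
          z ∈ Set.univ.pi fun _ : Fin n => Set.Ioo 0 u := by
        simp only [he, strictMaxAt, Set.mem_inter_iff, Set.mem_ofPred_eq, Set.mem_pi, Set.mem_univ,
          true_implies, i.forall_iff_succAbove, Fin.insertNth_apply_same,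
          Fin.insertNth_apply_succAbove, Set.mem_Ioi, Set.mem_Ioo, ne_eq, not_true, false_implies,
          Fin.succAbove_ne, not_false_iff, true_and, hu, hu0]
        exact ⟨fun h j => ⟨h.2 j, h.1 j⟩, fun h => ⟨fun j => (h j).2, fun j => (h j).1⟩⟩
      by_cases hz : z ∈ Set.univ.pi fun _ : Fin n => Set.Ioo 0 u
      · rw [hF, Set.indicator_of_mem (hiff.2 hz), Set.indicator_of_mem hz, he,
          laguerreDensity_insertNth ha, ENNReal.ofReal_mul (by positivity)]
      · rw [hF, Set.indicator_of_notMem (fun h => hz (hiff.1 h)), Set.indicator_of_notMem hz]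
    simp only [hpt]
    rw [Set.indicator_of_mem (by exact hu),
      lintegral_indicator (MeasurableSet.univ_pi fun _ => measurableSet_Ioo),
      lintegral_const_mul _ (measurable_conditionedWeight a β β u).ennreal_ofReal,
      setLIntegral_conditionedWeight ha1 (by linarith) (by linarith) hu0,
      ← ENNReal.ofReal_mul (by positivity)]
  · rw [Set.indicator_of_notMem (by exact hu)]
    have : ∀ z : Fin n → ℝ, F (e (u, z)) = 0 := by
      intro z
      refine Set.indicator_of_notMem (fun h => hu ?_) _
      simpa [he] using h.1.1
    simp [this]

/-- Configurations with coinciding points are negligible: the density vanishes there. -/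
theorem laguerreWeight_ties {κ β : ℝ} (hβ : β ≠ 0) :
    laguerreWeight n κ β {x | ∃ i j, i ≠ j ∧ x i = x j} = 0 := by
  have hT : MeasurableSet {x : Fin n → ℝ | ∃ i j, i ≠ j ∧ x i = x j} := by
    have : {x : Fin n → ℝ | ∃ i j, i ≠ j ∧ x i = x j} =
        ⋃ i, ⋃ j, ⋃ (_ : i ≠ j), {x | x i = x j} := by
      ext x
      simp
    rw [this]
    exact MeasurableSet.iUnion fun i => MeasurableSet.iUnion fun j => MeasurableSet.iUnion fun _ =>
      measurableSet_eq_fun (measurable_pi_apply i) (measurable_pi_apply j)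
  rw [laguerreWeight, withDensity_apply _ hT]
  refine (setLIntegral_congr_fun hT (g := fun _ => 0) fun x hx => ?_).trans (by simp)
  obtain ⟨i, j, hij, h⟩ := hx
  have : laguerreDensity n κ β x = 0 := by
    change interaction β x * _ = 0
    rw [interaction_eq_zero hβ hij h, zero_mul]
  simp [this]

/-- Exponential decay of the tail of the largest point beyond `t₀`, at the rate given by the
discriminant of the characteristic quadratic. -/
theorem laguerreEnsemble_largestPoint_ge_le {κ β ρ t₀ δ : ℝ} (hκ : ((n + 1 : ℕ) : ℝ) < κ + 1)
    (hβ : 1 ≤ β) (hρ : 0 ≤ ρ) (ht₀ : κ - n < t₀)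
    (hdisc : ∀ t, t₀ ≤ t → 4 * t ^ 2 * ρ ^ 2 + 4 * n * (t + 1 / 3) < (t - (κ - n)) ^ 2)
    (hδ : 0 ≤ δ) :
    (laguerreEnsemble (n + 1) κ β).real {x | t₀ + δ ≤ largestPoint x} ≤
      Real.exp (-(β * ρ * δ)) := by
  have hβ0 : 0 < β := by linarith
  obtain ⟨a, ha⟩ : ∃ a : ℝ, a = β / 2 * (κ - (n + 1 : ℕ) + 1) - 1 := ⟨_, rfl⟩
  have hK : 0 < κ - n := by
    push_cast at hκ
    linarith
  have ha' : a = β / 2 * (κ - n) - 1 := by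
    rw [ha]
    push_cast
    ring
  have ht0 : 0 < t₀ := hK.trans ht₀
  have hstep : ∀ i : Fin (n + 1), laguerreWeight (n + 1) κ β (strictMaxAt i (t₀ + δ)) ≤
      ENNReal.ofReal (Real.exp (-(β * ρ * δ))) *
        laguerreWeight (n + 1) κ β (strictMaxAt i t₀) := by
    intro i
    rw [laguerreWeight_strictMaxAt hκ hβ ha (by linarith),
      laguerreWeight_strictMaxAt hκ hβ ha ht0, ← lintegral_indicator measurableSet_Ici,
      ← lintegral_indicator measurableSet_Ici,
      ← lintegral_const_mul' _ _ ENNReal.ofReal_ne_top]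
    rw [← lintegral_add_right_eq_self _ δ]
    refine lintegral_mono fun u => ?_
    by_cases hu : t₀ ≤ u
    · rw [Set.indicator_of_mem (by simpa using hu), Set.indicator_of_mem (by simpa using hu),
        ← ENNReal.ofReal_mul (Real.exp_pos _).le]
      exact ENNReal.ofReal_le_ofReal (edgeDensity_add_le hβ hK ha' hρ ht₀ hdisc hu hδ)
    · rw [Set.indicator_of_notMem (by simpa using hu)]
      exact bot_le
  have hcover : {x : Fin (n + 1) → ℝ | t₀ + δ ≤ largestPoint x} ⊆
      (⋃ i, strictMaxAt i (t₀ + δ)) ∪ {x | ∃ i j, i ≠ j ∧ x i = x j} := by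
    intro x hx
    by_cases hT : ∃ i j, i ≠ j ∧ x i = x j
    · exact Or.inr hT
    · push Not at hT
      left
      obtain ⟨i, hi⟩ := exists_eq_ciSup_of_finite (f := x)
      refine Set.mem_iUnion.2 ⟨i, ?_, fun j hj => lt_of_le_of_ne ?_ (hT j i hj)⟩
      · rw [hi]
        exact hx
      · rw [hi]
        exact le_ciSup (Set.finite_range x).bddAbove j
  have hdisj : ∑ i, laguerreWeight (n + 1) κ β (strictMaxAt i t₀) ≤
      laguerreWeight (n + 1) κ β Set.univ := by
    have h := measure_iUnion (μ := laguerreWeight (n + 1) κ β)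
      (f := fun i : Fin (n + 1) => strictMaxAt i t₀)
      (fun i j hij => Set.disjoint_left.2 fun x hi hj =>
        lt_asymm (hi.2 j hij.symm) (hj.2 i hij))
      fun i => measurableSet_strictMaxAt i t₀
    rw [tsum_fintype] at h
    rw [← h]
    exact measure_mono (Set.subset_univ _)
  have hmain : laguerreWeight (n + 1) κ β {x | t₀ + δ ≤ largestPoint x} ≤
      ENNReal.ofReal (Real.exp (-(β * ρ * δ))) * laguerreWeight (n + 1) κ β Set.univ := by
    calc _ ≤ laguerreWeight (n + 1) κ β ((⋃ i, strictMaxAt i (t₀ + δ)) ∪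
            {x | ∃ i j, i ≠ j ∧ x i = x j}) := measure_mono hcover
      _ ≤ laguerreWeight (n + 1) κ β (⋃ i, strictMaxAt i (t₀ + δ)) + 0 := by
          rw [← laguerreWeight_ties (n := n + 1) (κ := κ) hβ0.ne']
          exact measure_union_le _ _
      _ ≤ ∑ i, laguerreWeight (n + 1) κ β (strictMaxAt i (t₀ + δ)) := by
          rw [add_zero]
          exact measure_iUnion_fintype_le _ _
      _ ≤ ∑ i, ENNReal.ofReal (Real.exp (-(β * ρ * δ))) *
            laguerreWeight (n + 1) κ β (strictMaxAt i t₀) := Finset.sum_le_sum fun i _ => hstep i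
      _ ≤ _ := by
          rw [← Finset.mul_sum]
          gcongr
  refine ENNReal.toReal_le_of_le_ofReal (Real.exp_pos _).le ?_
  rw [laguerreEnsemble, Measure.smul_apply, smul_eq_mul]
  calc _ ≤ (laguerreWeight (n + 1) κ β Set.univ)⁻¹ * (ENNReal.ofReal (Real.exp (-(β * ρ * δ))) *
        laguerreWeight (n + 1) κ β Set.univ) := by gcongr
    _ = ENNReal.ofReal (Real.exp (-(β * ρ * δ))) := by
        rw [mul_left_comm, ENNReal.inv_mul_cancel (laguerreWeight_univ_ne_zero _ _ _)
          (laguerreWeight_univ_ne_top _ hκ hβ0), mul_one]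

end LargestPoint

/-! ### The loop equation with a hard wall -/

section HardWall

variable {n : ℕ}

/-- The left-hand side of the quadratic (Riccati) loop equation for the resolvent
`G = ∑ (ζ - y j)⁻¹` of the points confined to the unit cube; `c = 2 a / β`. -/
noncomputable def loopQuadratic {n : ℕ} (c β t ζ : ℝ) (y : Fin n → ℝ) : ℝ :=
  ζ * (∑ j, (ζ - y j)⁻¹) ^ 2 - (1 - 2 / β) * ζ * (∑ j, ((ζ - y j)⁻¹) ^ 2) -
    (t * ζ - c) * (∑ j, (ζ - y j)⁻¹) + n * t

/-- The divergence, with respect to the Gibbs weight without repulsion from the face `y i = 1`, of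
the vector field `y i (1 - y i) / (ζ - y i)`, at a point with distinct coordinates. -/
theorem divergence_hardWall_field {a β t κ ζ : ℝ} (hβ : 0 < β)
    (ha : a = β / 2 * (κ - n + 1) - 1) (hζ : 1 < ζ) {y : Fin n → ℝ} (hy : y ∈ unitCube n)
    (hinj : ∀ k l, k < l → y k ≠ y l) :
    (∑ i, (1 - (ζ - 1) * ζ * ((ζ - y i)⁻¹) ^ 2 +
        y i * (1 - y i) * (ζ - y i)⁻¹ * (a / y i - 0 / (1 - y i) - β / 2 * t))) +
      β * ∑ k, ∑ l ∈ Finset.Ioi k, (y k * (1 - y k) * (ζ - y k)⁻¹ -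
        y l * (1 - y l) * (ζ - y l)⁻¹) * (y k - y l)⁻¹ =
      β / 2 * (n * κ - t * ∑ j, y j) -
        (ζ - 1) * (β / 2) * loopQuadratic (2 * a / β) β t ζ y := by
  set x : Fin n → ℝ := fun j => (ζ - y j)⁻¹ with hx
  have hne : ∀ j, ζ - y j ≠ 0 := fun j => by
    have := unitCube_lt_one hy j
    linarith
  have hpair : ∑ k, ∑ l ∈ Finset.Ioi k, (y k * (1 - y k) * (ζ - y k)⁻¹ -
        y l * (1 - y l) * (ζ - y l)⁻¹) * (y k - y l)⁻¹ =
        n * (n - 1) / 2 * 1 - (ζ - 1) * ζ * (((∑ j, x j) ^ 2 - ∑ j, x j ^ 2) / 2) := by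
    have h0 : ∀ k, ∀ l ∈ Finset.Ioi k, (y k * (1 - y k) * (ζ - y k)⁻¹ -
        y l * (1 - y l) * (ζ - y l)⁻¹) * (y k - y l)⁻¹ = 1 - (ζ - 1) * ζ * (x k * x l) := by
      intro k l hl
      have h1 := sub_ne_zero.2 (hinj k l (Finset.mem_Ioi.1 hl))
      have h2 := hne k
      have h3 := hne l
      simp only [hx]
      field_simp
      ring
    rw [Finset.sum_congr rfl fun k _ => Finset.sum_congr rfl (h0 k)]
    simp only [Finset.sum_sub_distrib]
    rw [sum_Ioi_const, ← sum_Ioi_mul_eq x, Finset.mul_sum]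
    simp only [Finset.mul_sum]
  have hone : ∀ i ∈ Finset.univ, (1 - (ζ - 1) * ζ * ((ζ - y i)⁻¹) ^ 2 +
        y i * (1 - y i) * (ζ - y i)⁻¹ * (a / y i - 0 / (1 - y i) - β / 2 * t)) =
      (1 + a - β / 2 * t * (ζ - 1)) + (-(β / 2 * t)) * y i +
        ((ζ - 1) * (β / 2 * t * ζ - a)) * x i + (-((ζ - 1) * ζ)) * x i ^ 2 := by
    intro i _
    have h2 := hne i
    have h3 : y i ≠ 0 := (unitCube_pos hy i).ne'
    simp only [hx]
    field_simp
    ring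
  rw [hpair, Finset.sum_congr rfl hone]
  simp only [Finset.sum_add_distrib, ← Finset.mul_sum, Finset.sum_const, Finset.card_univ,
    Fintype.card_fin, nsmul_eq_mul, loopQuadratic]
  change _ = β / 2 * (n * κ - t * ∑ j, y j) - (ζ - 1) * (β / 2) *
    (ζ * (∑ j, x j) ^ 2 - (1 - 2 / β) * ζ * (∑ j, x j ^ 2) -
      (t * ζ - 2 * a / β) * (∑ j, x j) + n * t)
  rw [ha]
  field_simp
  ring

theorem measurable_loopQuadratic (c β t ζ : ℝ) :
    Measurable (loopQuadratic (n := n) c β t ζ) := by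
  unfold loopQuadratic
  fun_prop

theorem abs_loopQuadratic_le {c β t ζ₀ ζ₁ ζ : ℝ} (ht : 0 < t) (hζ₀ : 1 < ζ₀) (h0 : ζ₀ ≤ ζ)
    (h1 : ζ ≤ ζ₁) {y : Fin n → ℝ} (hy : y ∈ unitCube n) :
    |loopQuadratic c β t ζ y| ≤ ζ₁ * (n * (ζ₀ - 1)⁻¹) ^ 2 +
      |1 - 2 / β| * ζ₁ * (n * ((ζ₀ - 1)⁻¹) ^ 2) +
      (t * ζ₁ + |c|) * (n * (ζ₀ - 1)⁻¹) + n * t := by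
  have hpos : 0 < ζ₀ - 1 := by linarith
  have hx0 : ∀ j, 0 ≤ (ζ - y j)⁻¹ := fun j =>
    inv_nonneg.2 (by linarith [unitCube_lt_one hy j])
  have hx : ∀ j, (ζ - y j)⁻¹ ≤ (ζ₀ - 1)⁻¹ := fun j => by
    have := unitCube_lt_one hy j
    exact inv_anti₀ hpos (by linarith)
  have hG0 : 0 ≤ ∑ j, (ζ - y j)⁻¹ := Finset.sum_nonneg fun j _ => hx0 j
  have hG : ∑ j, (ζ - y j)⁻¹ ≤ n * (ζ₀ - 1)⁻¹ := by
    refine (Finset.sum_le_sum fun j _ => hx j).trans ?_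
    simp
  have hS0 : 0 ≤ ∑ j, ((ζ - y j)⁻¹) ^ 2 := Finset.sum_nonneg fun j _ => sq_nonneg _
  have hS : ∑ j, ((ζ - y j)⁻¹) ^ 2 ≤ n * ((ζ₀ - 1)⁻¹) ^ 2 := by
    refine (Finset.sum_le_sum fun j _ => pow_le_pow_left₀ (hx0 j) (hx j) 2).trans ?_
    simp
  have hζ : 0 < ζ := by linarith
  have hζ₁ : 0 ≤ ζ₁ := by linarith
  unfold loopQuadratic
  refine (abs_add_le _ _).trans (add_le_add ((abs_sub _ _).trans (add_le_add
    ((abs_sub _ _).trans (add_le_add ?_ ?_)) ?_)) ?_)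
  · rw [abs_of_nonneg (by positivity)]
    gcongr
  · rw [abs_mul, abs_mul, abs_of_pos hζ, abs_of_nonneg hS0]
    gcongr
  · rw [abs_mul, abs_of_nonneg hG0]
    refine mul_le_mul ((abs_sub _ _).trans ?_) hG hG0 (by positivity)
    rw [abs_of_nonneg (by positivity)]
    gcongr
  · rw [abs_of_nonneg (by positivity)]

/-- Loop equation with a hard wall at `1`, for the field `y i (1 - y i) / (ζ - y i)`, which vanishes
at the wall. -/
theorem hardWall_loop_equation {a β t κ ζ : ℝ} (hβ : 1 ≤ β) (hκ : (n : ℝ) < κ + 1) (ht : 0 < t)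
    (ha : a = β / 2 * (κ - n + 1) - 1) (hζ : 1 < ζ) :
    n * κ * gibbsMoment n a 0 β (β / 2 * t) 0 - t * gibbsMoment n a 0 β (β / 2 * t) 1 =
      (ζ - 1) * ∫ y in unitCube n, loopQuadratic (2 * a / β) β t ζ y *
        gibbsWeight a 0 β (β / 2 * t) y := by
  have hβ0 : 0 < β := by linarith
  have ha1 : -1 < a := by
    rw [ha]
    have : 0 < β / 2 * (κ - n + 1) := by apply mul_pos <;> linarith
    linarith
  have hθ : 0 < β / 2 * t := by positivity
  have hζ1 : 0 < ζ - 1 := by linarith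
  set C := (ζ - 1)⁻¹ + 1 + (ζ - 1) * ζ * ((ζ - 1)⁻¹) ^ 2 with hC
  have hx0 : ∀ y ∈ unitCube n, ∀ j, 0 ≤ (ζ - y j)⁻¹ := fun y hy j =>
    inv_nonneg.2 (by linarith [unitCube_lt_one hy j])
  have hx : ∀ y ∈ unitCube n, ∀ j, (ζ - y j)⁻¹ ≤ (ζ - 1)⁻¹ := fun y hy j => by
    have := unitCube_lt_one hy j
    exact inv_anti₀ hζ1 (by linarith)
  have hloop := (loop_equation (n := n) (a := a) (s := 0) (β := β) (θ := β / 2 * t) (q := 0)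
    (C := C) ha1 hβ hθ.le (by norm_num)
    (h := fun i y => y i * (1 - y i) * (ζ - y i)⁻¹)
    (h' := fun i y => 1 - (ζ - 1) * ζ * ((ζ - y i)⁻¹) ^ 2)
    (fun i => by fun_prop) (fun i => by fun_prop) ?_ ?_ ?_).2
  · have i0 := integrableOn_pow_mul_gibbsWeight (n := n) (s := 0) ha1 (by norm_num) hβ0.le hθ.le 0
    have i1 := integrableOn_pow_mul_gibbsWeight (n := n) (s := 0) ha1 (by norm_num) hβ0.le hθ.le 1
    have iQ := integrableOn_mul_gibbsWeight (n := n) (s := 0) ha1 (by norm_num) hβ0.le hθ.le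
      (measurable_loopQuadratic (2 * a / β) β t ζ) _
      (fun y hy => abs_loopQuadratic_le (c := 2 * a / β) (β := β) ht hζ le_rfl le_rfl hy)
    have heq : ∀ y ∈ unitCube n, ((∑ i, (1 - (ζ - 1) * ζ * ((ζ - y i)⁻¹) ^ 2 +
        y i * (1 - y i) * (ζ - y i)⁻¹ * (a / y i - 0 / (1 - y i) - β / 2 * t))) +
        β * ∑ k, ∑ l ∈ Finset.Ioi k, (y k * (1 - y k) * (ζ - y k)⁻¹ -
        y l * (1 - y l) * (ζ - y l)⁻¹) * (y k - y l)⁻¹) * gibbsWeight a 0 β (β / 2 * t) y =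
        β / 2 * (n * κ) * ((∑ j, y j) ^ 0 * gibbsWeight a 0 β (β / 2 * t) y) -
        β / 2 * t * ((∑ j, y j) ^ 1 * gibbsWeight a 0 β (β / 2 * t) y) -
        (ζ - 1) * (β / 2) * (loopQuadratic (2 * a / β) β t ζ y *
          gibbsWeight a 0 β (β / 2 * t) y) := by
      intro y hy
      by_cases hinj : ∀ k l, k < l → y k ≠ y l
      · rw [divergence_hardWall_field hβ0 ha hζ hy hinj]
        ring
      · push Not at hinj
        obtain ⟨k, l, hkl, hEq⟩ := hinj
        have : gibbsWeight a 0 β (β / 2 * t) y = 0 := by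
          unfold gibbsWeight
          rw [interaction_eq_zero hβ0.ne' hkl.ne hEq, zero_mul]
        simp [this]
    rw [setIntegral_congr_fun measurableSet_unitCube heq, integral_sub, integral_sub,
      integral_const_mul, integral_const_mul, integral_const_mul] at hloop
    · have hb : β / 2 ≠ 0 := by positivity
      refine mul_left_cancel₀ hb ?_
      unfold gibbsMoment
      linarith
    · exact i0.const_mul _
    · exact i1.const_mul _
    · exact (i0.const_mul _).sub (i1.const_mul _)
    · exact iQ.const_mul _
  · intro i y hy
    have hne : ζ - y i ≠ 0 := by linarith [unitCube_lt_one hy i]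
    have hid := hasDerivAt_id (y i)
    have := (hid.mul (hid.const_sub 1)).mul ((hid.const_sub ζ).inv hne)
    simp only [Function.update_self]
    refine this.congr_deriv ?_
    simp only [id, Pi.mul_apply, Pi.inv_apply]
    field_simp
    ring
  · intro i y hy
    have h0 := unitCube_pos hy i
    have h1 : 0 < 1 - y i := by linarith [unitCube_lt_one hy i]
    simp only [Real.rpow_zero, Finset.prod_const_one, mul_one]
    rw [abs_mul, abs_of_pos (mul_pos h0 h1), abs_of_nonneg (hx0 y hy i), mul_comm]
    refine mul_le_mul_of_nonneg_right ((hx y hy i).trans ?_) (mul_pos h0 h1).le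
    rw [hC, add_assoc]
    refine le_add_of_nonneg_right ?_
    positivity
  · intro i y hy
    simp only [Real.rpow_zero, Finset.prod_const_one, mul_one]
    refine (abs_sub _ _).trans ?_
    rw [abs_one, abs_of_nonneg (by positivity), hC, add_assoc]
    have h2 : (ζ - 1) * ζ * ((ζ - y i)⁻¹) ^ 2 ≤ (ζ - 1) * ζ * ((ζ - 1)⁻¹) ^ 2 :=
      mul_le_mul_of_nonneg_left (pow_le_pow_left₀ (hx0 y hy i) (hx y hy i) 2) (by positivity)
    have h3 : 0 ≤ (ζ - 1)⁻¹ := by positivity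
    linarith

/-- Completing the square in the resolvent, after integration against the squared test function
`((ζ - ζ₀) (ζ₁ - ζ))²`: a deterministic lower bound valid for every configuration. The part of
the loop quadratic which is linear in `∑ (ζ - y j)⁻² = -G'` is integrated by parts in `ζ`. -/
theorem integral_loopQuadratic_ge {β t d ζ₀ ζ₁ D : ℝ} (hβ : 1 ≤ β) (ht : 0 < t) (hζ₀ : 1 < ζ₀)
    (hζ : ζ₀ < ζ₁)
    (hD : ∀ ζ ∈ Set.Icc ζ₀ ζ₁, D ≤ t * (n - 1 / 2) - (t * ζ - d) ^ 2 / (4 * ζ))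
    {y : Fin n → ℝ} (hy : y ∈ unitCube n) :
    D * ((ζ₁ - ζ₀) ^ 5 / 30) - ζ₁ * ((ζ₁ - ζ₀) ^ 3 / 3) ≤
      ∫ ζ in ζ₀..ζ₁, ((ζ - ζ₀) * (ζ₁ - ζ)) ^ 2 *
        loopQuadratic (d + (1 - 2 / β)) β t ζ y := by
  set ν := 1 - 2 / β with hν
  have hβ0 : 0 < β := by linarith
  have hν1 : -1 ≤ ν := by
    have : 2 / β ≤ 2 := by
      rw [div_le_iff₀ hβ0]
      linarith
    rw [hν]
    linarith
  have hν2 : ν ≤ 1 := by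
    have : 0 < 2 / β := by positivity
    rw [hν]
    linarith
  set G : ℝ → ℝ := fun ζ => ∑ j, (ζ - y j)⁻¹ with hG
  set S : ℝ → ℝ := fun ζ => ∑ j, ((ζ - y j)⁻¹) ^ 2 with hS
  have hne : ∀ ζ, ζ₀ ≤ ζ → ∀ j, ζ - y j ≠ 0 := fun ζ h j => by
    have := unitCube_lt_one hy j
    linarith
  have hG' : ∀ ζ, ζ₀ ≤ ζ → HasDerivAt G (-S ζ) ζ := by
    intro ζ h
    refine (HasDerivAt.fun_sum fun j _ =>
      ((hasDerivAt_id ζ).sub_const (y j)).inv (hne ζ h j)).congr_deriv ?_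
    simp only [hS, id, ← Finset.sum_neg_distrib]
    refine Finset.sum_congr rfl fun j _ => ?_
    rw [inv_pow, neg_div, one_div]
  set φ : ℝ → ℝ := fun ζ => (ζ - ζ₀) * (ζ₁ - ζ) with hφ
  set q := ζ₁ - ζ₀ with hq
  have hφ' : ∀ ζ, HasDerivAt φ (ζ₁ + ζ₀ - 2 * ζ) ζ := by
    intro ζ
    refine (((hasDerivAt_id ζ).sub_const ζ₀).mul ((hasDerivAt_id ζ).const_sub ζ₁)).congr_deriv ?_
    simp
    ring
  -- `R` is the antiderivative, vanishing at `ζ₀`, of `D φ² - ζ₁ φ'²`, and `U` adds to it the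
  -- boundary terms of the integration by parts, which vanish at both ends
  set R : ℝ → ℝ := fun ζ => D * (q ^ 2 * (ζ - ζ₀) ^ 3 / 3 - q * (ζ - ζ₀) ^ 4 / 2 +
      (ζ - ζ₀) ^ 5 / 5) -
      ζ₁ * (q ^ 2 * (ζ - ζ₀) - 2 * q * (ζ - ζ₀) ^ 2 + 4 * (ζ - ζ₀) ^ 3 / 3) with hR
  have hR' : ∀ ζ, HasDerivAt R (D * φ ζ ^ 2 - ζ₁ * (ζ₁ + ζ₀ - 2 * ζ) ^ 2) ζ := by
    intro ζ
    have p := (hasDerivAt_id ζ).sub_const ζ₀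
    have := (((((p.pow 3).const_mul (q ^ 2)).div_const 3).sub
      (((p.pow 4).const_mul q).div_const 2)).add ((p.pow 5).div_const 5)).const_mul D |>.sub
      ((((p.const_mul (q ^ 2)).sub ((p.pow 2).const_mul (2 * q))).add
        (((p.pow 3).const_mul 4).div_const 3)).const_mul ζ₁)
    refine this.congr_deriv ?_
    simp [hφ, hq]
    ring
  set U : ℝ → ℝ := fun ζ => ν * (φ ζ ^ 2 * (ζ * G ζ)) - ν * (φ ζ ^ 2 * (t * ζ - d)) / 2 + R ζ
    with hU
  set U' : ℝ → ℝ := fun ζ =>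
    ν * (2 * φ ζ * (ζ₁ + ζ₀ - 2 * ζ) * (ζ * G ζ) + φ ζ ^ 2 * (G ζ - ζ * S ζ)) -
    ν * (2 * φ ζ * (ζ₁ + ζ₀ - 2 * ζ) * (t * ζ - d) + φ ζ ^ 2 * t) / 2 +
    (D * φ ζ ^ 2 - ζ₁ * (ζ₁ + ζ₀ - 2 * ζ) ^ 2) with hU'
  have hUd : ∀ ζ, ζ₀ ≤ ζ → HasDerivAt U (U' ζ) ζ := by
    intro ζ h
    have h1 := (hφ' ζ).pow 2
    have h2 := (hasDerivAt_id ζ).mul (hG' ζ h)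
    have h3 := ((hasDerivAt_id ζ).const_mul t).sub_const d
    refine ((((h1.mul h2).const_mul ν).sub (((h1.mul h3).const_mul ν).div_const 2)).add
      (hR' ζ)).congr_deriv ?_
    simp only [hU', id, Pi.mul_apply, Pi.pow_apply, Nat.cast_ofNat, Nat.reduceSub, pow_one]
    ring
  have hends : U ζ₁ - U ζ₀ = D * (q ^ 5 / 30) - ζ₁ * (q ^ 3 / 3) := by
    simp only [hU, hφ, hR, sub_self, zero_mul, mul_zero, ← hq]
    ring
  rw [← hends]
  have hcont : ContinuousOn (fun ζ => φ ζ ^ 2 * loopQuadratic (d + ν) β t ζ y)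
      (Set.Icc ζ₀ ζ₁) := by
    have hGc : ContinuousOn G (Set.Icc ζ₀ ζ₁) := fun ζ h =>
      (hG' ζ h.1).continuousAt.continuousWithinAt
    have hSc : ContinuousOn S (Set.Icc ζ₀ ζ₁) := by
      refine continuousOn_finsetSum _ fun j _ => ?_
      exact ((continuousOn_id.sub continuousOn_const).inv₀ fun ζ h => hne ζ h.1 j).pow 2
    have e : (fun ζ => φ ζ ^ 2 * loopQuadratic (d + ν) β t ζ y) = fun ζ => φ ζ ^ 2 *
      (ζ * G ζ ^ 2 - ν * ζ * S ζ - (t * ζ - (d + ν)) * G ζ + n * t) := rfl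
    rw [e]
    simp only [hφ]
    fun_prop
  refine intervalIntegral.sub_le_integral_of_hasDeriv_right_of_le hζ.le
    (g' := U') (fun ζ h => (hUd ζ h.1).continuousAt.continuousWithinAt)
    (fun ζ h => (hUd ζ h.1.le).hasDerivWithinAt) (hcont.integrableOn_Icc) fun ζ h => ?_
  have hζp : 0 < ζ := by linarith [h.1]
  have hDζ := hD ζ ⟨h.1.le, h.2.le⟩
  change _ ≤ φ ζ ^ 2 * (ζ * G ζ ^ 2 - ν * ζ * S ζ - (t * ζ - (d + ν)) * G ζ + n * t)
  set ψ := ζ₁ + ζ₀ - 2 * ζ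
  have hsq : 0 ≤ ζ * (φ ζ * G ζ - (φ ζ * (t * ζ - d) + 2 * ν * ψ * ζ) / (2 * ζ)) ^ 2 := by
    positivity
  -- the cross term `φ φ' (t ζ - d)` of the completed square is the one produced by `U`
  have hid : φ ζ ^ 2 * (ζ * G ζ ^ 2 - ν * ζ * S ζ - (t * ζ - (d + ν)) * G ζ + n * t) - U' ζ =
      ζ * (φ ζ * G ζ - (φ ζ * (t * ζ - d) + 2 * ν * ψ * ζ) / (2 * ζ)) ^ 2 +
      φ ζ ^ 2 * (t * (n - 1 / 2) - (t * ζ - d) ^ 2 / (4 * ζ) - D) +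
      φ ζ ^ 2 * t * (1 + ν) / 2 + (ζ₁ - ν ^ 2 * ζ) * ψ ^ 2 := by
    simp only [hU']
    field_simp
    ring
  have h2 := mul_nonneg (sq_nonneg (φ ζ)) (sub_nonneg.2 hDζ)
  have h3 : 0 ≤ φ ζ ^ 2 * t * (1 + ν) / 2 := by
    have : 0 ≤ 1 + ν := by linarith
    positivity
  have h4 : 0 ≤ (ζ₁ - ν ^ 2 * ζ) * ψ ^ 2 := by
    have h5 : ν ^ 2 ≤ 1 := (sq_le_one_iff_abs_le_one ν).2 (abs_le.2 ⟨hν1, hν2⟩)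
    have h6 : ν ^ 2 * ζ ≤ ζ := mul_le_of_le_one_left hζp.le h5
    exact mul_nonneg (sub_nonneg.2 (h6.trans h.2.le)) (sq_nonneg ψ)
  rw [← sub_nonneg, hid]
  exact add_nonneg (add_nonneg (add_nonneg hsq h2) h3) h4

/-- Lower bound on the drift `n κ - t E[∑ y]` of the ensemble confined to `(0, t)`, when the
quadratic loop equation has no real root on an interval of length large enough. -/
theorem hardWall_drift_ge {a β t κ ζ₀ ζ₁ D : ℝ} (hβ : 1 ≤ β) (hκ : (n : ℝ) < κ + 1) (ht : 0 < t)
    (ha : a = β / 2 * (κ - n + 1) - 1) (hζ₀ : 1 < ζ₀) (hζ : ζ₀ < ζ₁)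
    (hD : ∀ ζ ∈ Set.Icc ζ₀ ζ₁, D ≤ t * (n - 1 / 2) - (t * ζ - (κ - n)) ^ 2 / (4 * ζ))
    (hDq : 20 * ζ₁ ≤ D * (ζ₁ - ζ₀) ^ 2) :
    D / 2 * (ζ₀ - 1) * gibbsMoment n a 0 β (β / 2 * t) 0 ≤
      n * κ * gibbsMoment n a 0 β (β / 2 * t) 0 - t * gibbsMoment n a 0 β (β / 2 * t) 1 := by
  have hβ0 : 0 < β := by linarith
  have ha1 : -1 < a := by
    rw [ha]
    have : 0 < β / 2 * (κ - n + 1) := by apply mul_pos <;> linarith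
    linarith
  have hθ : 0 < β / 2 * t := by positivity
  have hq : 0 < ζ₁ - ζ₀ := by linarith
  have hζ1 : 0 < ζ₀ - 1 := by linarith
  set W : (Fin n → ℝ) → ℝ := gibbsWeight a 0 β (β / 2 * t) with hW
  set m₀ := gibbsMoment n a 0 β (β / 2 * t) 0 with hm₀
  set X := n * κ * m₀ - t * gibbsMoment n a 0 β (β / 2 * t) 1 with hX
  have hm₀nn : 0 ≤ m₀ := gibbsMoment_nonneg 0
  have hm₀W : m₀ = ∫ y in unitCube n, W y := by
    simp only [hm₀, gibbsMoment, pow_zero, one_mul, hW]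
  have iW : IntegrableOn W (unitCube n) := integrableOn_gibbsWeight ha1 (by norm_num) hβ0.le hθ.le
  set φ : ℝ → ℝ := fun ζ => (ζ - ζ₀) * (ζ₁ - ζ) with hφ
  have hc : 2 * a / β = (κ - n) + (1 - 2 / β) := by
    rw [ha]
    field_simp
    ring
  have hloop : ∀ ζ ∈ Set.uIcc ζ₀ ζ₁, X * (φ ζ ^ 2 / (ζ - 1)) =
      ∫ y in unitCube n, φ ζ ^ 2 * loopQuadratic (2 * a / β) β t ζ y * W y := by
    intro ζ h
    rw [Set.uIcc_of_le hζ.le] at h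
    have h1 : 0 < ζ - 1 := by linarith [h.1]
    simp only [mul_assoc]
    rw [hX, hardWall_loop_equation hβ hκ ht ha (by linarith : 1 < ζ), integral_const_mul]
    change (ζ - 1) * (∫ y in unitCube n, loopQuadratic (2 * a / β) β t ζ y * W y) *
      (φ ζ ^ 2 / (ζ - 1)) = _
    field_simp
  set B := ζ₁ * (n * (ζ₀ - 1)⁻¹) ^ 2 + |1 - 2 / β| * ζ₁ * (n * ((ζ₀ - 1)⁻¹) ^ 2) +
      (t * ζ₁ + |2 * a / β|) * (n * (ζ₀ - 1)⁻¹) + n * t with hB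
  have hint : Integrable (Function.uncurry fun ζ y =>
      φ ζ ^ 2 * loopQuadratic (2 * a / β) β t ζ y * W y)
      ((volume.restrict (Set.Ioc ζ₀ ζ₁)).prod (volume.restrict (unitCube n))) := by
    have hdom : Integrable (fun p : ℝ × (Fin n → ℝ) => ((ζ₁ - ζ₀) ^ 2) ^ 2 * B * W p.2)
      ((volume.restrict (Set.Ioc ζ₀ ζ₁)).prod (volume.restrict (unitCube n))) :=
      Integrable.mul_prod (f := fun _ : ℝ => ((ζ₁ - ζ₀) ^ 2) ^ 2 * B) (integrable_const _) iW
    refine hdom.mono' ?_ ?_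
    · have hWm : Measurable W := measurable_gibbsWeight a 0 β (β / 2 * t)
      refine Measurable.aestronglyMeasurable ?_
      simp only [Function.uncurry_def, loopQuadratic, hφ]
      fun_prop
    · rw [Measure.prod_restrict]
      filter_upwards [ae_restrict_mem (measurableSet_Ioc.prod measurableSet_unitCube)] with p hp
      have h1 := abs_loopQuadratic_le (c := 2 * a / β) (β := β) ht hζ₀ hp.1.1.le hp.1.2 hp.2
      have h2 : |φ p.1| ≤ (ζ₁ - ζ₀) ^ 2 := by
        have e1 : 0 ≤ p.1 - ζ₀ := by linarith [hp.1.1]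
        have e2 : 0 ≤ ζ₁ - p.1 := by linarith [hp.1.2]
        rw [abs_of_nonneg (mul_nonneg e1 e2), sq]
        exact mul_le_mul (by linarith) (by linarith) e2 hq.le
      simp only [Function.uncurry_def]
      rw [norm_mul, norm_mul, norm_pow, Real.norm_of_nonneg (gibbsWeight_nonneg hp.2)]
      refine mul_le_mul_of_nonneg_right ?_ (gibbsWeight_nonneg hp.2)
      exact mul_le_mul (pow_le_pow_left₀ (norm_nonneg _) h2 2) h1 (norm_nonneg _) (by positivity)
  have hfub : X * ∫ ζ in ζ₀..ζ₁, φ ζ ^ 2 / (ζ - 1) =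
      ∫ y in unitCube n, (∫ ζ in ζ₀..ζ₁, φ ζ ^ 2 * loopQuadratic (2 * a / β) β t ζ y) * W y := by
    rw [← intervalIntegral.integral_const_mul, intervalIntegral.integral_congr hloop,
      intervalIntegral.integral_of_le hζ.le, integral_integral_swap hint]
    congr 1
    ext y
    rw [integral_mul_const, intervalIntegral.integral_of_le hζ.le]
  have hlow : (D * ((ζ₁ - ζ₀) ^ 5 / 30) - ζ₁ * ((ζ₁ - ζ₀) ^ 3 / 3)) * m₀ ≤
      X * ∫ ζ in ζ₀..ζ₁, φ ζ ^ 2 / (ζ - 1) := by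
    rw [hfub, hm₀W, ← integral_const_mul]
    refine setIntegral_mono_on (iW.const_mul _) ?_ measurableSet_unitCube fun y hy => ?_
    · have := hint.integral_prod_right
      refine this.congr (Filter.Eventually.of_forall fun y => ?_)
      simp only [Function.uncurry_def]
      rw [integral_mul_const, intervalIntegral.integral_of_le hζ.le]
    · refine mul_le_mul_of_nonneg_right ?_ (gibbsWeight_nonneg hy)
      rw [hc]
      exact integral_loopQuadratic_ge hβ ht hζ₀ hζ hD hy
  -- the kinetic term costs at most half of the potential term
  have hLB : D * ((ζ₁ - ζ₀) ^ 5 / 60) ≤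
      D * ((ζ₁ - ζ₀) ^ 5 / 30) - ζ₁ * ((ζ₁ - ζ₀) ^ 3 / 3) := by
    have := mul_le_mul_of_nonneg_right hDq (by positivity : 0 ≤ (ζ₁ - ζ₀) ^ 3 / 60)
    nlinarith
  have hφint : ∫ ζ in ζ₀..ζ₁, φ ζ ^ 2 = (ζ₁ - ζ₀) ^ 5 / 30 := by
    have hd : ∀ ζ ∈ Set.uIcc ζ₀ ζ₁, HasDerivAt (fun ζ => (ζ₁ - ζ₀) ^ 2 * (ζ - ζ₀) ^ 3 / 3 -
        (ζ₁ - ζ₀) * (ζ - ζ₀) ^ 4 / 2 + (ζ - ζ₀) ^ 5 / 5) (φ ζ ^ 2) ζ := by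
      intro ζ _
      have p := (hasDerivAt_id ζ).sub_const ζ₀
      refine (((((p.pow 3).const_mul ((ζ₁ - ζ₀) ^ 2)).div_const 3).sub
        (((p.pow 4).const_mul (ζ₁ - ζ₀)).div_const 2)).add
        ((p.pow 5).div_const 5)).congr_deriv ?_
      simp [hφ]
      ring
    rw [intervalIntegral.integral_eq_sub_of_hasDerivAt hd
      (Continuous.intervalIntegrable (by fun_prop) _ _)]
    ring
  have hne : ∀ ζ ∈ Set.Icc ζ₀ ζ₁, ζ - 1 ≠ 0 := fun ζ h => by linarith [h.1]
  have hIc : ContinuousOn (fun ζ => φ ζ ^ 2 / (ζ - 1)) (Set.Icc ζ₀ ζ₁) := by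
    simp only [hφ]
    fun_prop (disch := assumption)
  have hIi : IntervalIntegrable (fun ζ => φ ζ ^ 2 / (ζ - 1)) volume ζ₀ ζ₁ :=
    hIc.intervalIntegrable_of_Icc hζ.le
  have hIpos : 0 < ∫ ζ in ζ₀..ζ₁, φ ζ ^ 2 / (ζ - 1) := by
    refine intervalIntegral.intervalIntegral_pos_of_pos_on hIi (fun ζ h => ?_) hζ
    have e0 : 0 < ζ - 1 := by linarith [h.1]
    have e1 : 0 < ζ - ζ₀ := by linarith [h.1]
    have e2 : 0 < ζ₁ - ζ := by linarith [h.2]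
    simp only [hφ]
    positivity
  have hIle : ∫ ζ in ζ₀..ζ₁, φ ζ ^ 2 / (ζ - 1) ≤ (ζ₁ - ζ₀) ^ 5 / 30 / (ζ₀ - 1) := by
    rw [← hφint, ← intervalIntegral.integral_div]
    refine intervalIntegral.integral_mono_on hζ.le hIi
      (Continuous.intervalIntegrable (by fun_prop) _ _) fun ζ h => ?_
    have := h.1
    gcongr
  have hDpos : 0 < D := by
    by_contra hneg
    push Not at hneg
    nlinarith [sq_nonneg (ζ₁ - ζ₀)]
  have hXI : D * ((ζ₁ - ζ₀) ^ 5 / 60) * m₀ ≤ X * ∫ ζ in ζ₀..ζ₁, φ ζ ^ 2 / (ζ - 1) :=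
    (mul_le_mul_of_nonneg_right hLB hm₀nn).trans hlow
  have hXnn : 0 ≤ X := nonneg_of_mul_nonneg_left ((by positivity :
    0 ≤ D * ((ζ₁ - ζ₀) ^ 5 / 60) * m₀).trans hXI) hIpos
  have h5 := hXI.trans (mul_le_mul_of_nonneg_left hIle hXnn)
  have h6 : 0 < (ζ₁ - ζ₀) ^ 5 / 30 / (ζ₀ - 1) := by positivity
  refine le_of_mul_le_mul_right ?_ h6
  calc D / 2 * (ζ₀ - 1) * m₀ * ((ζ₁ - ζ₀) ^ 5 / 30 / (ζ₀ - 1)) =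
        D * ((ζ₁ - ζ₀) ^ 5 / 60) * m₀ := by
        field_simp
        ring
    _ ≤ _ := h5

end HardWall

/-! ### The distribution function of the largest point below the edge -/

section LowerTail

variable {n : ℕ}

/-- The distribution function of the largest point is, up to normalisation, the partition function
of the ensemble confined to `(0, t)`. -/
theorem laguerreWeight_largestPoint_le {a κ β t : ℝ} (hn : 1 ≤ n) (hκ : (n : ℝ) < κ + 1)
    (hβ : 0 < β) (ha : a = β / 2 * (κ - n + 1) - 1) (ht : 0 < t) :
    laguerreWeight n κ β {x | largestPoint x ≤ t} = ENNReal.ofReal (scaledGibbs n a 0 β t) := by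
  have ha1 : -1 < a := by
    rw [ha]
    have : 0 < β / 2 * (κ - n + 1) := by apply mul_pos <;> linarith
    linarith
  have : Nonempty (Fin n) := ⟨⟨0, hn⟩⟩
  have hset : {x : Fin n → ℝ | largestPoint x ≤ t} = Set.univ.pi fun _ => Set.Iic t := by
    ext x
    simp only [Set.mem_pi, Set.mem_univ, true_implies, Set.mem_Iic]
    exact ciSup_le_iff (Set.finite_range x).bddAbove
  have hm : MeasurableSet (Set.univ.pi fun _ : Fin n => Set.Iic t) :=
    MeasurableSet.univ_pi fun _ => measurableSet_Iic
  have hae : (Set.univ.pi fun _ : Fin n => Set.Ioc 0 t) =ᵐ[volume]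
      Set.univ.pi fun _ : Fin n => Set.Ioo 0 t :=
    (Measure.univ_pi_Ioc_ae_eq_Icc (f := fun _ : Fin n => (0 : ℝ)) (g := fun _ => t)).trans
      (Measure.univ_pi_Ioo_ae_eq_Icc (f := fun _ : Fin n => (0 : ℝ)) (g := fun _ => t)).symm
  rw [hset, laguerreWeight, withDensity_apply _ hm, Measure.restrict_restrict hm,
    ← Set.pi_inter_distrib]
  simp only [Set.inter_comm (Set.Iic t), Set.Ioi_inter_Iic]
  rw [setLIntegral_congr hae, ← setLIntegral_conditionedWeight ha1 (by norm_num) hβ.le ht]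
  congr 1
  ext x
  simp only [conditionedWeight, Real.rpow_zero, Finset.prod_const_one, one_mul, ha]
  rfl

/-- A lower bound `x` for the drift on `[t₁, t₂]` makes the distribution function of the largest
point grow at least like `t ^ (β x / 2)` there. -/
theorem laguerreEnsemble_largestPoint_le_le {a κ β x t₁ t₂ : ℝ} (hn : 1 ≤ n)
    (hκ : (n : ℝ) < κ + 1) (hβ : 0 < β) (ha : a = β / 2 * (κ - n + 1) - 1) (ht₁ : 0 < t₁)
    (ht : t₁ ≤ t₂)
    (hdrift : ∀ t ∈ Set.Icc t₁ t₂, x * gibbsMoment n a 0 β (β / 2 * t) 0 ≤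
      n * κ * gibbsMoment n a 0 β (β / 2 * t) 0 - t * gibbsMoment n a 0 β (β / 2 * t) 1) :
    (laguerreEnsemble n κ β).real {y | largestPoint y ≤ t₁} ≤ (t₁ / t₂) ^ (β / 2 * x) := by
  have ha1 : -1 < a := by
    rw [ha]
    have : 0 < β / 2 * (κ - n + 1) := by apply mul_pos <;> linarith
    linarith
  have ht₂ : 0 < t₂ := ht₁.trans_le ht
  set M := gibbsDegree n a 0 β with hM
  have hMκ : M = β / 2 * (n * κ) := by
    rw [hM, gibbsDegree, ha]
    ring
  have hmono : MonotoneOn (fun t => t ^ (-(β / 2 * x)) * scaledGibbs n a 0 β t)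
      (Set.Icc t₁ t₂) := by
    have hd : ∀ t, 0 < t → HasDerivAt (fun t => t ^ (-(β / 2 * x)) * scaledGibbs n a 0 β t)
        (t ^ (-(β / 2 * x)) * t ^ (M - 1) * (scaledGibbsDrift n a 0 β t -
          β / 2 * x * gibbsMoment n a 0 β (β / 2 * t) 0)) t := by
      intro t ht
      refine (((hasDerivAt_id t).rpow_const (p := -(β / 2 * x)) (Or.inl ht.ne')).mul
        (hasDerivAt_scaledGibbs ha1 (by norm_num) hβ ht)).congr_deriv ?_
      have e : t ^ M = t ^ (M - 1) * t := by
        rw [← Real.rpow_add_one ht.ne', sub_add_cancel]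
      simp only [id, scaledGibbs, ← hM]
      rw [e, Real.rpow_sub_one ht.ne']
      field_simp
      ring
    refine monotoneOn_of_hasDerivWithinAt_nonneg (convex_Icc t₁ t₂)
      (f' := fun t => t ^ (-(β / 2 * x)) * t ^ (M - 1) * (scaledGibbsDrift n a 0 β t -
          β / 2 * x * gibbsMoment n a 0 β (β / 2 * t) 0))
      (fun t h => (hd t (ht₁.trans_le h.1)).continuousAt.continuousWithinAt)
      (fun t h => (hd t (ht₁.trans_le (interior_subset h).1)).hasDerivWithinAt) fun t h => ?_
    have h' := interior_subset h
    have htp := ht₁.trans_le h'.1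
    have h1 := mul_le_mul_of_nonneg_left (hdrift t h') (by positivity : 0 ≤ β / 2)
    refine mul_nonneg (by positivity) ?_
    rw [scaledGibbsDrift, ← hM, hMκ]
    linarith
  have h1 := hmono ⟨le_rfl, ht⟩ ⟨ht, le_rfl⟩ ht
  have h2 : scaledGibbs n a 0 β t₁ ≤ (t₁ / t₂) ^ (β / 2 * x) * scaledGibbs n a 0 β t₂ := by
    simp only [Real.rpow_neg ht₁.le, Real.rpow_neg ht₂.le] at h1
    rw [Real.div_rpow ht₁.le ht₂.le]
    have hp : 0 < t₁ ^ (β / 2 * x) := by positivity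
    have h3 := mul_le_mul_of_nonneg_left h1 hp.le
    rw [mul_inv_cancel_left₀ hp.ne'] at h3
    calc _ ≤ _ := h3
      _ = _ := by ring
  have h3 : laguerreWeight n κ β {y | largestPoint y ≤ t₁} ≤
      ENNReal.ofReal ((t₁ / t₂) ^ (β / 2 * x)) * laguerreWeight n κ β Set.univ := by
    calc _ ≤ ENNReal.ofReal ((t₁ / t₂) ^ (β / 2 * x)) *
          laguerreWeight n κ β {y | largestPoint y ≤ t₂} := by
          rw [laguerreWeight_largestPoint_le hn hκ hβ ha ht₁,
            laguerreWeight_largestPoint_le hn hκ hβ ha ht₂, ← ENNReal.ofReal_mul (by positivity)]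
          exact ENNReal.ofReal_le_ofReal h2
      _ ≤ _ := by
          gcongr
          exact Set.subset_univ _
  refine ENNReal.toReal_le_of_le_ofReal (by positivity) ?_
  rw [laguerreEnsemble, Measure.smul_apply, smul_eq_mul]
  calc _ ≤ (laguerreWeight n κ β Set.univ)⁻¹ * (ENNReal.ofReal ((t₁ / t₂) ^ (β / 2 * x)) *
        laguerreWeight n κ β Set.univ) := by gcongr
    _ = ENNReal.ofReal ((t₁ / t₂) ^ (β / 2 * x)) := by
        rw [mul_left_comm, ENNReal.inv_mul_cancel (laguerreWeight_univ_ne_zero _ _ _)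
          (laguerreWeight_univ_ne_top _ hκ hβ), mul_one]

theorem gibbsMoment_one_le {a s β θ : ℝ} (ha : -1 < a) (hs : -1 < s) (hβ : 0 ≤ β) (hθ : 0 ≤ θ) :
    gibbsMoment n a s β θ 1 ≤ n * gibbsMoment n a s β θ 0 := by
  unfold gibbsMoment
  rw [← integral_const_mul]
  refine setIntegral_mono_on (integrableOn_pow_mul_gibbsWeight ha hs hβ hθ 1)
    ((integrableOn_pow_mul_gibbsWeight ha hs hβ hθ 0).const_mul _) measurableSet_unitCube
    fun y hy => ?_
  rw [pow_zero, one_mul, pow_one]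
  exact mul_le_mul_of_nonneg_right ((le_abs_self _).trans (abs_sum_unitCube_le hy))
    (gibbsWeight_nonneg hy)

/-- The drift below the edge `(r + w)²`, with `r = √κ` and `w = √n`, at relative depth `ε`, once
both candidate exponents `n κ ε²` and `√n κ^(3/2) ε³` are large. -/
theorem drift_ge_below_edge {a β t κ ε r w : ℝ} (hβ : 1 ≤ β) (hκ : (n : ℝ) < κ + 1)
    (ha : a = β / 2 * (κ - n + 1) - 1) (hr : 0 < r) (hw : 1 ≤ w) (hrκ : κ = r ^ 2)
    (hwn : (n : ℝ) = w ^ 2) (hwr : w ^ 2 ≤ 2 * r ^ 2) (hε : 0 < ε) (ht : 0 < t)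
    (hE1 : 250000 ≤ (r * w * ε) ^ 2) (hE2 : 250000 ≤ w * r ^ 3 * ε ^ 3)
    (htε : t ≤ (r + w) ^ 2 * (1 - ε / 2)) :
    min ((r * w) ^ 2 * ε / 4) (w * r ^ 3 * ε ^ 2 / 336) * gibbsMoment n a 0 β (β / 2 * t) 0 ≤
      n * κ * gibbsMoment n a 0 β (β / 2 * t) 0 - t * gibbsMoment n a 0 β (β / 2 * t) 1 := by
  have hβ0 : 0 < β := by linarith
  have ha1 : -1 < a := by
    rw [ha]
    have : 0 < β / 2 * (κ - n + 1) := by apply mul_pos <;> linarith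
    linarith
  have hw0 : 0 < w := by linarith
  have hrw : 0 < r * w := mul_pos hr hw0
  set b := (r + w) ^ 2 with hb
  have hb0 : 0 < b := by positivity
  have hbr : r ^ 2 ≤ b := by
    rw [hb]
    nlinarith
  have hm₀ : 0 ≤ gibbsMoment n a 0 β (β / 2 * t) 0 := gibbsMoment_nonneg 0
  rcases le_or_gt (14 * (r * w)) (b * ε) with hA | hB
  · -- far from the edge, all points being below `t` is enough
    have hw32 : w ≤ 3 / 2 * r := by nlinarith
    have h1 := mul_le_mul_of_nonneg_left (gibbsMoment_one_le (n := n) (s := 0) ha1 (by norm_num)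
      hβ0.le (by positivity : 0 ≤ β / 2 * t)) ht.le
    have h2 : b * ε / 4 ≤ κ - t := by
      have : w ^ 2 ≤ 3 / 2 * (r * w) := by nlinarith
      rw [hrκ]
      nlinarith
    have h3 : (r * w) ^ 2 * ε / 4 ≤ n * (κ - t) := by
      rw [hwn]
      calc (r * w) ^ 2 * ε / 4 = w ^ 2 * (r ^ 2 * ε / 4) := by ring
        _ ≤ w ^ 2 * (b * ε / 4) := by gcongr
        _ ≤ w ^ 2 * (κ - t) := by gcongr
    calc _ ≤ (n * (κ - t)) * gibbsMoment n a 0 β (β / 2 * t) 0 :=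
          mul_le_mul_of_nonneg_right ((min_le_left _ _).trans h3) hm₀
      _ ≤ _ := by linarith
  · -- near the edge, the quadratic has no real root on `[b - 2 ℓ, b - ℓ]`
    -- `ℓ` is a small multiple of the depth `b ε`, so that `b - 2 ℓ` stays above `t` by `b ε / 3`
    set ℓ := b * ε / 14 with hℓ
    have hℓ0 : 0 < ℓ := by positivity
    have hℓrw : ℓ ≤ r * w := by
      rw [hℓ]
      linarith
    have hgap : b * ε / 3 ≤ b - 2 * ℓ - t := by
      have : 0 < b * ε := by positivity
      rw [hℓ]
      linarith
    -- on the window, minus the discriminant of the quadratic is at least `4 ζ t D₀`; since `r w ε`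
    -- is large, `1 ≤ D₀`, so that the correction `t / 2` costs at most half of `t D₀`
    set D₀ := r * w * ℓ / (2 * b) with hD₀
    have hD₀1 : 1 ≤ D₀ := by
      have h28 : 28 ≤ r * w * ε := by
        refine le_of_pow_le_pow_left₀ two_ne_zero (by positivity) ?_
        linarith
      have : D₀ = r * w * ε / 28 := by
        rw [hD₀, hℓ]
        field_simp
        ring
      rw [this]
      linarith
    -- the window is longer than the fluctuation scale of the edge
    have hkin : 80 * b ^ 2 ≤ r * w * ℓ ^ 3 := by
      have h1 : 250000 ≤ b * (r * w * ε ^ 3) := by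
        refine hE2.trans ?_
        have := mul_le_mul_of_nonneg_right hbr (by positivity : 0 ≤ r * w * ε ^ 3)
        linarith
      have h2 : r * w * ℓ ^ 3 = b ^ 2 * (b * (r * w * ε ^ 3)) / 2744 := by
        rw [hℓ]
        ring
      rw [h2]
      have h3 := mul_le_mul_of_nonneg_left h1 (sq_nonneg b)
      have h4 := sq_nonneg b
      linarith
    have hdrift := hardWall_drift_ge (n := n) (a := a) (t := t) (κ := κ) (ζ₀ := (b - 2 * ℓ) / t)
      (ζ₁ := (b - ℓ) / t) (D := t * (D₀ / 2)) hβ hκ ht ha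
      (by
        rw [one_lt_div ht]
        have : 0 < b * ε := by positivity
        linarith)
      (by
        gcongr
        linarith)
      (by
        intro ζ hζ
        have hz1 : b - 2 * ℓ ≤ t * ζ := by
          have := (div_le_iff₀ ht).1 hζ.1
          linarith
        have hz2 : t * ζ ≤ b - ℓ := by
          have := (le_div_iff₀ ht).1 hζ.2
          linarith
        have hz0 : 0 < t * ζ := by
          have : 0 < b * ε := by positivity
          linarith
        have hζ0 : 0 < ζ := pos_of_mul_pos_right hz0 ht.le
        have e1 : t * (n - 1 / 2) - (t * ζ - (κ - n)) ^ 2 / (4 * ζ) =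
            t * ((t * ζ - (r - w) ^ 2) * (b - t * ζ) / (4 * (t * ζ)) - 1 / 2) := by
          rw [hrκ, hwn, hb]
          field_simp
          ring
        rw [e1]
        refine mul_le_mul_of_nonneg_left ?_ ht.le
        have h1 : 2 * (r * w) ≤ t * ζ - (r - w) ^ 2 := by
          have : b - (r - w) ^ 2 = 4 * (r * w) := by
            rw [hb]
            ring
          linarith
        have h2 : D₀ ≤ (t * ζ - (r - w) ^ 2) * (b - t * ζ) / (4 * (t * ζ)) := by
          have e2 : D₀ = 2 * (r * w) * ℓ / (4 * b) := by
            rw [hD₀]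
            field_simp
            ring
          rw [e2]
          have h3 : ℓ ≤ b - t * ζ := by linarith
          have h4 : 0 ≤ b - t * ζ := by linarith
          have h5 : 0 ≤ t * ζ - (r - w) ^ 2 := by linarith
          exact div_le_div₀ (mul_nonneg h5 h4) (mul_le_mul h1 h3 hℓ0.le h5) (by positivity)
            (by linarith)
        linarith)
      (by
        have e1 : t * (D₀ / 2) * ((b - ℓ) / t - (b - 2 * ℓ) / t) ^ 2 =
            r * w * ℓ ^ 3 / (4 * b * t) := by
          rw [hD₀]
          field_simp
          ring
        rw [e1, ← mul_div_assoc, div_le_div_iff₀ ht (by positivity)]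
        have h5 : 20 * (b - ℓ) * (4 * b * t) ≤ 80 * b ^ 2 * t := by
          have : 0 ≤ 80 * (ℓ * b * t) := by positivity
          linarith
        exact h5.trans (mul_le_mul_of_nonneg_right hkin ht.le))
    refine le_trans (mul_le_mul_of_nonneg_right ?_ hm₀) hdrift
    have e1 : t * (D₀ / 2) / 2 * ((b - 2 * ℓ) / t - 1) = D₀ / 4 * (b - 2 * ℓ - t) := by
      field_simp
      ring
    rw [e1]
    calc min ((r * w) ^ 2 * ε / 4) (w * r ^ 3 * ε ^ 2 / 336) ≤ w * r ^ 3 * ε ^ 2 / 336 :=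
          min_le_right _ _
      _ ≤ r * w * b * ε ^ 2 / 336 := by
          have := mul_le_mul_of_nonneg_left hbr (by positivity : 0 ≤ r * w * ε ^ 2)
          linarith
      _ = D₀ / 4 * (b * ε / 3) := by
          rw [hD₀, hℓ]
          field_simp
          ring
      _ ≤ _ := by gcongr

end LowerTail

/-! ### Small deviations of the largest point -/

section SmallDeviations

variable {n : ℕ}

theorem rpow_quarter_eq {r w : ℝ} (hr : 0 < r) (hw : 0 < w) :
    (r ^ 2 / w ^ 2) ^ (1 / 4 : ℝ) = Real.sqrt (r * w) / w := by
  have h : r * w = (r / w) * w ^ 2 := by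
    field_simp
  rw [h, Real.sqrt_mul (by positivity), Real.sqrt_sq hw.le, mul_div_cancel_right₀ _ hw.ne',
    ← div_pow, ← Real.rpow_natCast, ← Real.rpow_mul (by positivity), Real.sqrt_eq_rpow]
  norm_num

/-- Upper tail in terms of `r = √κ` and `w = √n`. -/
theorem largestPoint_upper_tail {κ β ε r w : ℝ} (hn : 1 ≤ n) (hκ : (n : ℝ) < κ + 1) (hβ : 1 ≤ β)
    (hε : 0 < ε) (hε1 : ε ≤ 1) (hr : 0 < r) (hw : 1 ≤ w) (hrκ : κ = r ^ 2)
    (hwn : (n : ℝ) = w ^ 2) :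
    (laguerreEnsemble n κ β).real {x | (r + w) ^ 2 * (1 + ε) ≤ largestPoint x} ≤
      Real.exp (-(β * (r * Real.sqrt (r * w) * (ε * Real.sqrt ε) / 4))) := by
  obtain ⟨m, rfl⟩ : ∃ m, n = m + 1 := ⟨n - 1, by omega⟩
  have hm : (m : ℝ) = w ^ 2 - 1 := by
    rw [← hwn]
    push_cast
    ring
  have hw0 : 0 < w := by linarith
  have hrw : 0 < r * w := mul_pos hr hw0
  have hrw2 : w ^ 2 - 1 < r ^ 2 := by
    rw [← hwn, ← hrκ]
    linarith
  set b := (r + w) ^ 2 with hb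
  have hb0 : 0 < b := by positivity
  -- `4 t² ρ²` is a fixed share of the discriminant `(t - (r - w) ^ 2) (t - b)` for
  -- `t ≥ b (1 + ε / 2)`; the decay is then collected over the second half of the interval
  set ρ := Real.sqrt (ε * (r * w) / 3) / (r + w) with hρ
  have hρ2 : ρ ^ 2 = ε * (r * w) / (3 * b) := by
    rw [hρ, div_pow, Real.sq_sqrt (by positivity), hb]
    field_simp
  have key := laguerreEnsemble_largestPoint_ge_le (n := m) (κ := κ) (β := β) (ρ := ρ)
    (t₀ := b * (1 + ε / 2)) (δ := b * (ε / 2)) hκ hβ (by positivity) ?_ ?_ (by positivity)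
  · have e : b * (1 + ε / 2) + b * (ε / 2) = b * (1 + ε) := by ring
    rw [e] at key
    refine key.trans (Real.exp_le_exp.2 (neg_le_neg ?_))
    rw [mul_assoc β]
    refine mul_le_mul_of_nonneg_left ?_ (by linarith)
    have h1 : ρ * (b * (ε / 2)) = Real.sqrt (ε * (r * w) / 3) * (r + w) * (ε / 2) := by
      rw [hρ, hb]
      field_simp
    have h2 : Real.sqrt ε * Real.sqrt (r * w) / 2 ≤ Real.sqrt (ε * (r * w) / 3) := by
      refine Real.le_sqrt_of_sq_le ?_
      rw [div_pow, mul_pow, Real.sq_sqrt hε.le, Real.sq_sqrt hrw.le]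
      have : 0 < ε * (r * w) := by positivity
      linarith
    rw [h1]
    calc r * Real.sqrt (r * w) * (ε * Real.sqrt ε) / 4 =
          Real.sqrt ε * Real.sqrt (r * w) / 2 * r * (ε / 2) := by ring
      _ ≤ Real.sqrt (ε * (r * w) / 3) * (r + w) * (ε / 2) := by
          gcongr
          linarith
  · have h1 : b ≤ b * (1 + ε / 2) := le_mul_of_one_le_right hb0.le (by linarith)
    have h2 : κ - m < b := by
      rw [hrκ, hm, hb]
      nlinarith
    linarith
  · intro t ht
    have htb : b ≤ t := by
      have h1 : b ≤ b * (1 + ε / 2) := le_mul_of_one_le_right hb0.le (by linarith)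
      linarith
    have ht0 : 0 < t := by linarith
    have e1 : (t - (κ - m)) ^ 2 - 4 * m * (t + 1 / 3) = (t - (r - w) ^ 2) * (t - b) +
        (2 * t + 2 * r ^ 2 - 2 * w ^ 2 + 1 - 4 * (w ^ 2 - 1) / 3) := by
      rw [hrκ, hm, hb]
      ring
    have h1 : 0 < 2 * t + 2 * r ^ 2 - 2 * w ^ 2 + 1 - 4 * (w ^ 2 - 1) / 3 := by
      have : b = r ^ 2 + 2 * (r * w) + w ^ 2 := by
        rw [hb]
        ring
      nlinarith
    have h2 : t * (ε / 3) ≤ t - b := by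
      have h3 : b ≤ b * ((1 + ε / 2) * (1 - ε / 3)) := by
        refine le_mul_of_one_le_right hb0.le ?_
        nlinarith
      have h4 := mul_le_mul_of_nonneg_right ht (by linarith : 0 ≤ 1 - ε / 3)
      linarith
    have h3 : t * (4 * (r * w) / b) ≤ t - (r - w) ^ 2 := by
      have e2 : t - (r - w) ^ 2 - t * (4 * (r * w) / b) = (r - w) ^ 2 * ((t - b) / b) := by
        have : (r - w) ^ 2 = b - 4 * (r * w) := by
          rw [hb]
          ring
        rw [this]
        field_simp
        ring
      have : 0 ≤ (r - w) ^ 2 * ((t - b) / b) :=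
        mul_nonneg (sq_nonneg _) (div_nonneg (by linarith) hb0.le)
      linarith
    have h4 : 4 * t ^ 2 * ρ ^ 2 ≤ (t - (r - w) ^ 2) * (t - b) := by
      calc 4 * t ^ 2 * ρ ^ 2 = (t * (4 * (r * w) / b)) * (t * (ε / 3)) := by
            rw [hρ2]
            field_simp
        _ ≤ _ := mul_le_mul h3 h2 (by positivity) (le_trans (by positivity) h3)
    linarith

/-- Lower tail in terms of `r = √κ` and `w = √n`, when both candidate exponents `n κ ε²` and
`√n κ^(3/2) ε³` are large. -/
theorem largestPoint_lower_tail {κ β ε r w : ℝ} (hn : 1 ≤ n) (hκ : (n : ℝ) < κ + 1) (hβ : 1 ≤ β)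
    (hε : 0 < ε) (hε1 : ε ≤ 1) (hr : 0 < r) (hw : 1 ≤ w) (hrκ : κ = r ^ 2)
    (hwn : (n : ℝ) = w ^ 2) (hE1 : 250000 ≤ (r * w * ε) ^ 2)
    (hE2 : 250000 ≤ w * r ^ 3 * ε ^ 3) :
    (laguerreEnsemble n κ β).real {x | largestPoint x ≤ (r + w) ^ 2 * (1 - ε)} ≤
      Real.exp (-(β * min ((r * w * ε) ^ 2) (w * r ^ 3 * ε ^ 3) / 1344)) := by
  have hβ0 : 0 < β := by linarith
  have hw0 : 0 < w := by linarith
  have hrw : 0 < r * w := mul_pos hr hw0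
  set b := (r + w) ^ 2 with hb
  have hb0 : 0 < b := by positivity
  rcases hε1.eq_or_lt with rfl | hε1
  · -- for `ε = 1` the event is null, all points being positive
    have hzero : laguerreWeight n κ β {x | largestPoint x ≤ b * (1 - 1)} = 0 := by
      have hS : MeasurableSet (Set.univ.pi fun _ : Fin n => Set.Ioi (0 : ℝ)) :=
        MeasurableSet.univ_pi fun _ => measurableSet_Ioi
      refine withDensity_absolutelyContinuous _ _ ?_
      refine measure_mono_null (t := (Set.univ.pi fun _ : Fin n => Set.Ioi (0 : ℝ))ᶜ)
        (fun x hx hxS => ?_) ?_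
      · have h1 : x ⟨0, hn⟩ ≤ largestPoint x := le_ciSup (Set.finite_range x).bddAbove _
        have h2 : 0 < x ⟨0, hn⟩ := hxS _ (Set.mem_univ _)
        have h3 : largestPoint x ≤ b * (1 - 1) := hx
        linarith
      · rw [Measure.restrict_apply hS.compl, Set.compl_inter_self, measure_empty]
    rw [Measure.real, laguerreEnsemble, Measure.smul_apply, hzero, smul_zero]
    simpa using (Real.exp_pos _).le
  · -- for `n ≥ 2` this is `κ > n - 1`; for `n = 1` it holds because `κ` is large
    have hwr : w ^ 2 ≤ 2 * r ^ 2 := by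
      rcases hn.eq_or_lt with h1 | h2
      · have hw1 : w ^ 2 = 1 := by
          rw [← hwn, ← h1]
          norm_num
        have : 250000 ≤ r ^ 2 := by
          refine hE1.trans ?_
          rw [mul_pow, mul_pow, hw1, mul_one]
          exact mul_le_of_le_one_right (sq_nonneg r) (pow_le_one₀ hε.le hε1.le)
        linarith
      · have : (2 : ℝ) ≤ n := by exact_mod_cast h2
        rw [← hwn, ← hrκ]
        linarith
    obtain ⟨a, ha⟩ : ∃ a : ℝ, a = β / 2 * (κ - n + 1) - 1 := ⟨_, rfl⟩
    set x := min ((r * w) ^ 2 * ε / 4) (w * r ^ 3 * ε ^ 2 / 336) with hx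
    have hx0 : 0 ≤ x := by positivity
    have ht₁ : 0 < b * (1 - ε) := mul_pos hb0 (by linarith)
    have ht₂ : 0 < b * (1 - ε / 2) := mul_pos hb0 (by linarith)
    have key := laguerreEnsemble_largestPoint_le_le (n := n) (a := a) (κ := κ) (β := β) (x := x)
      (t₁ := b * (1 - ε)) (t₂ := b * (1 - ε / 2)) hn hκ hβ0 ha ht₁
      (by
        gcongr
        linarith)
      (fun t h => drift_ge_below_edge hβ hκ ha hr hw hrκ hwn hwr hε (ht₁.trans_le h.1) hE1 hE2
        h.2)
    refine key.trans ?_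
    have h1 : b * (1 - ε) / (b * (1 - ε / 2)) ≤ Real.exp (-(ε / 2)) := by
      have h2 : b * (1 - ε) / (b * (1 - ε / 2)) ≤ 1 - ε / 2 := by
        rw [div_le_iff₀ ht₂]
        nlinarith [mul_nonneg hb0.le (sq_nonneg ε)]
      have h3 := Real.add_one_le_exp (-(ε / 2))
      linarith
    calc (b * (1 - ε) / (b * (1 - ε / 2))) ^ (β / 2 * x) ≤
          Real.exp (-(ε / 2)) ^ (β / 2 * x) :=
          Real.rpow_le_rpow (by positivity) h1 (by positivity)
      _ = Real.exp (-(β * (ε * x) / 4)) := by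
          rw [← Real.exp_mul]
          congr 1
          ring
      _ ≤ _ := by
          refine Real.exp_le_exp.2 (neg_le_neg ?_)
          have h4 : min ((r * w * ε) ^ 2) (w * r ^ 3 * ε ^ 3) / 336 ≤ ε * x := by
            rw [hx, mul_min_of_nonneg _ _ hε.le]
            refine le_min ?_ ?_
            · have := min_le_left ((r * w * ε) ^ 2) (w * r ^ 3 * ε ^ 3)
              have h5 := sq_nonneg (r * w * ε)
              have h6 : ε * ((r * w) ^ 2 * ε / 4) = (r * w * ε) ^ 2 / 4 := by ring
              linarith
            · have := min_le_right ((r * w * ε) ^ 2) (w * r ^ 3 * ε ^ 3)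
              have h6 : ε * (w * r ^ 3 * ε ^ 2 / 336) = w * r ^ 3 * ε ^ 3 / 336 := by ring
              linarith
          have h7 := mul_le_mul_of_nonneg_left h4 hβ0.le
          linarith

end SmallDeviations

theorem theorem2 :
    ∃ C : ℝ, 0 < C ∧
      ∀ (n : ℕ) (κ β ε : ℝ), 1 ≤ n → (n : ℝ) < κ + 1 → 1 ≤ β → 0 < ε → ε ≤ 1 →
        (laguerreEnsemble n κ β).real
            {x | (Real.sqrt κ + Real.sqrt n) ^ 2 * (1 + ε) ≤ largestPoint x} ≤
          C * Real.exp (-(β * Real.sqrt (n * κ) * ε ^ (3 / 2 : ℝ) *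
            min (1 / Real.sqrt ε) ((κ / n) ^ (1 / 4 : ℝ))) / C) ∧
        (laguerreEnsemble n κ β).real
            {x | largestPoint x ≤ (Real.sqrt κ + Real.sqrt n) ^ 2 * (1 - ε)} ≤
          C ^ β * Real.exp (-(β * (n * κ) * ε ^ 3 *
            min (1 / ε) ((κ / n) ^ (1 / 2 : ℝ))) / C) := by
  refine ⟨250000, by norm_num, fun n κ β ε hn hκ hβ hε hε1 => ?_⟩
  have hn1 : (1 : ℝ) ≤ n := by exact_mod_cast hn
  have hβ0 : 0 < β := by linarith
  have hκ0 : 0 < κ := by linarith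
  obtain ⟨r, hr⟩ : ∃ r, r = Real.sqrt κ := ⟨_, rfl⟩
  obtain ⟨w, hw⟩ : ∃ w, w = Real.sqrt n := ⟨_, rfl⟩
  have hr0 : 0 < r := hr ▸ Real.sqrt_pos.2 hκ0
  have hw1 : 1 ≤ w := hw ▸ Real.one_le_sqrt.2 hn1
  have hw0 : 0 < w := by linarith
  have hrκ : κ = r ^ 2 := by rw [hr, Real.sq_sqrt hκ0.le]
  have hwn : (n : ℝ) = w ^ 2 := by rw [hw, Real.sq_sqrt (by linarith)]
  have hrw : 0 < r * w := mul_pos hr0 hw0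
  rw [← hr, ← hw]
  constructor
  · refine (largestPoint_upper_tail hn hκ hβ hε hε1 hr0 hw1 hrκ hwn).trans ?_
    have hε32 : ε ^ (3 / 2 : ℝ) = ε * Real.sqrt ε := by
      rw [Real.sqrt_eq_rpow, ← Real.rpow_one_add' hε.le (by norm_num)]
      norm_num
    have hsq : Real.sqrt (n * κ) = w * r := by
      rw [hwn, hrκ, ← mul_pow, Real.sqrt_sq (by positivity)]
    have hpow : (κ / n) ^ (1 / 4 : ℝ) = Real.sqrt (r * w) / w := by
      rw [hwn, hrκ]
      exact rpow_quarter_eq hr0 hw0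
    rw [hε32, hsq, hpow]
    have hX : β * (w * r) * (ε * Real.sqrt ε) * min (1 / Real.sqrt ε) (Real.sqrt (r * w) / w) ≤
        β * (r * Real.sqrt (r * w) * (ε * Real.sqrt ε)) := by
      calc _ ≤ β * (w * r) * (ε * Real.sqrt ε) * (Real.sqrt (r * w) / w) := by
            gcongr
            exact min_le_right _ _
        _ = _ := by
            field_simp
    have hX0 : 0 ≤ β * (r * Real.sqrt (r * w) * (ε * Real.sqrt ε)) := by positivity
    refine le_trans (Real.exp_le_exp.2 ?_) (le_mul_of_one_le_left (Real.exp_pos _).le (by norm_num))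
    rw [neg_div, neg_le_neg_iff, div_le_iff₀ (by norm_num)]
    linarith
  · have hpow : (κ / n) ^ (1 / 2 : ℝ) = r / w := by
      rw [hwn, hrκ, ← div_pow, ← Real.sqrt_eq_rpow, Real.sqrt_sq (by positivity)]
    have hE : β * (n * κ) * ε ^ 3 * min (1 / ε) ((κ / n) ^ (1 / 2 : ℝ)) =
        β * min ((r * w * ε) ^ 2) (w * r ^ 3 * ε ^ 3) := by
      rw [hpow, hwn, hrκ, mul_assoc, mul_assoc, ← mul_assoc (w ^ 2 * r ^ 2),
        mul_min_of_nonneg _ _ (by positivity)]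
      congr 2 <;> field_simp
    rw [hE]
    set E := min ((r * w * ε) ^ 2) (w * r ^ 3 * ε ^ 3) with hEdef
    have hE0 : 0 ≤ E := by positivity
    rcases le_or_gt E 250000 with hsmall | hlarge
    · -- the right-hand side is at least `(C / e) ^ β ≥ 1`
      have := isProbabilityMeasure_laguerreEnsemble n hκ hβ0
      refine measureReal_le_one.trans ?_
      have h1 : Real.exp (-β) ≤ Real.exp (-(β * E) / 250000) := by
        refine Real.exp_le_exp.2 ?_
        rw [le_div_iff₀ (by norm_num)]
        have := mul_le_mul_of_nonneg_left hsmall hβ0.le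
        linarith
      have h2 : Real.exp 1 ≤ 250000 := by
        have := Real.exp_one_lt_d9
        linarith
      calc (1 : ℝ) = Real.exp 1 ^ β * Real.exp (-β) := by
            rw [← Real.exp_mul, ← Real.exp_add, one_mul, add_neg_cancel, Real.exp_zero]
        _ ≤ 250000 ^ β * Real.exp (-(β * E) / 250000) := by gcongr
    · refine (largestPoint_lower_tail hn hκ hβ hε hε1 hr0 hw1 hrκ hwn (hlarge.le.trans (min_le_left _ _))
        (hlarge.le.trans (min_le_right _ _))).trans ?_
      refine le_trans (Real.exp_le_exp.2 ?_) (le_mul_of_one_le_left (Real.exp_pos _).le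
        (Real.one_le_rpow (by norm_num) hβ0.le))
      rw [neg_div, neg_le_neg_iff, ← hEdef]
      have : 0 ≤ β * E := by positivity
      gcongr
      norm_num
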